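/- Let $d\ge 1$ and let $\Omega^*=\begin{pmatrix}1&\delta^\top\\ \delta&\bar\Omega\end{pmatrix}$ be a full-rank $(d+1)\times(d+1)$ correlation matrix, $\delta\in\mathbb{R}^d$. Let $U^*=(U_0,U)$, with $U_0$ scalar and $U$ $d$-dimensional, have the elliptical density $c_{d+1}|\Omega^*|^{-1/2}\tilde f\{u^\top(\Omega^*)^{-1}u\}$ on $\mathbb{R}^{d+1}$, where $\tilde f:[0,\infty)\to[0,\infty)$ is the density generator and $c_{d+1}$ the normalising constant. Let $Z=(U\mid U_0>0)$, let $f_U$ be the density of $U$, and put $\alpha=(1-\delta^\top\bar\Omega^{-1}\delta)^{-1/2}\,\bar\Omega^{-1}\delta$ and $Q_z=z^\top\bar\Omega^{-1}z$. For $q\ge 0$ let $F^{q}(y)=\int_{-\infty}^{y}\tilde f(q+x^2)\,dx\big/\int_{-\infty}^{\infty}\tilde f(q+x^2)\,dx$ be the distribution function of the conditional generator, so that $Z$ has density $2f_U(z)F^{Q_z}(\alpha^\top z)$. Then: (i) Suppose $d\ge 2$ and $\delta\ne 0$ (equivalently $\alpha\neq 0$). The density of $Z$ can be written as $2f_U(z)F\{w(z)\}$,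 with $F$ a (fixed) distribution function on $\mathbb{R}$, $w(z)=h(\alpha^\top z,Q_z)$ for some function $h$, and $w(z)=\alpha^\top z$ for all $z$, if and only if $U^*$ is Gaussian. (ii) For every $d\ge1$ and every $\delta$, the conditional distribution function $F^{Q_z}$ does not depend on $Q_z$ (that is, there is one distribution function $F$ on $\mathbb{R}$ with $F^{Q_z}(y)=F(y)$ for all $y\in\mathbb{R}$, for almost every $z$ with $f_U(z)\ne0$) if and only if $U^*$ is Gaussian. (iii) For every $d\ge1$ and every $\delta$, the following are equivalent: $U^*$ is Gaussian; $Z\sim\mathrm{SN}_d(0,\sigma^2\bar\Omega,\alpha)$ for some $\sigma>0$; $Z$ is skew normal, that is, $Z\sim\mathrm{SN}_d(\xi,\Omega,\alpha')$ for some $\xi,\alpha'\in\mathbb{R}^d$ and some full-rank covariance matrix $\Omega$. Here $\mathrm{SN}_d(\xi,\Omega,\alpha)$ is the law with density $2\,\phi_d(z-\xi;\Omega)\,\Phi(\alpha^\top\omega^{-1}(z-\xi))$, where $\phi_d(\cdot\,;\Omega)$ is the $\mathrm{N}_d(0,\Omega)$ density, $\Phi$ the standard normal distribution function, and $\omega$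 the diagonal matrix of the square roots of the diagonal entries of $\Omega$. -/

import Mathlib

open MeasureTheory ProbabilityTheory
open scoped Matrix

noncomputable section

/-- The quadratic form `xᵀ A⁻¹ x`. -/
def invQuadForm {ι : Type*} [Fintype ι] [DecidableEq ι] (A : Matrix ι ι ℝ)
    (x : EuclideanSpace ℝ ι) : ℝ :=
  x.ofLp ⬝ᵥ (A⁻¹ *ᵥ x.ofLp)

/-- The normalising constant `c` of a density generator `f` on `ℝ^ι`, i.e. the inverse of
`∫ f (‖x‖²) dx`. -/
def ellipticalConst (ι : Type*) [Fintype ι] (f : ℝ → ℝ) : ℝ :=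
  (∫ x : EuclideanSpace ℝ ι, f (‖x‖ ^ 2))⁻¹

/-- The elliptical density `c |A|^{-1/2} f ((y - ξ)ᵀ A⁻¹ (y - ξ))`. -/
def ellipticalDensity {ι : Type*} [Fintype ι] [DecidableEq ι] (ξ : EuclideanSpace ℝ ι)
    (A : Matrix ι ι ℝ) (f : ℝ → ℝ) (y : EuclideanSpace ℝ ι) : ℝ :=
  ellipticalConst ι f / √A.det * f (invQuadForm A (y - ξ))

/-- `Y ∼ Ell(ξ, A, f)` under `P`: the matrix `A` is symmetric positive definite, the density
generator `f` is a nonnegative measurable function on `[0, ∞)` (its values at negative arguments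
play no role), and `Y` has the elliptical density.  Under a probability measure this forces
`x ↦ f (‖x‖²)` to be integrable with positive integral: otherwise `ellipticalConst` is `0`. -/
structure IsElliptical {S : Type*} [MeasurableSpace S] (P : Measure S) {ι : Type*} [Fintype ι]
    [DecidableEq ι] (Y : S → EuclideanSpace ℝ ι) (ξ : EuclideanSpace ℝ ι) (A : Matrix ι ι ℝ)
    (f : ℝ → ℝ) : Prop where
  posDef : A.PosDef
  measurable_generator : Measurable f
  generator_nonneg : ∀ t, 0 ≤ t → 0 ≤ f t
  aemeasurable : AEMeasurable Y P
  law : P.map Y = volume.withDensity (fun y => ENNReal.ofReal (ellipticalDensity ξ A f y))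

/-- A full-rank correlation matrix. -/
def IsFullRankCorrelation {ι : Type*} (A : Matrix ι ι ℝ) : Prop :=
  A.PosDef ∧ ∀ i, A i i = 1

/-- The block matrix `Ω* = [[1, δᵀ], [δ, Ω̄]]`. -/
def starMatrix {d : ℕ} (δ : Fin d → ℝ) (Ωbar : Matrix (Fin d) (Fin d) ℝ) :
    Matrix (Unit ⊕ Fin d) (Unit ⊕ Fin d) ℝ :=
  Matrix.fromBlocks 1 (Matrix.replicateRow Unit δ) (Matrix.replicateCol Unit δ) Ωbar

/-- The point `(u₀, u)` of `ℝ^(1 + d)`. -/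
def joinVec {d : ℕ} (u₀ : ℝ) (u : EuclideanSpace ℝ (Fin d)) :
    EuclideanSpace ℝ (Unit ⊕ Fin d) :=
  WithLp.toLp 2 (Sum.elim (fun _ => u₀) u.ofLp)

/-- The `d`-dimensional component `u` of `(u₀, u)`. -/
def vecPart {d : ℕ} (x : EuclideanSpace ℝ (Unit ⊕ Fin d)) : EuclideanSpace ℝ (Fin d) :=
  WithLp.toLp 2 (fun i => x.ofLp (Sum.inr i))

/-- The shape parameter `α = (1 - δᵀ Ω̄⁻¹ δ)^{-1/2} Ω̄⁻¹ δ`. -/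
def shapeParam {d : ℕ} (δ : Fin d → ℝ) (Ωbar : Matrix (Fin d) (Fin d) ℝ) : Fin d → ℝ :=
  (1 / √(1 - δ ⬝ᵥ (Ωbar⁻¹ *ᵥ δ))) • (Ωbar⁻¹ *ᵥ δ)

/-- The density `f_U` of the component `U` of `U* = (U₀, U) ∼ Ell(0, Ω*, f)`, i.e. the joint
density integrated over `u₀`. -/
def marginalDensity {d : ℕ} (δ : Fin d → ℝ) (Ωbar : Matrix (Fin d) (Fin d) ℝ) (f : ℝ → ℝ)
    (z : EuclideanSpace ℝ (Fin d)) : ℝ :=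
  ∫ u₀ : ℝ, ellipticalDensity 0 (starMatrix δ Ωbar) f (joinVec u₀ z)

/-- The conditional density generator `f^q (x) = f (q + x)`.  Given `U = z`, the standardised
variable `(U₀ - δᵀ Ω̄⁻¹ z) / (1 - δᵀ Ω̄⁻¹ δ)^{1/2}` has density `c₁ f^q (y²)` with
`q = zᵀ Ω̄⁻¹ z`. -/
def condGenerator (f : ℝ → ℝ) (q x : ℝ) : ℝ := f (q + x)

/-- The distribution function `F^q` of the conditional density generator `f^q`:
`F^q (y) = ∫_{-∞}^y c₁ f^q (x²) dx`, where `1 / c₁` is the integral of `f^q (x²)` over `ℝ`. -/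
def condDistFun (f : ℝ → ℝ) (q y : ℝ) : ℝ :=
  (∫ x in Set.Iic y, condGenerator f q (x ^ 2)) / ∫ x : ℝ, condGenerator f q (x ^ 2)

/-- The law of `Z = (U | U₀ > 0)`. -/
def skewLaw {S : Type*} [MeasurableSpace S] (P : Measure S) {d : ℕ}
    (Ustar : S → EuclideanSpace ℝ (Unit ⊕ Fin d)) : Measure (EuclideanSpace ℝ (Fin d)) :=
  (ProbabilityTheory.cond P {s | 0 < (Ustar s).ofLp (Sum.inl ())}).map
    (fun s => vecPart (Ustar s))

/-- `Z = (U | U₀ > 0)` has density `2 f_U(z) F(w(z))`, where `F` is the distribution function of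
the probability measure `ν` on `ℝ`, and `w(z) = h (αᵀ z, zᵀ Ω̄⁻¹ z)` for some function `h`. -/
def IsSkewingRepresentation {S : Type*} [MeasurableSpace S] (P : Measure S) {d : ℕ}
    (Ustar : S → EuclideanSpace ℝ (Unit ⊕ Fin d)) (δ : Fin d → ℝ)
    (Ωbar : Matrix (Fin d) (Fin d) ℝ) (f : ℝ → ℝ) (ν : Measure ℝ)
    (w : EuclideanSpace ℝ (Fin d) → ℝ) : Prop :=
  IsProbabilityMeasure ν ∧
  (∃ h : ℝ → ℝ → ℝ, ∀ z, w z = h (shapeParam δ Ωbar ⬝ᵥ z.ofLp) (invQuadForm Ωbar z)) ∧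
  skewLaw P Ustar =
    volume.withDensity (fun z => ENNReal.ofReal (2 * marginalDensity δ Ωbar f z * cdf ν (w z)))

/-- The density of `N_d(0, A)` at `x`. -/
def normalDensity {d : ℕ} (A : Matrix (Fin d) (Fin d) ℝ) (x : EuclideanSpace ℝ (Fin d)) : ℝ :=
  (2 * Real.pi) ^ (-(d : ℝ) / 2) / √A.det * Real.exp (-(invQuadForm A x) / 2)

/-- The skew normal density `2 φ_d(z - ξ; A) Φ(αᵀ ω⁻¹ (z - ξ))`, where `ω` is the diagonal matrix
of the square roots of the diagonal entries of `A`. -/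
def skewNormalDensity {d : ℕ} (ξ : EuclideanSpace ℝ (Fin d)) (A : Matrix (Fin d) (Fin d) ℝ)
    (α : Fin d → ℝ) (z : EuclideanSpace ℝ (Fin d)) : ℝ :=
  2 * normalDensity A (z - ξ) *
    cdf (gaussianReal 0 1) (∑ i, α i * ((z - ξ).ofLp i / √(A i i)))

/-- `μ` is the skew normal law `SN_d(ξ, A, α)`. -/
def IsSkewNormal {d : ℕ} (μ : Measure (EuclideanSpace ℝ (Fin d))) (ξ : EuclideanSpace ℝ (Fin d))
    (A : Matrix (Fin d) (Fin d) ℝ) (α : Fin d → ℝ) : Prop :=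
  A.PosDef ∧
    μ = volume.withDensity (fun z => ENNReal.ofReal (skewNormalDensity ξ A α z))

end

/-! Given `U = z`, completing the square in the quadratic form of `Ω*` leaves `Q_z` plus the square
of a standardised `u₀`, so `Z` has density `2 f_U(z) F^{Q_z}(αᵀz)`. If the generator is a multiple
of `exp(-bt)`, the factor `exp(-b Q_z)` cancels in `F^{Q_z}`, and the Gaussian direction of every
equivalence follows. The converses need two different arguments.

For (i) and (ii), the generator `f` satisfies `∫₀^y f(q + x²) dx = g(q) F(y)`: the left side
separates in `q` and `y`. In (ii) this holds for all `y ≥ 0`. In (i) only the pairs `(Q_z, αᵀz)` are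
available; for `d ≥ 2` they fill a cone `|y| < a√q`, because the sphere is connected. As `f` is
merely measurable, one integrates over `q > r` first. The tail `Φ(r) = ∫_r^∞ f` is continuous (the
dimension `d + 1 ≥ 2` makes it finite), so one may differentiate in `y`, and eliminating `g` gives
`Φ(r + x) Φ(s) = Φ(r) Φ(s + x)` for `x` small against `r` and `s`. Hence `Φ`, and then `f` almost
everywhere, is exponential (`ae_eq_exp_of_separated`).

For (iii), project a skew normal `Z` on its slant direction. After standardising `U*` to a radial
law, some functional `⟪a, w⟫`, restricted to a half space `⟪b, w⟫ > 0`, has half the law of `m + sY`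
with `Y` univariate skew normal of slant `β`. If `m = 0`, testing against even functions and using
`Φ(x) + Φ(-x) = 1` for the normal distribution function shows that `⟪a, w⟫` is `N(0, s²)`; a radial
law with one nondegenerate centred normal projection is normal, as its characteristic function
depends on the norm only.

To see that `m = 0`, compare the largest `l` for which `exp(l ⟪a, w⟫²)` is integrable over the two
wedges `±⟪a, w⟫ > 0`, `⟪b, w⟫ > 0`. The geometry of the wedges and the tails of the skew normal law
both determine the ratio of these thresholds, and so `β` must be the slant that a Gaussian law with
the same `a`, `b` would have (`IsHalfSkewNormal.slant_eq`). The probability of a wedge is the same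
for all radial probability laws, so it equals its Gaussian value, and this forces `m = 0`. -/

noncomputable section

/-! ### Polar coordinates and null sets -/

section Polar

/-- Null sets of `(0, ∞)` pull back to null sets under `x ↦ q + x ^ 2`. -/
theorem ae_comp_add_sq {p : ℝ → Prop} (h : ∀ᵐ t ∂volume.restrict (Set.Ioi (0 : ℝ)), p t)
    {q : ℝ} (hq : 0 ≤ q) : ∀ᵐ x : ℝ, p (q + x ^ 2) := by
  rw [ae_restrict_iff' measurableSet_Ioi] at h
  have hN : volume ({t | ¬ (t ∈ Set.Ioi (0 : ℝ) → p t)} ∩ Set.Ioi q) = 0 :=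
    measure_mono_null Set.inter_subset_left h
  set N := {t | ¬ (t ∈ Set.Ioi (0 : ℝ) → p t)} ∩ Set.Ioi q with hNdef
  -- The inverse branches `±√(t - q)` are differentiable for `t > q`, so they preserve null sets;
  -- only the point `x = 0` is missed.
  have hd : DifferentiableOn ℝ (fun t => √(t - q)) N := by
    intro t ht
    have : t - q ≠ 0 := by have : q < t := ht.2; linarith
    exact (((differentiableAt_id.sub_const q)).sqrt this).differentiableWithinAt
  have h1 := addHaar_image_eq_zero_of_differentiableOn_of_addHaar_eq_zero volume hd hN
  have h2 := addHaar_image_eq_zero_of_differentiableOn_of_addHaar_eq_zero volume hd.neg hN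
  have h3 : volume ({0} : Set ℝ) = 0 := by simp
  refine measure_mono_null ?_ (measure_union_null (measure_union_null h1 h2) h3)
  intro x hx
  have hx' : ¬ p (q + x ^ 2) := hx
  by_cases hx0 : x = 0
  · right; exact hx0
  left
  have hpos : 0 < x ^ 2 := by positivity
  have hmem : q + x ^ 2 ∈ N := by
    refine ⟨fun hh => hx' (hh ?_), ?_⟩
    · exact Set.mem_Ioi.2 (by linarith)
    · exact Set.mem_Ioi.2 (by linarith)
  rcases le_total 0 x with h | h
  · left
    refine ⟨_, hmem, ?_⟩
    simp [Real.sqrt_sq h]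
  · right
    refine ⟨_, hmem, ?_⟩
    simp [Real.sqrt_sq_eq_abs, abs_of_nonpos h]

theorem ae_Ioi_of_ae_sq {p : ℝ → Prop}
    (h : ∀ᵐ r ∂volume.restrict (Set.Ioi (0 : ℝ)), p (r ^ 2)) :
    ∀ᵐ t ∂volume.restrict (Set.Ioi (0 : ℝ)), p t := by
  rw [ae_restrict_iff' measurableSet_Ioi] at h ⊢
  have hd : DifferentiableOn ℝ (fun t : ℝ => t ^ 2) {r | ¬ (r ∈ Set.Ioi (0 : ℝ) → p (r ^ 2))} := by
    fun_prop
  refine measure_mono_null ?_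
    (addHaar_image_eq_zero_of_differentiableOn_of_addHaar_eq_zero volume hd h)
  intro t ht
  have ht' : ¬ (t ∈ Set.Ioi (0 : ℝ) → p t) := ht
  push Not at ht'
  have h0 : 0 < t := ht'.1
  refine ⟨√t, ?_, Real.sq_sqrt h0.le⟩
  simp only [Set.mem_ofPred_eq, Real.sq_sqrt h0.le]
  push Not
  exact ⟨Real.sqrt_pos.2 h0, ht'.2⟩

variable {E : Type*} [NormedAddCommGroup E] [InnerProductSpace ℝ E] [FiniteDimensional ℝ E]
  [MeasurableSpace E] [BorelSpace E] [Nontrivial E]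

theorem lintegral_polar {h : E → ENNReal} (hh : Measurable h) :
    ∫⁻ w, h w = ∫⁻ s, (∫⁻ r in Set.Ioi (0 : ℝ),
      ENNReal.ofReal (r ^ (Module.finrank ℝ E - 1)) * h (r • (s : E)))
        ∂(volume : Measure E).toSphere := by
  have hmp := (volume : Measure E).measurePreserving_homeomorphUnitSphereProd
  have hsymm : Measurable (homeomorphUnitSphereProd E).symm :=
    (homeomorphUnitSphereProd E).symm.continuous.measurable
  have h1 : ∫⁻ w, h w = ∫⁻ x : ({0}ᶜ : Set E), h x ∂((volume : Measure E).comap (↑)) := by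
    rw [lintegral_subtype_comap (measurableSet_singleton _).compl h,
      restrict_compl_singleton]
  have h2 := hmp.lintegral_comp (hh.comp (measurable_subtype_coe.comp hsymm))
  simp only [Function.comp_apply, Homeomorph.symm_apply_apply] at h2
  have h3 := lintegral_prod (μ := (volume : Measure E).toSphere)
    (ν := .volumeIoiPow (Module.finrank ℝ E - 1)) _
    (hh.comp (measurable_subtype_coe.comp hsymm)).aemeasurable
  simp only [Function.comp_apply] at h3
  rw [h1, h2, h3]
  refine lintegral_congr fun s => ?_
  rw [Measure.volumeIoiPow, lintegral_withDensity_eq_lintegral_mul _ (by fun_prop)]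
  · rw [← lintegral_subtype_comap measurableSet_Ioi (μ := volume)
      (fun r : ℝ => ENNReal.ofReal (r ^ (Module.finrank ℝ E - 1)) * h (r • (s : E)))]
    simp [homeomorphUnitSphereProd_symm_apply_coe]
  · exact (hh.comp (measurable_subtype_coe.comp hsymm)).comp measurable_prodMk_left

/-- Fubini in polar coordinates, with the radius outermost: fixing a good radius fixes `Q_z` while
the direction still varies. -/
theorem ae_polar {p : E → Prop} (h : ∀ᵐ w : E, p w) :
    ∀ᵐ r ∂volume.restrict (Set.Ioi (0 : ℝ)), ∀ᵐ s ∂(volume : Measure E).toSphere,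
      p (r • s.val) := by
  obtain ⟨N, hsub, hmeas, hN⟩ := exists_measurable_superset_of_null h
  have hm : Measurable (N.indicator (1 : E → ENNReal)) := measurable_one.indicator hmeas
  have h1 := lintegral_polar hm
  rw [lintegral_indicator_one hmeas, hN, lintegral_lintegral_swap] at h1
  · rw [eq_comm, lintegral_eq_zero_iff] at h1
    · filter_upwards [h1, ae_restrict_mem measurableSet_Ioi] with r hr hr0
      have hr0' : (0 : ℝ) < r := hr0
      rw [Pi.zero_apply, lintegral_eq_zero_iff (by fun_prop)] at hr
      filter_upwards [hr] with s hs
      by_contra hcon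
      have hmem : r • (s : E) ∈ N := hsub hcon
      simp only [Pi.zero_apply, hmem, Set.indicator_of_mem, Pi.one_apply, mul_one,
        ENNReal.ofReal_eq_zero] at hs
      exact absurd hs (not_le.2 (by positivity))
    · exact Measurable.lintegral_prod_left' (f := fun z : (Metric.sphere (0 : E) 1) × ℝ =>
        ENNReal.ofReal (z.2 ^ (Module.finrank ℝ E - 1)) *
          N.indicator (1 : E → ENNReal) (z.2 • (z.1 : E))) (by fun_prop)
  · exact Measurable.aemeasurable (by fun_prop)

theorem ae_norm_sq {p : ℝ → Prop} (h : ∀ᵐ t ∂volume.restrict (Set.Ioi (0 : ℝ)), p t) :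
    ∀ᵐ w : E, p (‖w‖ ^ 2) := by
  have h' : ∀ᵐ r ∂volume.restrict (Set.Ioi (0 : ℝ)), p (r ^ 2) := by
    have := ae_comp_add_sq h le_rfl
    simp only [zero_add] at this
    exact ae_restrict_of_ae this
  obtain ⟨N, hsub, hmeas, hN⟩ := exists_measurable_superset_of_null h'
  have hm : Measurable (((fun w : E => ‖w‖) ⁻¹' N).indicator (1 : E → ENNReal)) :=
    measurable_one.indicator (hmeas.preimage measurable_norm)
  have hz : volume ((fun w : E => ‖w‖) ⁻¹' N) = 0 := by
    rw [← lintegral_indicator_one (hmeas.preimage measurable_norm), lintegral_polar hm]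
    refine (lintegral_congr fun s => ?_).trans lintegral_zero
    refine lintegral_eq_zero_of_ae_eq_zero ?_
    have hN' : ∀ᵐ r ∂volume.restrict (Set.Ioi (0 : ℝ)), r ∉ N := measure_eq_zero_iff_ae_notMem.1 hN
    filter_upwards [hN', ae_restrict_mem measurableSet_Ioi] with r hr hr0
    have hr0' : (0 : ℝ) < r := hr0
    have : r • (s : E) ∉ (fun w : E => ‖w‖) ⁻¹' N := by
      simpa [norm_smul, abs_of_pos hr0'] using hr
    simp [this]
  refine measure_mono_null ?_ hz
  intro w hw
  exact hsub hw

/-- The spherical measure is nonzero, so almost every radius has at least one good direction, and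
the property depends on the radius alone. -/
theorem ae_Ioi_of_ae_norm_sq {p : ℝ → Prop} (h : ∀ᵐ w : E, p (‖w‖ ^ 2)) :
    ∀ᵐ t ∂volume.restrict (Set.Ioi (0 : ℝ)), p t := by
  refine ae_Ioi_of_ae_sq ?_
  filter_upwards [ae_polar h, ae_restrict_mem measurableSet_Ioi] with r hr hr0
  have hr0' : (0 : ℝ) < r := hr0
  have : NeZero (volume : Measure E).toSphere := ⟨(volume : Measure E).toSphere_ne_zero⟩
  have hr' := hr.exists
  obtain ⟨s, hs⟩ := hr'
  simpa [norm_smul, abs_of_pos hr0', norm_eq_of_mem_sphere s] using hs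

end Polar

/-! ### The functional equation for the tail of the generator -/

section ExponentialTail

open Filter Topology

/-- `Φ` need not be differentiable, but its integral `J` over windows of length `h` is, with `J'(r)
= Φ(r + h) - Φ(r)`. Integrating the hypothesis over `x` makes `J` proportional to `Φ`, and the case
`x = h` makes `Φ(r + h)` proportional to `Φ(r)` with a fixed factor; so `J' = kJ`. -/
theorem eq_exp_of_shift_mul_comm {Φ : ℝ → ℝ} (hc : Continuous Φ) (h0 : ∀ r, 0 ≤ Φ r) {s₀ h : ℝ}
    (hh : 0 < h) (hs₀ : 0 < Φ s₀)
    (hΦ : ∀ r s x, s₀ ≤ r → s₀ ≤ s → 0 ≤ x → x ≤ h → Φ (r + x) * Φ s = Φ r * Φ (s + x)) :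
    ∃ k : ℝ, ∀ r, s₀ ≤ r → Φ r = Φ s₀ * Real.exp (k * (r - s₀)) := by
  set J : ℝ → ℝ := fun r => ∫ x in r..(r + h), Φ x with hJ
  have hJ' : ∀ r, J r = ∫ x in (0 : ℝ)..h, Φ (r + x) := by
    intro r
    rw [intervalIntegral.integral_comp_add_left (fun x => Φ x) r]
    simp [hJ]
  have hJd : ∀ r, HasDerivAt J (Φ (r + h) - Φ r) r := by
    intro r
    have e : J = fun r => (∫ x in (0 : ℝ)..(r + h), Φ x) - ∫ x in (0 : ℝ)..r, Φ x := by
      funext r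
      rw [intervalIntegral.integral_interval_sub_left] <;>
        exact hc.intervalIntegrable _ _
    rw [e]
    have h1 := (hc.integral_hasStrictDerivAt 0 (r + h)).hasDerivAt
    have h2 := (hc.integral_hasStrictDerivAt 0 r).hasDerivAt
    have h3 : HasDerivAt (fun r : ℝ => r + h) 1 r := (hasDerivAt_id r).add_const h
    have h4 := h1.scomp r h3
    simp only [one_smul] at h4
    exact h4.sub h2
  have hJpos : 0 < J s₀ := by
    exact intervalIntegral.integral_pos (by linarith) hc.continuousOn (fun x _ => h0 x)
      ⟨s₀, ⟨le_rfl, by linarith⟩, hs₀⟩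
  have hrel : ∀ r, s₀ ≤ r → J r * Φ s₀ = Φ r * J s₀ := by
    intro r hr
    rw [hJ', hJ', ← intervalIntegral.integral_mul_const, ← intervalIntegral.integral_const_mul]
    refine intervalIntegral.integral_congr fun x hx => ?_
    rw [Set.uIcc_of_le hh.le] at hx
    exact hΦ r s₀ x hr le_rfl hx.1 hx.2
  have hstep : ∀ r, s₀ ≤ r → Φ (r + h) * Φ s₀ = Φ r * Φ (s₀ + h) := fun r hr =>
    hΦ r s₀ h hr le_rfl hh.le le_rfl
  set k := (Φ (s₀ + h) - Φ s₀) / J s₀ with hk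
  refine ⟨k, fun r hr => ?_⟩
  have hder : ∀ x, s₀ ≤ x → HasDerivAt (fun x => J x * Real.exp (-k * (x - s₀))) 0 x := by
    intro x hx
    have h1 : HasDerivAt (fun x : ℝ => -k * (x - s₀)) (-k) x := by
      simpa using ((hasDerivAt_id x).sub_const s₀).const_mul (-k)
    have h2 := (hJd x).mul h1.exp
    have e1 := hrel x hx
    have e2 := hstep x hx
    have : Φ (x + h) - Φ x = J x * k := by
      rw [hk]; field_simp
      have : Φ s₀ ≠ 0 := hs₀.ne'
      apply mul_right_cancel₀ this
      linear_combination J s₀ * e2 - (Φ (s₀ + h) - Φ s₀) * e1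
    refine h2.congr_deriv ?_
    rw [this]; ring
  have hconst := constant_of_has_deriv_right_zero (a := s₀) (b := r)
    (f := fun x => J x * Real.exp (-k * (x - s₀)))
    (fun x hx => (hder x hx.1).continuousAt.continuousWithinAt)
    (fun x hx => (hder x hx.1).hasDerivWithinAt) r ⟨hr, le_rfl⟩
  simp only [sub_self, mul_zero, Real.exp_zero, mul_one] at hconst
  have e1 := hrel r hr
  have e3 : Real.exp (-k * (r - s₀)) * Real.exp (k * (r - s₀)) = 1 := by
    rw [← Real.exp_add]; simp
  apply mul_right_cancel₀ hJpos.ne'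
  rw [← e1]
  linear_combination (Φ s₀ * Real.exp (k * (r - s₀))) * hconst - J r * Φ s₀ * e3

/-- The admissible shifts shrink as `r → 0`, so the equation is solved on each half-line `[s₀, ∞)`
with its own window. Two such solutions overlap and have the same rate; the rate is negative because
`Φ → 0`. -/
theorem exists_exp_of_cone_mul_comm {Φ : ℝ → ℝ} (hc : ContinuousOn Φ (Set.Ioi 0))
    (h0 : ∀ r, 0 < r → 0 ≤ Φ r) (hanti : AntitoneOn Φ (Set.Ioi 0)) (hlim : Tendsto Φ atTop (𝓝 0))
    (hne : ∃ r, 0 < r ∧ Φ r ≠ 0) {a : ℝ} (ha : 0 < a)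
    (hΦ : ∀ r s x, 0 < r → 0 < s → 0 ≤ x → x < a * r → x < a * s →
      Φ (r + x) * Φ s = Φ r * Φ (s + x)) :
    ∃ B b : ℝ, 0 < B ∧ 0 < b ∧ ∀ r, 0 < r → Φ r = B * Real.exp (-b * r) := by
  have key : ∀ s₀, 0 < s₀ → 0 < Φ s₀ →
      ∃ k : ℝ, ∀ r, s₀ ≤ r → Φ r = Φ s₀ * Real.exp (k * (r - s₀)) := by
    intro s₀ hs hpos
    -- Freezing `Φ` to the left of `s₀` makes it continuous on the whole line.
    have hc' : Continuous fun r => Φ (max r s₀) :=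
      hc.comp_continuous (by fun_prop) fun x => lt_of_lt_of_le hs (le_max_right _ _)
    obtain ⟨k, hk⟩ := eq_exp_of_shift_mul_comm (Φ := fun r => Φ (max r s₀)) (s₀ := s₀)
      (h := a * s₀ / 2) hc' (fun r => h0 _ (lt_of_lt_of_le hs (le_max_right _ _))) (by positivity) (by simpa using hpos) (by
        intro r s x hr hs' hx hxh
        have h1 : s₀ ≤ r + x := by linarith
        have h2 : s₀ ≤ s + x := by linarith
        simp only [max_eq_left hr, max_eq_left hs', max_eq_left h1, max_eq_left h2]
        have : 0 < a * s₀ := by positivity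
        have h3 : a * s₀ ≤ a * r := by gcongr
        have h4 : a * s₀ ≤ a * s := by gcongr
        exact hΦ r s x (by linarith) (by linarith) hx (by linarith) (by linarith))
    refine ⟨k, fun r hr => ?_⟩
    simpa [max_eq_left hr] using hk r hr
  obtain ⟨S, hS, hSne⟩ := hne
  have hSpos : 0 < Φ S := lt_of_le_of_ne (h0 S hS) hSne.symm
  obtain ⟨k, hk⟩ := key S hS hSpos
  have hB : 0 < Φ S * Real.exp (-(k * S)) := by positivity
  have hall : ∀ r, 0 < r → Φ r = (Φ S * Real.exp (-(k * S))) * Real.exp (k * r) := by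
    intro r hr
    set s := min r S with hs
    have hspos : 0 < s := lt_min hr hS
    -- Monotonicity keeps `Φ` positive to the left of `S`, so the local solution may start at any `s
    -- ≤ S`.
    have hΦs : 0 < Φ s := hSpos.trans_le (hanti hspos hS (min_le_right _ _))
    obtain ⟨k', hk'⟩ := key s hspos hΦs
    have e1 := hk' S (min_le_right _ _)
    have e2 := hk' (S + 1) ((min_le_right _ _).trans (by linarith))
    have e3 := hk (S + 1) (by linarith)
    have hkk : k = k' := by
      rw [e3, e1, mul_assoc, ← Real.exp_add] at e2
      have := Real.exp_injective (mul_left_cancel₀ hΦs.ne' e2)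
      linarith
    have e4 := hk' r (min_le_left _ _)
    rw [e4, e1, hkk, mul_assoc, mul_assoc, ← Real.exp_add, ← Real.exp_add]
    ring_nf
  have hkneg : k < 0 := by
    by_contra hcon
    push Not at hcon
    have : ∀ᶠ r in atTop, Φ S * Real.exp (-(k * S)) ≤ Φ r := by
      filter_upwards [eventually_gt_atTop 0] with r hr
      rw [hall r hr]
      exact le_mul_of_one_le_right hB.le (Real.one_le_exp (by positivity))
    exact absurd (ge_of_tendsto hlim this) (not_le.2 hB)
  exact ⟨_, -k, hB, by linarith, fun r hr => by rw [hall r hr]; simp⟩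

/-- Lebesgue differentiation of the tail. Integrability up to the origin is not assumed, hence the
cut at `1 / (n + 1)` and the countable union. -/
theorem ae_eq_exp_of_tail_eq_exp {f : ℝ → ℝ} (hint : ∀ r, 0 < r → IntegrableOn f (Set.Ioi r))
    {B b : ℝ} (h : ∀ r, 0 < r → ∫ t in Set.Ioi r, f t = B * Real.exp (-b * r)) :
    ∀ᵐ t ∂volume.restrict (Set.Ioi (0 : ℝ)), f t = b * B * Real.exp (-b * t) := by
  rw [ae_restrict_iff' measurableSet_Ioi]
  have hn : ∀ n : ℕ, ∀ᵐ t : ℝ, ((n : ℝ) + 1)⁻¹ < t → f t = b * B * Real.exp (-b * t) := by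
    intro n
    set c : ℝ := ((n : ℝ) + 1)⁻¹ with hcdef
    have hcpos : 0 < c := by positivity
    have hg : Integrable ((Set.Ioi c).indicator f) :=
      (hint c hcpos).integrable_indicator measurableSet_Ioi
    filter_upwards [LocallyIntegrable.ae_hasDerivAt_integral hg.locallyIntegrable] with t ht htc
    have h1 := ht c
    rw [Set.indicator_of_mem (Set.mem_Ioi.2 htc)] at h1
    have h2 : HasDerivAt (fun x => B * Real.exp (-b * c) - B * Real.exp (-b * x))
        (b * B * Real.exp (-b * t)) t := by
      have h3 : HasDerivAt (fun x : ℝ => -b * x) (-b) t := by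
        simpa using (hasDerivAt_id t).const_mul (-b)
      refine ((h3.exp.const_mul B).const_sub (B * Real.exp (-b * c))).congr_deriv ?_
      ring
    refine h1.unique (h2.congr_of_eventuallyEq ?_)
    filter_upwards [Ioi_mem_nhds htc] with x hx
    rw [← h c hcpos, ← h x (hcpos.trans hx), intervalIntegral.integral_Ioi_sub_Ioi (hint c hcpos) (le_of_lt hx)]
    rw [intervalIntegral.integral_of_le (le_of_lt hx), intervalIntegral.integral_of_le (le_of_lt hx)]
    refine setIntegral_congr_fun measurableSet_Ioc fun y hy => ?_
    exact Set.indicator_of_mem (Set.mem_Ioi.2 hy.1) f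
  filter_upwards [ae_all_iff.2 hn] with t ht ht0
  obtain ⟨n, hn⟩ := exists_nat_one_div_lt (Set.mem_Ioi.1 ht0)
  exact ht n (by simpa using hn)

/-- Integrating over `q > r` replaces `f` by its continuous tail `Φ` and `g` by its tail integral
`Γ`, keeping the separated form; the cone condition survives since `√q` increases. Differentiating
in `y` gives `Γ(s) Φ(r + y²) = Γ(r) Φ(s + y²)`, and comparison with `y = 0` eliminates `Γ`. -/
theorem ae_eq_exp_of_separated {f g F : ℝ → ℝ} (hf : Measurable f) (hf0 : ∀ t, 0 ≤ t → 0 ≤ f t)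
    (hint : ∀ r, 0 < r → IntegrableOn f (Set.Ioi r))
    (hne : ¬ ∀ᵐ t ∂volume.restrict (Set.Ioi (0 : ℝ)), f t = 0) {a : ℝ} (ha : 0 < a)
    (h : ∀ᵐ q ∂volume.restrict (Set.Ioi (0 : ℝ)), ∀ y, 0 ≤ y → y < a * √q →
      ∫ x in (0 : ℝ)..y, f (q + x ^ 2) = g q * F y) :
    ∃ A b : ℝ, 0 < A ∧ 0 < b ∧
      ∀ᵐ t ∂volume.restrict (Set.Ioi (0 : ℝ)), f t = A * Real.exp (-b * t) := by
  set Φ : ℝ → ℝ := fun r => ∫ t in Set.Ioi r, f t with hΦ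
  set Γ : ℝ → ℝ := fun r => ∫ q in Set.Ioi r, g q with hΓ
  have hnn : ∀ r, 0 < r → 0 ≤ Φ r := fun r hr => setIntegral_nonneg measurableSet_Ioi
    fun t ht => hf0 t (hr.trans ht).le
  have hanti : AntitoneOn Φ (Set.Ioi 0) := by
    intro r hr s hs hrs
    refine setIntegral_mono_set (hint r hr) ?_ (Set.Ioi_subset_Ioi hrs).eventuallyLE
    filter_upwards [ae_restrict_mem measurableSet_Ioi] with t ht
    exact hf0 t ((Set.mem_Ioi.1 hr).trans ht).le
  have hcont : ContinuousOn Φ (Set.Ioi 0) := by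
    intro r hr
    have hr' : (0 : ℝ) < r := hr
    have := (IntegrableOn.continuousOn_Ici_primitive_Ioi (hint (r / 2) (by positivity))).continuousAt
      (Ici_mem_nhds (show r / 2 < r by linarith))
    exact this.continuousWithinAt
  have hlim : Tendsto Φ atTop (𝓝 0) := by
    have h1 := intervalIntegral_tendsto_integral_Ioi 1 (hint 1 one_pos) tendsto_id
    have h2 : Tendsto (fun r => Φ 1 - ∫ x in (1 : ℝ)..r, f x) atTop (𝓝 (Φ 1 - Φ 1)) :=
      h1.const_sub (Φ 1)
    rw [sub_self] at h2
    refine h2.congr' ?_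
    filter_upwards [eventually_ge_atTop 1] with r hr
    rw [← intervalIntegral.integral_Ioi_sub_Ioi (hint 1 one_pos) hr]
    ring
  have htrans : ∀ r x, ∫ q in Set.Ioi r, f (q + x ^ 2) = Φ (r + x ^ 2) := by
    intro r x
    have hmp := measurePreserving_add_right (volume : Measure ℝ) (x ^ 2)
    have := hmp.setIntegral_preimage_emb (measurableEmbedding_addRight (x ^ 2)) f
      (Set.Ioi (r + x ^ 2))
    simpa using this
  have hfub : ∀ r y, 0 < r → 0 ≤ y → y < a * √r →
      ∫ x in (0 : ℝ)..y, Φ (r + x ^ 2) = Γ r * F y := by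
    intro r y hr hy hyr
    have hcongr : ∫ q in Set.Ioi r, (∫ x in (0 : ℝ)..y, f (q + x ^ 2)) = Γ r * F y := by
      rw [hΓ, ← integral_mul_const]
      refine integral_congr_ae ?_
      have h' : ∀ᵐ q ∂volume.restrict (Set.Ioi r), ∀ y, 0 ≤ y → y < a * √q →
          ∫ x in (0 : ℝ)..y, f (q + x ^ 2) = g q * F y :=
        ae_restrict_of_ae_restrict_of_subset (Set.Ioi_subset_Ioi hr.le) h
      filter_upwards [h', ae_restrict_mem measurableSet_Ioi] with q hq hqr
      refine hq y hy (hyr.trans_le ?_)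
      gcongr
      exact le_of_lt hqr
    rw [← hcongr]
    simp_rw [intervalIntegral.integral_of_le hy]
    rw [integral_integral_swap]
    · refine integral_congr_ae (ae_of_all _ fun x => (htrans r x).symm)
    · rw [integrable_prod_iff' (Measurable.aestronglyMeasurable (by fun_prop))]
      have hi : ∀ x : ℝ, IntegrableOn (fun q => f (q + x ^ 2)) (Set.Ioi r) := by
        intro x
        have := hint (r + x ^ 2) (by positivity)
        have hmp := measurePreserving_add_right (volume : Measure ℝ) (x ^ 2)
        have h2 := (hmp.integrableOn_comp_preimage (measurableEmbedding_addRight (x ^ 2))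
          (f := f) (s := Set.Ioi (r + x ^ 2))).2 this
        simpa [Function.comp_def] using h2
      refine ⟨ae_of_all _ fun x => hi x, ?_⟩
      have hbd : ∀ x : ℝ, ∫ q in Set.Ioi r, ‖f (q + x ^ 2)‖ = Φ (r + x ^ 2) := by
        intro x
        rw [← htrans]
        refine setIntegral_congr_fun measurableSet_Ioi fun q hq => ?_
        have : (0 : ℝ) < q := hr.trans hq
        exact Real.norm_of_nonneg (hf0 _ (by positivity))
      simp only [Function.uncurry_apply_pair, hbd]
      have hcx : Continuous fun x : ℝ => Φ (r + x ^ 2) :=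
        hcont.comp_continuous (by fun_prop) fun x => Set.mem_Ioi.2 (by positivity)
      exact (hcx.integrableOn_Icc (a := 0) (b := y)).mono_set Set.Ioc_subset_Icc_self
  have hcross : ∀ r s y, 0 < r → 0 < s → 0 ≤ y → y < a * √r → y < a * √s →
      Γ s * Φ (r + y ^ 2) = Γ r * Φ (s + y ^ 2) := by
    intro r s y hr hs hy hyr hys
    have hcx : ∀ r, 0 < r → Continuous fun x : ℝ => Φ (r + x ^ 2) := fun r hr =>
      hcont.comp_continuous (by fun_prop) fun x => Set.mem_Ioi.2 (by positivity)
    have hd : ∀ r, 0 < r → HasDerivAt (fun y => ∫ x in (0 : ℝ)..y, Φ (r + x ^ 2))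
        (Φ (r + y ^ 2)) y := fun r hr => ((hcx r hr).integral_hasStrictDerivAt 0 y).hasDerivAt
    have h1 := (hd r hr).const_mul (Γ s)
    have h2 := (hd s hs).const_mul (Γ r)
    refine h1.unique (h2.congr_of_eventuallyEq ?_)
    -- At `y = 0` the derivative also looks at negative `z`, where the identity follows by oddness.
    have hodd : ∀ r z, ∫ x in (0 : ℝ)..(-z), Φ (r + x ^ 2) = -∫ x in (0 : ℝ)..z, Φ (r + x ^ 2) := by
      intro r z
      have := intervalIntegral.integral_comp_neg (a := -z) (b := 0) (fun x => Φ (r + x ^ 2))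
      simp only [neg_sq, neg_zero, neg_neg] at this
      rw [intervalIntegral.integral_symm, this]
    have hpos : ∀ z, 0 ≤ z → z < a * √r → z < a * √s →
        Γ s * ∫ x in (0 : ℝ)..z, Φ (r + x ^ 2) = Γ r * ∫ x in (0 : ℝ)..z, Φ (s + x ^ 2) := by
      intro z h0 hzr hzs
      rw [hfub r z hr h0 hzr, hfub s z hs h0 hzs]; ring
    have hev : ∀ r, 0 < r → y < a * √r → ∀ᶠ z in 𝓝 y, |z| < a * √r := fun r hr hyr =>
      (continuous_abs.tendsto y).eventually_lt_const (by rwa [abs_of_nonneg hy])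
    filter_upwards [hev r hr hyr, hev s hs hys] with z hzr hzs
    rcases le_total 0 z with hz | hz
    · rw [abs_of_nonneg hz] at hzr hzs
      exact hpos z hz hzr hzs
    · rw [abs_of_nonpos hz] at hzr hzs
      have h3 := hpos (-z) (by linarith) hzr hzs
      rw [hodd, hodd] at h3
      linarith
  have hcone : ∀ r s x, 0 < r → 0 < s → 0 ≤ x → x < a ^ 2 * r → x < a ^ 2 * s →
      Φ (r + x) * Φ s = Φ r * Φ (s + x) := by
    intro r s x hr hs hx hxr hxs
    have hsq : √x ^ 2 = x := Real.sq_sqrt hx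
    have hlt : ∀ r, 0 < r → x < a ^ 2 * r → √x < a * √r := by
      intro r hr h
      have : a * √r = √(a ^ 2 * r) := by
        rw [Real.sqrt_mul (by positivity), Real.sqrt_sq ha.le]
      rw [this]
      exact Real.sqrt_lt_sqrt hx h
    have h1 := hcross r s (√x) hr hs (Real.sqrt_nonneg _) (hlt r hr hxr) (hlt s hs hxs)
    have h2 := hcross r s 0 hr hs le_rfl (by positivity) (by positivity)
    rw [hsq] at h1
    simp only [ne_eq, OfNat.ofNat_ne_zero, not_false_eq_true, zero_pow, add_zero] at h2
    -- `Γ` can be cancelled only where it is nonzero; where it vanishes, so does `Φ`.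
    have hzero : ∀ r, 0 < r → Γ r = 0 → Φ r = 0 := by
      intro r hr h0
      by_contra hne
      have hcx : Continuous fun x : ℝ => Φ (r + x ^ 2) :=
        hcont.comp_continuous (by fun_prop) fun x => Set.mem_Ioi.2 (by positivity)
      have hp : 0 < a * √r / 2 := by positivity
      have h3 := hfub r (a * √r / 2) hr hp.le (by linarith)
      rw [h0, zero_mul] at h3
      have h4 := intervalIntegral.integral_pos hp hcx.continuousOn
        (fun x _ => hnn _ (by positivity))
        ⟨0, ⟨le_rfl, hp.le⟩, by simpa using lt_of_le_of_ne (hnn r hr) (Ne.symm hne)⟩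
      linarith
    by_cases hs0 : Γ s = 0
    · by_cases hr0 : Γ r = 0
      · rw [hzero s hs hs0, hzero r hr hr0]; ring
      · apply mul_left_cancel₀ hr0
        linear_combination Φ (r + x) * (-h2) + Φ r * h1
    · apply mul_left_cancel₀ hs0
      linear_combination Φ s * h1 - Φ (s + x) * h2
  have hne' : ∃ r, 0 < r ∧ Φ r ≠ 0 := by
    by_contra hcon
    push Not at hcon
    refine hne ?_
    -- A tail that vanishes identically is the degenerate case `B = b = 0`, and makes `f` zero
    -- almost everywhere.
    have := ae_eq_exp_of_tail_eq_exp hint (B := 0) (b := 0) fun r hr => by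
      simpa using hcon r hr
    simpa using this
  obtain ⟨B, b, hB, hb, h1⟩ := exists_exp_of_cone_mul_comm hcont hnn hanti hlim hne'
    (a := a ^ 2) (by positivity) hcone
  exact ⟨b * B, b, by positivity, hb, ae_eq_exp_of_tail_eq_exp hint h1⟩

end ExponentialTail

/-! ### Standardising a positive definite form -/

section StandardizingMap

open scoped MatrixOrder
open Matrix

variable {ι : Type*} [Fintype ι] [DecidableEq ι]

theorem invQuadForm_of_mulVec_eq {A : Matrix ι ι ℝ} (hA : A.PosDef) {x : EuclideanSpace ℝ ι}
    {y : ι → ℝ} (h : A *ᵥ y = x.ofLp) : invQuadForm A x = x.ofLp ⬝ᵥ y := by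
  have hu : IsUnit A.det := (Matrix.isUnit_iff_isUnit_det A).1 hA.isUnit
  rw [invQuadForm, ← h, Matrix.mulVec_mulVec, Matrix.nonsing_inv_mul _ hu, Matrix.one_mulVec]

/-- A positive definite quadratic form `xᵀ A⁻¹ x` is the pullback of the squared Euclidean norm
under a linear change of variables with determinant `±|A|^{-1/2}`. -/
theorem exists_norm_sq_eq_invQuadForm {A : Matrix ι ι ℝ} (hA : A.PosDef) :
    ∃ T : EuclideanSpace ℝ ι ≃L[ℝ] EuclideanSpace ℝ ι,
      (∀ y, ‖T y‖ ^ 2 = invQuadForm A y) ∧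
        (volume : Measure (EuclideanSpace ℝ ι)).map T = ENNReal.ofReal √A.det • volume := by
  have hB0 : (0 : Matrix ι ι ℝ) ≤ A⁻¹ := hA.inv.posSemidef.nonneg
  -- The map is the positive square root of `A⁻¹`; its symmetry turns `‖By‖²` into `yᵀA⁻¹y`.
  set B := CFC.sqrt A⁻¹ with hB
  have hBB : B * B = A⁻¹ := CFC.sqrt_mul_sqrt_self A⁻¹ hB0
  have hBs : B.PosSemidef := nonneg_iff_posSemidef.1 (CFC.sqrt_nonneg _)
  have hBt : Bᵀ = B := by
    have := hBs.isHermitian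
    rwa [IsHermitian, conjTranspose_eq_transpose_of_trivial] at this
  have hdet2 : B.det * B.det = A.det⁻¹ := by
    rw [← det_mul, hBB, det_nonsing_inv, Ring.inverse_eq_inv']
  have hdetA : 0 < A.det := hA.det_pos
  have hdet : B.det = (√A.det)⁻¹ := by
    rw [← Real.sqrt_inv, ← hdet2, Real.sqrt_mul_self hBs.det_nonneg]
  have hdetpos : 0 < B.det := by rw [hdet]; positivity
  have hu : IsUnit B.det := hdetpos.ne'.isUnit
  let L := toEuclideanCLM (n := ι) (𝕜 := ℝ) B
  let L' := toEuclideanCLM (n := ι) (𝕜 := ℝ) B⁻¹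
  let T : EuclideanSpace ℝ ι ≃L[ℝ] EuclideanSpace ℝ ι := ContinuousLinearEquiv.equivOfInverse L L'
    (fun x => by
      apply WithLp.ofLp_injective 2
      simp only [L, L', ofLp_toEuclideanCLM, mulVec_mulVec, nonsing_inv_mul _ hu, one_mulVec])
    (fun x => by
      apply WithLp.ofLp_injective 2
      simp only [L, L', ofLp_toEuclideanCLM, mulVec_mulVec, mul_nonsing_inv _ hu, one_mulVec])
  have hT : ∀ y, (T y).ofLp = B *ᵥ y.ofLp := fun y => rfl
  refine ⟨T, fun y => ?_, ?_⟩
  · rw [EuclideanSpace.real_norm_sq_eq, hT, invQuadForm, ← hBB, ← mulVec_mulVec,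
      dotProduct_mulVec, ← mulVec_transpose, hBt, dotProduct]
    simp [sq]
  · have hdetL : LinearMap.det (toEuclideanLin B) = B.det := by
      rw [toEuclideanLin_eq_toLin_orthonormal, LinearMap.det_toLin]
    have h := Measure.map_linearMap_addHaar_eq_smul_addHaar
      (volume : Measure (EuclideanSpace ℝ ι)) (f := toEuclideanLin B) (by rw [hdetL]; exact hdetpos.ne')
    rw [hdetL, hdet, inv_inv, abs_of_nonneg (Real.sqrt_nonneg _)] at h
    exact h

theorem invQuadForm_neg (A : Matrix ι ι ℝ) (x : EuclideanSpace ℝ ι) :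
    invQuadForm A (-x) = invQuadForm A x := by
  simp [invQuadForm, mulVec_neg]

theorem invQuadForm_smul_matrix {A : Matrix ι ι ℝ} (c : ℝ) (hc : c ≠ 0) (hA : A.PosDef)
    (x : EuclideanSpace ℝ ι) : invQuadForm (c • A) x = c⁻¹ * invQuadForm A x := by
  have hu : IsUnit A.det := (Matrix.isUnit_iff_isUnit_det A).1 hA.isUnit
  rw [invQuadForm, invQuadForm, show c • A = (Units.mk0 c hc) • A from rfl, inv_smul' _ _ hu]
  simp [smul_mulVec, Units.smul_def]

theorem invQuadForm_nonneg {A : Matrix ι ι ℝ} (hA : A.PosDef) (x : EuclideanSpace ℝ ι) :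
    0 ≤ invQuadForm A x := by
  obtain ⟨T, hT, -⟩ := exists_norm_sq_eq_invQuadForm hA
  rw [← hT]; positivity

theorem continuous_invQuadForm (A : Matrix ι ι ℝ) : Continuous (invQuadForm A) := by
  unfold invQuadForm
  simp only [dotProduct, mulVec]
  fun_prop

end StandardizingMap

/-! ### The block matrix and its Schur complement -/

section StarMatrix

open Matrix

variable {d : ℕ} {δ : Fin d → ℝ} {Ωbar : Matrix (Fin d) (Fin d) ℝ}

theorem posDef_of_starMatrix (h : (starMatrix δ Ωbar).PosDef) : Ωbar.PosDef := by
  have := h.submatrix (e := (Sum.inr : Fin d → Unit ⊕ Fin d)) Sum.inr_injective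
  exact this

theorem schurComplement_pos_of_starMatrix (h : (starMatrix δ Ωbar).PosDef) :
    0 < 1 - δ ⬝ᵥ (Ωbar⁻¹ *ᵥ δ) := by
  have hΩ := posDef_of_starMatrix h
  have hu : IsUnit Ωbar.det := (Matrix.isUnit_iff_isUnit_det Ωbar).1 hΩ.isUnit
  -- The form of `Ω*` at `(1, -Ω̄⁻¹δ)` is exactly the Schur complement.
  have hx : (Sum.elim (fun _ : Unit => (1 : ℝ)) (-(Ωbar⁻¹ *ᵥ δ))) ≠ 0 := by
    intro h0
    simpa using congrFun h0 (Sum.inl ())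
  have := h.dotProduct_mulVec_pos hx
  have e1 : (replicateRow Unit δ) *ᵥ (-(Ωbar⁻¹ *ᵥ δ)) = fun _ => -(δ ⬝ᵥ (Ωbar⁻¹ *ᵥ δ)) := by
    ext; simp [mulVec, replicateRow, dotProduct]
  have e2 : (replicateCol Unit δ) *ᵥ (fun _ : Unit => (1 : ℝ)) = δ := by
    ext; simp [mulVec, replicateCol, dotProduct]
  rw [starMatrix, fromBlocks_mulVec] at this
  simp only [Sum.elim_comp_inl, Sum.elim_comp_inr, one_mulVec, e1, e2, mulVec_neg,
    mulVec_mulVec, mul_nonsing_inv _ hu, star_trivial] at this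
  rw [dotProduct, Fintype.sum_sum_type] at this
  simpa [← sub_eq_add_neg] using this

/-- Completion of the square: this separates `Q_z` from the standardised `u₀` and is the source of
the conditional generator. -/
theorem invQuadForm_starMatrix (h : (starMatrix δ Ωbar).PosDef) (u₀ : ℝ)
    (z : EuclideanSpace ℝ (Fin d)) :
    invQuadForm (starMatrix δ Ωbar) (joinVec u₀ z) = invQuadForm Ωbar z +
      ((u₀ - δ ⬝ᵥ (Ωbar⁻¹ *ᵥ z.ofLp)) / √(1 - δ ⬝ᵥ (Ωbar⁻¹ *ᵥ δ))) ^ 2 := by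
  have hΩ := posDef_of_starMatrix h
  have hu : IsUnit Ωbar.det := (Matrix.isUnit_iff_isUnit_det Ωbar).1 hΩ.isUnit
  have hκ := schurComplement_pos_of_starMatrix h
  set κ := 1 - δ ⬝ᵥ (Ωbar⁻¹ *ᵥ δ) with hκdef
  set y₀ := (u₀ - δ ⬝ᵥ (Ωbar⁻¹ *ᵥ z.ofLp)) / κ with hy₀
  have hsymm : z.ofLp ⬝ᵥ (Ωbar⁻¹ *ᵥ δ) = δ ⬝ᵥ (Ωbar⁻¹ *ᵥ z.ofLp) := by
    have ht : (Ωbar⁻¹)ᵀ = Ωbar⁻¹ := by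
      have := hΩ.inv.isHermitian
      rwa [IsHermitian, conjTranspose_eq_transpose_of_trivial] at this
    rw [dotProduct_mulVec, ← mulVec_transpose, ht, dotProduct_comm]
  have e1 : ∀ v, (replicateRow Unit δ) *ᵥ v = fun _ => δ ⬝ᵥ v := by
    intro v; ext; simp [mulVec, replicateRow, dotProduct]
  have e2 : ∀ c : ℝ, (replicateCol Unit δ) *ᵥ (fun _ : Unit => c) = c • δ := by
    intro c; ext; simp [mulVec, replicateCol, dotProduct, mul_comm]
  -- The vector is `(Ω*)⁻¹(u₀, z)`, found by block elimination and verified by multiplying back, so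
  -- that no block inverse is needed.
  rw [invQuadForm_of_mulVec_eq h (y := Sum.elim (fun _ => y₀)
    (Ωbar⁻¹ *ᵥ z.ofLp - y₀ • (Ωbar⁻¹ *ᵥ δ)))]
  · simp only [joinVec]
    rw [dotProduct, Fintype.sum_sum_type]
    simp only [Sum.elim_inl, Sum.elim_inr, Finset.univ_unique, Finset.sum_const,
      Finset.card_singleton, one_smul]
    rw [← dotProduct, dotProduct_sub, dotProduct_smul, hsymm, div_pow, Real.sq_sqrt hκ.le,
      invQuadForm, smul_eq_mul, hy₀]
    field_simp
    ring
  · rw [starMatrix, fromBlocks_mulVec]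
    simp only [Sum.elim_comp_inl, Sum.elim_comp_inr, one_mulVec, e1, e2, joinVec]
    congr 1
    · funext _
      rw [Pi.add_apply, dotProduct_sub, dotProduct_smul, hy₀, smul_eq_mul]
      have : δ ⬝ᵥ (Ωbar⁻¹ *ᵥ δ) = 1 - κ := by rw [hκdef]; ring
      rw [this]
      field_simp
      ring
    · rw [mulVec_sub, mulVec_smul, mulVec_mulVec, mulVec_mulVec, mul_nonsing_inv _ hu, one_mulVec,
        one_mulVec]
      abel

theorem shapeParam_dotProduct (h : (starMatrix δ Ωbar).PosDef) (z : EuclideanSpace ℝ (Fin d)) :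
    shapeParam δ Ωbar ⬝ᵥ z.ofLp =
      (δ ⬝ᵥ (Ωbar⁻¹ *ᵥ z.ofLp)) / √(1 - δ ⬝ᵥ (Ωbar⁻¹ *ᵥ δ)) := by
  have hΩ := posDef_of_starMatrix h
  have ht : (Ωbar⁻¹)ᵀ = Ωbar⁻¹ := by
    have := hΩ.inv.isHermitian
    rwa [IsHermitian, conjTranspose_eq_transpose_of_trivial] at this
  have hsymm : (Ωbar⁻¹ *ᵥ δ) ⬝ᵥ z.ofLp = δ ⬝ᵥ (Ωbar⁻¹ *ᵥ z.ofLp) := by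
    rw [dotProduct_mulVec δ, ← mulVec_transpose, ht]
  rw [shapeParam, smul_dotProduct, smul_eq_mul, hsymm, one_div, inv_mul_eq_div]

end StarMatrix

/-! ### Isotropic Gaussian laws and radial laws -/

section GaussianMeasure

open scoped RealInnerProductSpace

variable {E : Type*} [NormedAddCommGroup E] [InnerProductSpace ℝ E]

/-- The density of the centred normal law with covariance `σ²` times the identity. -/
def isotropicGaussianDensity (E : Type*) [NormedAddCommGroup E] [InnerProductSpace ℝ E]
    (σ : ℝ) (w : E) : ℝ :=
  (2 * Real.pi * σ ^ 2) ^ (-(Module.finrank ℝ E : ℝ) / 2) * Real.exp (-(‖w‖ ^ 2) / (2 * σ ^ 2))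

theorem isotropicGaussianDensity_pos {σ : ℝ} (hσ : 0 < σ) (w : E) :
    0 < isotropicGaussianDensity E σ w := by
  unfold isotropicGaussianDensity; positivity

theorem continuous_isotropicGaussianDensity {σ : ℝ} :
    Continuous (isotropicGaussianDensity E σ) := by
  unfold isotropicGaussianDensity; fun_prop

variable [FiniteDimensional ℝ E] [MeasurableSpace E] [BorelSpace E]

theorem map_withDensity_of_map_eq_smul {h : E → ENNReal} (hh : Measurable h) (T : E ≃L[ℝ] E)
    {k : ENNReal} (hT : (volume : Measure E).map T = k • volume) :
    (volume.withDensity h).map T = volume.withDensity (fun w => k * h (T.symm w)) := by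
  have hTm : Measurable T := T.continuous.measurable
  have hTs : Measurable T.symm := T.symm.continuous.measurable
  ext s hs
  rw [Measure.map_apply hTm hs, withDensity_apply _ (hTm hs), withDensity_apply _ hs,
    lintegral_const_mul k (f := fun w => h (T.symm w)) (hh.comp hTs)]
  have h1 := setLIntegral_map (μ := (volume : Measure E)) hs (hh.comp hTs) hTm
  rw [hT] at h1
  simp only [Function.comp_apply, ContinuousLinearEquiv.symm_apply_apply] at h1
  rw [← h1, Measure.restrict_smul, lintegral_smul_measure, smul_eq_mul]

theorem integral_isotropicGaussianDensity_mul_cexp {σ : ℝ} (hσ : 0 < σ) (t : E) :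
    ∫ w : E, (isotropicGaussianDensity E σ w : ℂ) * Complex.exp (⟪w, t⟫ * Complex.I) =
      Complex.exp (-(σ ^ 2 * ‖t‖ ^ 2) / 2) := by
  have hb : 0 < ((1 / (2 * σ ^ 2) : ℝ) : ℂ).re := by
    rw [Complex.ofReal_re]; positivity
  have h := GaussianFourier.integral_cexp_neg_mul_sq_norm_add hb Complex.I t
  have hpi : (Real.pi : ℂ) / ((1 / (2 * σ ^ 2) : ℝ) : ℂ) = ((2 * Real.pi * σ ^ 2 : ℝ) : ℂ) := by
    have : (σ : ℂ) ≠ 0 := by exact_mod_cast hσ.ne'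
    push_cast; field_simp
  have hpow : (((2 * Real.pi * σ ^ 2 : ℝ) : ℂ)) ^ ((Module.finrank ℝ E : ℂ) / 2) =
      (((2 * Real.pi * σ ^ 2) ^ ((Module.finrank ℝ E : ℝ) / 2) : ℝ) : ℂ) := by
    rw [Complex.ofReal_cpow (by positivity)]
    push_cast; rfl
  rw [hpi, hpow] at h
  have hfun : ∀ w : E, (isotropicGaussianDensity E σ w : ℂ) * Complex.exp (⟪w, t⟫ * Complex.I) =
      (((2 * Real.pi * σ ^ 2) ^ (-(Module.finrank ℝ E : ℝ) / 2) : ℝ) : ℂ) *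
        Complex.exp (-((1 / (2 * σ ^ 2) : ℝ) : ℂ) * ‖w‖ ^ 2 + Complex.I * ⟪t, w⟫) := by
    intro w
    rw [isotropicGaussianDensity, Complex.ofReal_mul, mul_assoc, Complex.ofReal_exp,
      ← Complex.exp_add, real_inner_comm w t]
    congr 2
    push_cast
    ring
  simp_rw [hfun]
  rw [integral_const_mul, h, ← mul_assoc, ← Complex.ofReal_mul, ← Real.rpow_add (by positivity)]
  have : -(Module.finrank ℝ E : ℝ) / 2 + (Module.finrank ℝ E : ℝ) / 2 = 0 := by ring
  rw [this, Real.rpow_zero, Complex.ofReal_one, one_mul]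
  congr 1
  have : (σ : ℂ) ≠ 0 := by exact_mod_cast hσ.ne'
  push_cast
  rw [Complex.I_sq]
  field_simp
  norm_num

/-- The Fourier integral at `0` equals `1`, whereas a nonintegrable function would have integral `0`
by convention. -/
theorem integrable_isotropicGaussianDensity {σ : ℝ} (hσ : 0 < σ) :
    Integrable (isotropicGaussianDensity E σ) := by
  by_contra hcon
  have h := integral_isotropicGaussianDensity_mul_cexp (E := E) hσ 0
  simp only [inner_zero_right, Complex.ofReal_zero, zero_mul, Complex.exp_zero, mul_one,
    norm_zero] at h
  rw [integral_undef] at h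
  · simp at h
  · intro hi
    exact hcon (by simpa using hi.re)

theorem stdGaussian_map_smul {σ : ℝ} (hσ : 0 < σ) :
    (stdGaussian E).map (σ • ·) =
      volume.withDensity (fun w => ENNReal.ofReal (isotropicGaussianDensity E σ w)) := by
  have := isFiniteMeasure_withDensity_ofReal (integrable_isotropicGaussianDensity (E := E) hσ).2
  have : IsFiniteMeasure ((stdGaussian E).map (σ • ·)) := inferInstance
  apply Measure.ext_of_charFun
  ext t
  rw [charFun_map_smul, charFun_stdGaussian, charFun_apply,
    integral_withDensity_eq_integral_toReal_smul
      (by exact continuous_isotropicGaussianDensity.measurable.ennreal_ofReal)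
      (ae_of_all _ fun _ => ENNReal.ofReal_lt_top)]
  simp_rw [ENNReal.toReal_ofReal (isotropicGaussianDensity_pos hσ _).le, Complex.real_smul]
  rw [integral_isotropicGaussianDensity_mul_cexp hσ, norm_smul, Real.norm_of_nonneg hσ.le]
  push_cast
  ring_nf

theorem stdGaussian_eq_withDensity :
    stdGaussian E =
      volume.withDensity (fun w => ENNReal.ofReal (isotropicGaussianDensity E 1 w)) := by
  rw [← stdGaussian_map_smul one_pos]
  simp

theorem charFun_map_inner {μ : Measure E} (a : E) (τ : ℝ) :
    charFun (μ.map (fun w => ⟪a, w⟫)) τ = charFun μ (τ • a) := by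
  rw [charFun_apply, charFun_apply, integral_map (by fun_prop) (by fun_prop)]
  refine integral_congr_ae (ae_of_all _ fun w => ?_)
  simp only [RCLike.inner_apply, conj_trivial, real_inner_smul_right, real_inner_comm w a]

theorem stdGaussian_map_inner (a : E) :
    (stdGaussian E).map (fun w => ⟪a, w⟫) = gaussianReal 0 (‖a‖ ^ 2).toNNReal := by
  have : IsFiniteMeasure ((stdGaussian E).map (fun w => ⟪a, w⟫)) := inferInstance
  apply Measure.ext_of_charFun
  ext τ
  rw [charFun_map_inner, charFun_stdGaussian, charFun_gaussianReal, norm_smul]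
  congr 1
  rw [Real.coe_toNNReal _ (by positivity)]
  push_cast
  rw [mul_pow, ← Complex.ofReal_pow ‖τ‖, Real.norm_eq_abs, sq_abs]
  push_cast
  ring

theorem isGaussian_stdGaussian_map_smul (σ : ℝ) : IsGaussian ((stdGaussian E).map (σ • ·)) := by
  have := isGaussian_map (μ := stdGaussian E) (σ • ContinuousLinearMap.id ℝ E)
  exact this

/-- The law with density `p (‖w‖)`. -/
def radialMeasure (E : Type*) [NormedAddCommGroup E] [InnerProductSpace ℝ E]
    [FiniteDimensional ℝ E] [MeasurableSpace E] [BorelSpace E] (p : ℝ → ENNReal) : Measure E :=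
  volume.withDensity (fun w => p ‖w‖)

theorem measurePreserving_radialMeasure {p : ℝ → ENNReal} (hp : Measurable p) (e : E ≃ₗᵢ[ℝ] E) :
    MeasurePreserving e (radialMeasure E p) (radialMeasure E p) := by
  refine ⟨e.continuous.measurable, ?_⟩
  have h := map_withDensity_of_map_eq_smul (h := fun w : E => p ‖w‖) (by fun_prop)
    e.toContinuousLinearEquiv (k := 1) (by simpa using e.measurePreserving.map_eq)
  simpa [radialMeasure] using h

/-- The reflection in the hyperplane orthogonal to `t - t'` preserves the law and exchanges the two
points. -/
theorem charFun_radialMeasure_congr {p : ℝ → ENNReal} (hp : Measurable p) {t t' : E}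
    (h : ‖t‖ = ‖t'‖) : charFun (radialMeasure E p) t = charFun (radialMeasure E p) t' := by
  let e := (ℝ ∙ (t - t'))ᗮ.reflection
  have he : e t = t' := Submodule.reflection_sub h
  have hmp := measurePreserving_radialMeasure hp e
  have h1 := hmp.integral_comp e.toHomeomorph.measurableEmbedding
    (fun x => Complex.exp (⟪x, t'⟫ * Complex.I))
  rw [charFun_apply, charFun_apply, ← h1, ← he]
  simp only [LinearIsometryEquiv.inner_map_map]

/-- The law of `⟪a, w⟫` gives the characteristic function on the line through `a`, and radial
symmetry carries it to all of `E`. -/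
theorem radialMeasure_eq_stdGaussian_map {p : ℝ → ENNReal} (hp : Measurable p)
    [IsProbabilityMeasure (radialMeasure E p)] {a : E} (ha : a ≠ 0) {s : ℝ} (hs : 0 < s)
    (h : (radialMeasure E p).map (fun w => ⟪a, w⟫) = gaussianReal 0 (s ^ 2).toNNReal) :
    radialMeasure E p = (stdGaussian E).map ((s / ‖a‖) • ·) := by
  have ha' : 0 < ‖a‖ := norm_pos_iff.2 ha
  have : IsFiniteMeasure ((stdGaussian E).map ((s / ‖a‖) • ·)) := inferInstance
  apply Measure.ext_of_charFun
  ext t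
  have hn : ‖t‖ = ‖(‖t‖ / ‖a‖) • a‖ := by
    rw [norm_smul, norm_div, norm_norm, norm_norm, div_mul_cancel₀ _ ha'.ne']
  rw [charFun_radialMeasure_congr hp hn, ← charFun_map_inner, h, charFun_map_smul,
    charFun_stdGaussian, charFun_gaussianReal, norm_smul]
  congr 1
  have : (‖a‖ : ℂ) ≠ 0 := by exact_mod_cast ha'.ne'
  rw [Real.coe_toNNReal _ (by positivity), Real.norm_of_nonneg (by positivity)]
  push_cast
  field_simp
  ring

theorem radialMeasure_absolutelyContinuous (p : ℝ → ENNReal) : radialMeasure E p ≪ volume :=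
  withDensity_absolutelyContinuous _ _

theorem volume_inner_eq_zero {a : E} (ha : a ≠ 0) : volume {w : E | ⟪a, w⟫ = 0} = 0 := by
  have h := Measure.addHaar_submodule (volume : Measure E) (LinearMap.ker (innerₗ E a)) (by
    intro htop
    have : a ∈ LinearMap.ker (innerₗ E a) := by rw [htop]; trivial
    simp [ha] at this)
  exact h

/-- One projection suffices. Its mean vanishes by symmetry, and its variance is positive because a
hyperplane is null. -/
theorem exists_eq_stdGaussian_map_of_isGaussian [Nontrivial E] {p : ℝ → ENNReal} (hp : Measurable p)
    [IsGaussian (radialMeasure E p)] :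
    ∃ σ : ℝ, 0 < σ ∧ radialMeasure E p = (stdGaussian E).map (σ • ·) := by
  obtain ⟨a, ha⟩ := exists_ne (0 : E)
  set μ := radialMeasure E p with hμ
  have : IsProbabilityMeasure μ := IsGaussian.toIsProbabilityMeasure μ
  have h1 := IsGaussian.map_eq_gaussianReal (μ := μ) (innerSL ℝ a)
  have hmean : ∫ w, (innerSL ℝ a) w ∂μ = 0 := by
    have hmp := measurePreserving_radialMeasure hp (LinearIsometryEquiv.neg ℝ (E := E))
    have h2 := hmp.integral_comp (LinearIsometryEquiv.neg ℝ (E := E)).toHomeomorph.measurableEmbedding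
      (fun w => (innerSL ℝ a) w)
    simp only [LinearIsometryEquiv.coe_neg, map_neg, integral_neg] at h2
    rw [← hμ] at h2
    linarith
  set v := Var[innerSL ℝ a; μ].toNNReal with hv
  have hv0 : v ≠ 0 := by
    intro h0
    rw [hmean, h0, gaussianReal_zero_var] at h1
    have h2 : μ.map (innerSL ℝ a) {0} = 1 := by rw [h1]; simp
    rw [Measure.map_apply (by fun_prop) (measurableSet_singleton _)] at h2
    have h3 : μ ((innerSL ℝ a) ⁻¹' {0}) = 0 :=
      radialMeasure_absolutelyContinuous p (volume_inner_eq_zero ha)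
    rw [h3] at h2
    exact zero_ne_one h2
  have hs : 0 < √(v : ℝ) := Real.sqrt_pos.2 (by positivity)
  refine ⟨_, div_pos hs (norm_pos_iff.2 ha), radialMeasure_eq_stdGaussian_map hp ha hs ?_⟩
  rw [hmean] at h1
  have hsq : (√(v : ℝ) ^ 2).toNNReal = v := by
    rw [Real.sq_sqrt v.coe_nonneg, Real.toNNReal_coe]
  rw [hsq]
  exact h1

end GaussianMeasure

/-! ### Normal tails and quadratic exponential moments -/

section NormalTails

open Filter Topology

theorem cdf_gaussianReal_pos (x : ℝ) : 0 < cdf (gaussianReal 0 1) x := by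
  rw [cdf_eq_real, measureReal_def]
  refine ENNReal.toReal_pos ?_ (measure_ne_top _ _)
  intro h
  have := gaussianReal_absolutelyContinuous' 0 one_ne_zero h
  simp at this

theorem measurable_cdf (ν : Measure ℝ) : Measurable (cdf ν) := (monotone_cdf ν).measurable

theorem gaussianReal_Ioi_neg (x : ℝ) :
    gaussianReal 0 1 (Set.Ioi (-x)) = ENNReal.ofReal (cdf (gaussianReal 0 1) x) := by
  have := nullSingletonClass_gaussianReal (μ := 0) (v := 1) one_ne_zero
  have h := gaussianReal_map_neg (μ := 0) (v := 1)
  rw [neg_zero] at h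
  rw [ofReal_cdf, ← h, Measure.map_apply measurable_neg measurableSet_Ioi, h]
  simp only [Set.neg_preimage, Set.neg_Ioi, neg_neg]
  exact measure_congr Iio_ae_eq_Iic

theorem cdf_gaussianReal_neg (x : ℝ) :
    cdf (gaussianReal 0 1) (-x) = 1 - cdf (gaussianReal 0 1) x := by
  have h1 := gaussianReal_Ioi_neg x
  have h2 := prob_compl_eq_one_sub (μ := gaussianReal 0 1) (measurableSet_Iic (a := -x))
  rw [Set.compl_Iic, h1, ← ofReal_cdf, ← ENNReal.ofReal_one,
    ← ENNReal.ofReal_sub _ (cdf_nonneg _ _)] at h2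
  rw [ENNReal.ofReal_eq_ofReal_iff (cdf_nonneg _ _) (by linarith [cdf_le_one (gaussianReal 0 1) (-x)])]
    at h2
  linarith

/-- Chernoff bound. Here and in the lower bound below only the Gaussian rate matters, so crude
constants are enough. -/
theorem cdf_gaussianReal_neg_le {x : ℝ} (hx : 0 ≤ x) :
    cdf (gaussianReal 0 1) (-x) ≤ Real.exp (-x ^ 2 / 2) := by
  rw [cdf_eq_real]
  have h := measure_le_le_exp_mul_mgf (μ := gaussianReal 0 1) (X := id) (t := -x) (-x) (by linarith)
    (integrable_exp_mul_gaussianReal _)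
  rw [mgf_id_gaussianReal, ← Real.exp_add] at h
  refine h.trans_eq ?_
  congr 1
  push_cast; ring

theorem gaussianPDFReal_zero_one (x : ℝ) :
    gaussianPDFReal 0 1 x = (√(2 * Real.pi))⁻¹ * Real.exp (-x ^ 2 / 2) := by
  simp [gaussianPDFReal]

/-- The tail is at least the mass of the unit interval `(-x - 1, -x]`, on which the density is
smallest at the left end. -/
theorem gaussianPDFReal_le_cdf_neg {x : ℝ} (hx : 0 ≤ x) :
    gaussianPDFReal 0 1 (x + 1) ≤ cdf (gaussianReal 0 1) (-x) := by
  rw [cdf_eq_real, measureReal_def, gaussianReal_apply_eq_integral 0 one_ne_zero,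
    ENNReal.toReal_ofReal (setIntegral_nonneg measurableSet_Iic
      fun y _ => gaussianPDFReal_nonneg _ _ _)]
  have hint : IntegrableOn (gaussianPDFReal 0 1) (Set.Ioc (-x - 1) (-x)) :=
    (integrable_gaussianPDFReal 0 1).integrableOn
  calc gaussianPDFReal 0 1 (x + 1)
      = ∫ _ in Set.Ioc (-x - 1) (-x), gaussianPDFReal 0 1 (x + 1) := by simp
    _ ≤ ∫ y in Set.Ioc (-x - 1) (-x), gaussianPDFReal 0 1 y := by
        refine setIntegral_mono_on (by simp) hint measurableSet_Ioc fun y hy => ?_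
        rw [gaussianPDFReal_zero_one, gaussianPDFReal_zero_one]
        refine mul_le_mul_of_nonneg_left (Real.exp_le_exp.2 ?_) (by positivity)
        nlinarith [hy.1, hy.2]
    _ ≤ _ := by
        refine setIntegral_mono_set (integrable_gaussianPDFReal 0 1).integrableOn
          (ae_of_all _ fun y => gaussianPDFReal_nonneg _ _ _) ?_
        exact (Set.Ioc_subset_Iic_self).eventuallyLE

theorem lintegral_gaussianReal_neg {h : ℝ → ENNReal} (hh : Measurable h) :
    ∫⁻ y, h (-y) ∂gaussianReal 0 1 = ∫⁻ y, h y ∂gaussianReal 0 1 := by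
  have := gaussianReal_map_neg (μ := 0) (v := 1)
  rw [neg_zero] at this
  conv_rhs => rw [← this]
  rw [lintegral_map hh measurable_neg]

/-- `E [exp (λ (m + s Y)²) Φ(β Y) ; m + s Y > 0]` for a standard normal `Y`. -/
def skewExpMoment (m s β l : ℝ) : ENNReal :=
  ∫⁻ y, (Set.Ioi 0).indicator (fun x => ENNReal.ofReal (Real.exp (l * x ^ 2))) (m + s * y) *
    ENNReal.ofReal (cdf (gaussianReal 0 1) (β * y)) ∂gaussianReal 0 1

theorem skewExpMoment_eq_lintegral (m s β l : ℝ) : skewExpMoment m s β l =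
    ∫⁻ y, (Set.Ioi 0).indicator (fun _ => ENNReal.ofReal (gaussianPDFReal 0 1 y *
      Real.exp (l * (m + s * y) ^ 2) * cdf (gaussianReal 0 1) (β * y))) (m + s * y) := by
  have hm : Measurable fun y => (Set.Ioi 0).indicator
      (fun x => ENNReal.ofReal (Real.exp (l * x ^ 2))) (m + s * y) *
      ENNReal.ofReal (cdf (gaussianReal 0 1) (β * y)) := by
    refine Measurable.mul ?_ ((measurable_cdf _).comp (by fun_prop)).ennreal_ofReal
    exact (Measurable.indicator (by fun_prop) measurableSet_Ioi).comp (by fun_prop)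
  rw [skewExpMoment, gaussianReal_of_var_ne_zero 0 one_ne_zero,
    lintegral_withDensity_eq_lintegral_mul _ (measurable_gaussianPDF 0 1)]
  · refine lintegral_congr fun y => ?_
    by_cases hy : m + s * y ∈ Set.Ioi 0
    · simp only [Pi.mul_apply, Set.indicator_of_mem hy, gaussianPDF]
      rw [ENNReal.ofReal_mul (mul_nonneg (gaussianPDFReal_nonneg _ _ _) (Real.exp_pos _).le),
        ENNReal.ofReal_mul (gaussianPDFReal_nonneg _ _ _), mul_assoc]
    · simp [Set.indicator_of_notMem hy]
  · rw [← gaussianReal_of_var_ne_zero 0 one_ne_zero]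
    exact hm

/-- The event `m + sy > 0` leaves only `y → +∞`. There the normal density contributes rate `1/2`,
and `Φ(βy)` a further `β²/2` if `β < 0` and nothing otherwise; `exp(l s² y²)` must stay below their
sum. -/
theorem skewExpMoment_lt_top {m s β l : ℝ} (hs : 0 < s)
    (h : l < (1 + (min β 0) ^ 2) / (2 * s ^ 2)) : skewExpMoment m s β l < ⊤ := by
  set ρ := min β 0 with hρ
  rw [lt_div_iff₀ (by positivity)] at h
  set κ := (1 + ρ ^ 2) / 2 - l * s ^ 2 with hκdef
  have hκ : 0 < κ := by rw [hκdef]; linarith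
  set e := 2 * l * m * s with he
  set D := l * m ^ 2 + e ^ 2 / (2 * κ) + ρ ^ 2 * (m / s) ^ 2 / 2 with hD
  -- The extra term `ρ²(m/s)²/2` covers the bounded range `-m/s < y ≤ 0`, where the normal tail
  -- gives no decay.
  have hΦ : ∀ y, 0 < m + s * y → cdf (gaussianReal 0 1) (β * y) ≤
      Real.exp (ρ ^ 2 * (m / s) ^ 2 / 2 - ρ ^ 2 * y ^ 2 / 2) := by
    intro y hy
    rcases le_total 0 y with hy0 | hy0
    · rcases le_total 0 β with hβ | hβ
      · rw [hρ, min_eq_right hβ]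
        simpa using cdf_le_one _ _
      · rw [hρ, min_eq_left hβ]
        have h1 := cdf_gaussianReal_neg_le (x := -β * y) (mul_nonneg (by linarith) hy0)
        rw [show -(-β * y) = β * y by ring] at h1
        refine h1.trans (Real.exp_le_exp.2 ?_)
        have : 0 ≤ β ^ 2 * (m / s) ^ 2 := by positivity
        nlinarith
    · refine (cdf_le_one _ _).trans (Real.one_le_exp ?_)
      have h1 : -y ≤ m / s := by
        rw [le_div_iff₀ hs]; nlinarith
      have h2 : y ^ 2 ≤ (m / s) ^ 2 := by nlinarith
      have : 0 ≤ ρ ^ 2 * ((m / s) ^ 2 - y ^ 2) := mul_nonneg (sq_nonneg _) (by linarith)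
      nlinarith
  have hbound : ∀ y, 0 < m + s * y → gaussianPDFReal 0 1 y * Real.exp (l * (m + s * y) ^ 2) *
      cdf (gaussianReal 0 1) (β * y) ≤
        (√(2 * Real.pi))⁻¹ * Real.exp D * Real.exp (-(κ / 2) * y ^ 2) := by
    intro y hy
    rw [gaussianPDFReal_zero_one]
    calc _ ≤ (√(2 * Real.pi))⁻¹ * Real.exp (-y ^ 2 / 2) * Real.exp (l * (m + s * y) ^ 2) *
        Real.exp (ρ ^ 2 * (m / s) ^ 2 / 2 - ρ ^ 2 * y ^ 2 / 2) := by
          gcongr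
          exact hΦ y hy
      _ = (√(2 * Real.pi))⁻¹ * Real.exp (-y ^ 2 / 2 + l * (m + s * y) ^ 2 +
        (ρ ^ 2 * (m / s) ^ 2 / 2 - ρ ^ 2 * y ^ 2 / 2)) := by
          rw [Real.exp_add, Real.exp_add]; ring
      _ ≤ (√(2 * Real.pi))⁻¹ * Real.exp (D + -(κ / 2) * y ^ 2) := by
          refine mul_le_mul_of_nonneg_left (Real.exp_le_exp.2 ?_) (by positivity)
          -- Half of the spare quadratic rate `κ` absorbs the linear term, by completing the square.
          have h1 : e * y ≤ κ / 2 * y ^ 2 + e ^ 2 / (2 * κ) := by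
            have : 0 ≤ (κ * y - e) ^ 2 / (2 * κ) := by positivity
            have h2 : (κ * y - e) ^ 2 / (2 * κ) = κ / 2 * y ^ 2 + e ^ 2 / (2 * κ) - e * y := by
              field_simp; ring
            linarith
          have h3 : l * (m + s * y) ^ 2 = l * m ^ 2 + e * y + l * s ^ 2 * y ^ 2 := by
            rw [he]; ring
          rw [h3, hD]
          have h4 : l * s ^ 2 = (1 + ρ ^ 2) / 2 - κ := by rw [hκdef]; ring
          rw [h4]
          linarith
      _ = _ := by rw [Real.exp_add]; ring
  have hint : Integrable fun y : ℝ =>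
      (√(2 * Real.pi))⁻¹ * Real.exp D * Real.exp (-(κ / 2) * y ^ 2) :=
    (integrable_exp_neg_mul_sq (by positivity)).const_mul _
  rw [skewExpMoment_eq_lintegral]
  refine lt_of_le_of_lt (lintegral_mono fun y => ?_) hint.lintegral_lt_top
  by_cases hy : m + s * y ∈ Set.Ioi 0
  · rw [Set.indicator_of_mem hy]
    exact ENNReal.ofReal_le_ofReal (hbound y hy)
  · rw [Set.indicator_of_notMem hy]
    exact zero_le

/-- Above the threshold the total exponent is a quadratic in `y` with positive leading coefficient
`κ`, so the integrand is bounded below by a positive constant on a half-line. -/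
theorem skewExpMoment_eq_top {m s β l : ℝ} (hs : 0 < s)
    (h : (1 + (min β 0) ^ 2) / (2 * s ^ 2) < l) : skewExpMoment m s β l = ⊤ := by
  set ρ := min β 0 with hρ
  have hρ0 : ρ ≤ 0 := min_le_right _ _
  rw [div_lt_iff₀ (by positivity)] at h
  set κ := l * s ^ 2 - (1 + ρ ^ 2) / 2 with hκdef
  have hκ : 0 < κ := by rw [hκdef]; linarith
  have hlim : Tendsto (fun y : ℝ => y * (κ * y + (2 * l * m * s + ρ)) + (l * m ^ 2 - 1 / 2))
      atTop atTop := by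
    refine tendsto_atTop_add_const_right _ _ (tendsto_id.atTop_mul_atTop₀ ?_)
    exact tendsto_atTop_add_const_right _ _ (tendsto_id.const_mul_atTop hκ)
  have hlim2 : Tendsto (fun y : ℝ => m + s * y) atTop atTop :=
    tendsto_atTop_add_const_left _ _ (tendsto_id.const_mul_atTop hs)
  obtain ⟨y₀, hy₀⟩ := eventually_atTop.1 ((hlim.eventually_ge_atTop 0).and
    ((hlim2.eventually_gt_atTop 0).and (eventually_ge_atTop 0)))
  set c := (√(2 * Real.pi))⁻¹ with hc
  have hcpos : 0 < c := by positivity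
  have hbound : ∀ y, y₀ ≤ y → c * c ≤ gaussianPDFReal 0 1 y * Real.exp (l * (m + s * y) ^ 2) *
      cdf (gaussianReal 0 1) (β * y) := by
    intro y hy
    obtain ⟨h1, h2, h3⟩ := hy₀ y hy
    have hΦ : c * Real.exp (-(-ρ * y + 1) ^ 2 / 2) ≤ cdf (gaussianReal 0 1) (β * y) := by
      rw [hc, ← gaussianPDFReal_zero_one]
      refine (gaussianPDFReal_le_cdf_neg (mul_nonneg (by linarith) h3)).trans
        (monotone_cdf _ ?_)
      have : ρ ≤ β := min_le_left _ _
      nlinarith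
    calc c * c ≤ c * c * Real.exp (y * (κ * y + (2 * l * m * s + ρ)) + (l * m ^ 2 - 1 / 2)) :=
          le_mul_of_one_le_right (by positivity) (Real.one_le_exp h1)
      _ = (c * Real.exp (-y ^ 2 / 2)) * Real.exp (l * (m + s * y) ^ 2) *
          (c * Real.exp (-(-ρ * y + 1) ^ 2 / 2)) := by
          have : y * (κ * y + (2 * l * m * s + ρ)) + (l * m ^ 2 - 1 / 2) =
            -y ^ 2 / 2 + l * (m + s * y) ^ 2 + -(-ρ * y + 1) ^ 2 / 2 := by
            rw [hκdef]; ring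
          rw [this, Real.exp_add, Real.exp_add]; ring
      _ ≤ _ := by
          rw [hc, ← gaussianPDFReal_zero_one]
          gcongr
          exact mul_nonneg (gaussianPDFReal_nonneg _ _ _) (Real.exp_pos _).le
  rw [skewExpMoment_eq_lintegral, eq_top_iff]
  calc (⊤ : ENNReal) = ∫⁻ _ in Set.Ioi y₀, ENNReal.ofReal (c * c) := by
        have : ENNReal.ofReal (c * c) ≠ 0 := by
          simpa using (mul_pos hcpos hcpos)
        rw [lintegral_const, Measure.restrict_apply_univ, Real.volume_Ioi, ENNReal.mul_top this]
    _ ≤ ∫⁻ y in Set.Ioi y₀, (Set.Ioi 0).indicator (fun _ => ENNReal.ofReal (gaussianPDFReal 0 1 y *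
          Real.exp (l * (m + s * y) ^ 2) * cdf (gaussianReal 0 1) (β * y))) (m + s * y) := by
        refine setLIntegral_mono' measurableSet_Ioi fun y hy => ?_
        have hy' : y₀ ≤ y := le_of_lt hy
        rw [Set.indicator_of_mem (Set.mem_Ioi.2 (hy₀ y hy').2.1)]
        exact ENNReal.ofReal_le_ofReal (hbound y hy')
    _ ≤ _ := setLIntegral_le_lintegral _ _

end NormalTails

/-! ### Wedges, integrability thresholds and the slant -/

section HalfSkewNormal

open scoped RealInnerProductSpace
open Filter Topology

theorem exists_pos_of_continuousAt {f : ℝ → ℝ} (hf : ContinuousAt f 0) (h : 0 < f 0) :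
    ∃ ε, 0 < ε ∧ 0 < f ε := by
  have h1 : ∀ᶠ ε in 𝓝[>] (0 : ℝ), 0 < f ε :=
    (hf.tendsto.mono_left nhdsWithin_le_nhds).eventually_const_lt h
  obtain ⟨ε, h2, h3⟩ := (h1.and self_mem_nhdsWithin).exists
  exact ⟨ε, h3, h2⟩

variable {E : Type*} [NormedAddCommGroup E] [InnerProductSpace ℝ E]

/-- The open wedge where both linear functionals are positive. -/
def wedge (a b : E) : Set E := {w | 0 < ⟪b, w⟫ ∧ 0 < ⟪a, w⟫}

theorem isOpen_wedge (a b : E) : IsOpen (wedge a b) :=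
  (isOpen_lt (f := fun _ : E => (0 : ℝ)) (g := fun w => ⟪b, w⟫) (by fun_prop) (by fun_prop)).inter
    (isOpen_lt (f := fun _ : E => (0 : ℝ)) (g := fun w => ⟪a, w⟫) (by fun_prop) (by fun_prop))

theorem smul_mem_wedge_iff {a b w : E} {r : ℝ} (hr : 0 < r) : r • w ∈ wedge a b ↔ w ∈ wedge a b := by
  simp [wedge, real_inner_smul_right, hr]

/-- Squared norm of the component of `a` orthogonal to `b`. -/
def rejSq (a b : E) : ℝ := ‖a‖ ^ 2 - ⟪a, b⟫ ^ 2 / ‖b‖ ^ 2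

theorem norm_sub_proj_sq {a b : E} (hb : b ≠ 0) :
    ‖a - (⟪a, b⟫ / ‖b‖ ^ 2) • b‖ ^ 2 = rejSq a b := by
  have hb' : ‖b‖ ≠ 0 := norm_ne_zero_iff.2 hb
  rw [norm_sub_sq_real, real_inner_smul_right, norm_smul, mul_pow, Real.norm_eq_abs, sq_abs, rejSq]
  field_simp
  ring

theorem wedge_bound_self {a : E} {l : ℝ} (hl : 0 ≤ l) (w : E) :
    l * ⟪a, w⟫ ^ 2 ≤ (l * ‖a‖ ^ 2) * ‖w‖ ^ 2 := by
  have := abs_real_inner_le_norm a w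
  have h2 : ⟪a, w⟫ ^ 2 ≤ (‖a‖ * ‖w‖) ^ 2 := by
    rw [← sq_abs]; gcongr
  rw [mul_assoc, ← mul_pow]
  gcongr

/-- Let `c` be the part of `a` orthogonal to `b`. On this wedge `⟪a, w⟫` is negative and is `⟪c, w⟫`
plus a nonnegative term, so `|⟪a, w⟫| ≤ |⟪c, w⟫|`: Cauchy–Schwarz with `c` improves the constant
from `‖a‖²` to `rejSq a b`. -/
theorem wedge_bound_neg {a b : E} (hb : b ≠ 0) (hab : 0 ≤ ⟪a, b⟫) {l : ℝ} (hl : 0 ≤ l) :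
    ∀ w ∈ wedge (-a) b, l * ⟪-a, w⟫ ^ 2 ≤ (l * rejSq a b) * ‖w‖ ^ 2 := by
  intro w hw
  set c := a - (⟪a, b⟫ / ‖b‖ ^ 2) • b with hc
  have h1 : ⟪a, w⟫ = ⟪c, w⟫ + ⟪a, b⟫ / ‖b‖ ^ 2 * ⟪b, w⟫ := by
    rw [hc, inner_sub_left, real_inner_smul_left]; ring
  have h2 : ⟪a, w⟫ < 0 := by simpa using hw.2
  have h3 : 0 < ⟪b, w⟫ := hw.1
  have h4 : 0 ≤ ⟪a, b⟫ / ‖b‖ ^ 2 * ⟪b, w⟫ := by positivity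
  have h5 : ⟪a, w⟫ ^ 2 ≤ ⟪c, w⟫ ^ 2 := by nlinarith
  have h6 := wedge_bound_self (a := c) hl w
  rw [hc, norm_sub_proj_sq hb, ← hc] at h6
  refine le_trans ?_ h6
  rw [inner_neg_left, neg_sq]
  gcongr

/-- Sharpness of the Cauchy–Schwarz bound: the extremal direction `a` may lie on the boundary of the
open wedge, so it is pushed inside by a small multiple of `b`, and `l' < l` pays for the push. -/
theorem exists_mem_wedge_self {a b : E} (ha : a ≠ 0) (hb : b ≠ 0) (hab : 0 ≤ ⟪a, b⟫) {l l' : ℝ}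
    (hl : l' < l) : ∃ w ∈ wedge a b, (l' * ‖a‖ ^ 2) * ‖w‖ ^ 2 < l * ⟪a, w⟫ ^ 2 := by
  have ha' : 0 < ‖a‖ := norm_pos_iff.2 ha
  have hb' : 0 < ‖b‖ := norm_pos_iff.2 hb
  obtain ⟨ε, hε, h⟩ := exists_pos_of_continuousAt
    (f := fun ε => l * ⟪a, a + ε • b⟫ ^ 2 - (l' * ‖a‖ ^ 2) * ‖a + ε • b‖ ^ 2) (by fun_prop) (by
      simp only [zero_smul, add_zero, real_inner_self_eq_norm_sq]
      have : 0 < (l - l') * ‖a‖ ^ 4 := mul_pos (by linarith) (by positivity)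
      linarith)
  refine ⟨a + ε • b, ⟨?_, ?_⟩, by linarith⟩
  · rw [inner_add_right, real_inner_smul_right, real_inner_self_eq_norm_sq, real_inner_comm]
    positivity
  · rw [inner_add_right, real_inner_smul_right, real_inner_self_eq_norm_sq]
    positivity

/-- The extremal direction is now `-c`, with `c` the part of `a` orthogonal to `b`. It lies on the
face `⟪b, w⟫ = 0` and is again pushed inside. -/
theorem exists_mem_wedge_neg {a b : E} (hb : b ≠ 0) (hK : 0 < rejSq a b) {l l' : ℝ}
    (hl : l' < l) : ∃ w ∈ wedge (-a) b, (l' * rejSq a b) * ‖w‖ ^ 2 < l * ⟪-a, w⟫ ^ 2 := by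
  have hb' : 0 < ‖b‖ := norm_pos_iff.2 hb
  set c := a - (⟪a, b⟫ / ‖b‖ ^ 2) • b with hc
  have hcc : ‖c‖ ^ 2 = rejSq a b := norm_sub_proj_sq hb
  have hbc : ⟪b, c⟫ = 0 := by
    rw [hc, inner_sub_right, real_inner_smul_right, real_inner_self_eq_norm_sq, real_inner_comm]
    field_simp; ring
  have hac : ⟪a, c⟫ = rejSq a b := by
    have : a = c + (⟪a, b⟫ / ‖b‖ ^ 2) • b := by rw [hc]; abel
    rw [this, inner_add_left, real_inner_smul_left, hbc, mul_zero, add_zero,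
      real_inner_self_eq_norm_sq, hcc]
    rw [← this]
  obtain ⟨ε, hε, h⟩ := exists_pos_of_continuousAt
    (f := fun ε => min (⟪-a, -c + ε • b⟫)
      (l * ⟪-a, -c + ε • b⟫ ^ 2 - (l' * rejSq a b) * ‖-c + ε • b‖ ^ 2)) (by fun_prop) (by
      simp only [zero_smul, add_zero, inner_neg_neg, hac, norm_neg, hcc]
      refine lt_min hK ?_
      have : 0 < (l - l') * rejSq a b ^ 2 := mul_pos (by linarith) (by positivity)
      linarith)
  rw [lt_min_iff] at h
  refine ⟨-c + ε • b, ⟨?_, h.1⟩, by linarith [h.2]⟩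
  rw [inner_add_right, inner_neg_right, hbc, real_inner_smul_right, real_inner_self_eq_norm_sq]
  simp; positivity

variable [MeasurableSpace E]

/-- On the half space `⟪b, w⟫ > 0`, the functional `⟪a, w⟫` has half the law of `m + s Y`, where
`Y` is skew normal with slant `β`. -/
def IsHalfSkewNormal (μ : Measure E) (a b : E) (m s β : ℝ) : Prop :=
  ∀ h : ℝ → ENNReal, Measurable h → ∫⁻ w in {w | 0 < ⟪b, w⟫}, h ⟪a, w⟫ ∂μ =
    ∫⁻ y, h (m + s * y) * ENNReal.ofReal (cdf (gaussianReal 0 1) (β * y)) ∂gaussianReal 0 1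

theorem IsHalfSkewNormal.neg {μ : Measure E} {a b : E} {m s β : ℝ}
    (H : IsHalfSkewNormal μ a b m s β) : IsHalfSkewNormal μ (-a) b (-m) s (-β) := by
  intro h hh
  have h1 := H (fun x => h (-x)) (by fun_prop)
  have hc := measurable_cdf (gaussianReal 0 1)
  have h2 := lintegral_gaussianReal_neg
    (h := fun y => h (-(m + s * y)) * ENNReal.ofReal (cdf (gaussianReal 0 1) (β * y)))
    (by fun_prop)
  simp only [inner_neg_left]
  rw [h1, ← h2]
  refine lintegral_congr fun y => ?_
  ring_nf

variable [FiniteDimensional ℝ E] [BorelSpace E]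

theorem lintegral_radialMeasure [Nontrivial E] {p : ℝ → ENNReal} (hp : Measurable p)
    {h : E → ENNReal} (hh : Measurable h) :
    ∫⁻ w, h w ∂radialMeasure E p = ∫⁻ s, (∫⁻ r in Set.Ioi (0 : ℝ),
      ENNReal.ofReal (r ^ (Module.finrank ℝ E - 1)) * (p r * h (r • s.val)))
        ∂(volume : Measure E).toSphere := by
  have hpn : Measurable fun w : E => p ‖w‖ := by fun_prop
  rw [radialMeasure, lintegral_withDensity_eq_lintegral_mul _ hpn hh,
    lintegral_polar (hpn.mul hh)]
  refine lintegral_congr fun s => setLIntegral_congr_fun measurableSet_Ioi fun r hr => ?_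
  have hr' : (0 : ℝ) < r := hr
  simp [norm_smul, abs_of_pos hr', norm_eq_of_mem_sphere s]

/-- The integral of `exp (l r²)` against the radial part of `radialMeasure E p`. -/
def radialExpMoment (E : Type*) [NormedAddCommGroup E] [InnerProductSpace ℝ E]
    (p : ℝ → ENNReal) (l : ℝ) : ENNReal :=
  ∫⁻ r in Set.Ioi (0 : ℝ), ENNReal.ofReal (r ^ (Module.finrank ℝ E - 1)) *
    (p r * ENNReal.ofReal (Real.exp (l * r ^ 2)))

/-- The integral of `exp (l ⟪a, w⟫²)` over the wedge `wedge a b`. -/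
def wedgeExpMoment (μ : Measure E) (a b : E) (l : ℝ) : ENNReal :=
  ∫⁻ w in wedge a b, ENNReal.ofReal (Real.exp (l * ⟪a, w⟫ ^ 2)) ∂μ

theorem wedgeExpMoment_eq [Nontrivial E] {p : ℝ → ENNReal} (hp : Measurable p) (a b : E) (l : ℝ) :
    wedgeExpMoment (radialMeasure E p) a b l = ∫⁻ s, (∫⁻ r in Set.Ioi (0 : ℝ),
      ENNReal.ofReal (r ^ (Module.finrank ℝ E - 1)) * (p r * (wedge a b).indicator
        (fun w => ENNReal.ofReal (Real.exp (l * ⟪a, w⟫ ^ 2))) (r • s.val)))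
        ∂(volume : Measure E).toSphere := by
  rw [wedgeExpMoment, ← lintegral_indicator (isOpen_wedge a b).measurableSet,
    lintegral_radialMeasure hp]
  exact Measurable.indicator (by fun_prop) (isOpen_wedge a b).measurableSet

theorem wedgeExpMoment_lt_top [Nontrivial E] {p : ℝ → ENNReal} (hp : Measurable p) {a b : E}
    {l K : ℝ} (hK : ∀ w ∈ wedge a b, l * ⟪a, w⟫ ^ 2 ≤ K * ‖w‖ ^ 2)
    (h : radialExpMoment E p K < ⊤) : wedgeExpMoment (radialMeasure E p) a b l < ⊤ := by
  rw [wedgeExpMoment_eq hp]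
  calc _ ≤ ∫⁻ _, radialExpMoment E p K ∂(volume : Measure E).toSphere := by
        refine lintegral_mono fun s => setLIntegral_mono' measurableSet_Ioi fun r hr => ?_
        have hr' : (0 : ℝ) < r := hr
        gcongr
        by_cases hw : r • s.val ∈ wedge a b
        · rw [Set.indicator_of_mem hw]
          refine ENNReal.ofReal_le_ofReal (Real.exp_le_exp.2 ((hK _ hw).trans_eq ?_))
          simp [norm_smul, norm_eq_of_mem_sphere s]
        · rw [Set.indicator_of_notMem hw]
          exact zero_le
    _ < ⊤ := by
        rw [lintegral_const]
        exact ENNReal.mul_lt_top h (measure_lt_top _ _)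

/-- Strict inequality persists on an open set of directions, which has positive spherical measure.
An infinite radial moment would therefore make the wedge moment infinite. -/
theorem radialExpMoment_lt_top [Nontrivial E] {p : ℝ → ENNReal} (hp : Measurable p) {a b : E}
    {l K : ℝ} (hw : ∃ w ∈ wedge a b, K * ‖w‖ ^ 2 < l * ⟪a, w⟫ ^ 2)
    (h : wedgeExpMoment (radialMeasure E p) a b l < ⊤) : radialExpMoment E p K < ⊤ := by
  let U : Set (Metric.sphere (0 : E) 1) := {s | s.val ∈ wedge a b ∧ K < l * ⟪a, s.val⟫ ^ 2}
  have hU : IsOpen U := ((isOpen_wedge a b).preimage continuous_subtype_val).inter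
    (isOpen_lt (f := fun _ : Metric.sphere (0 : E) 1 => K) (g := fun s => l * ⟪a, s.val⟫ ^ 2)
      (by fun_prop) (by fun_prop))
  have hUne : U.Nonempty := by
    obtain ⟨w, hwm, hwl⟩ := hw
    have hw0 : w ≠ 0 := by
      rintro rfl
      simpa using hwm.1
    have hn : 0 < ‖w‖ := norm_pos_iff.2 hw0
    refine ⟨⟨‖w‖⁻¹ • w, by simp [norm_smul, hn.ne']⟩, ?_, ?_⟩
    · exact (smul_mem_wedge_iff (by positivity)).2 hwm
    · simp only [real_inner_smul_right]
      rw [mul_pow, inv_pow, mul_left_comm, ← div_eq_inv_mul, lt_div_iff₀ (by positivity)]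
      exact hwl
  have hpos := hU.measure_pos (volume : Measure E).toSphere hUne
  by_contra hcon
  rw [not_lt, top_le_iff] at hcon
  refine h.ne ?_
  rw [wedgeExpMoment_eq hp, eq_top_iff]
  calc (⊤ : ENNReal) = ∫⁻ _ in U, radialExpMoment E p K ∂(volume : Measure E).toSphere := by
        rw [hcon, lintegral_const, Measure.restrict_apply_univ, ENNReal.top_mul hpos.ne']
    _ ≤ ∫⁻ s in U, (∫⁻ r in Set.Ioi (0 : ℝ),
      ENNReal.ofReal (r ^ (Module.finrank ℝ E - 1)) * (p r * (wedge a b).indicator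
        (fun w => ENNReal.ofReal (Real.exp (l * ⟪a, w⟫ ^ 2))) (r • s.val)))
        ∂(volume : Measure E).toSphere := by
        refine setLIntegral_mono' hU.measurableSet fun s hs => ?_
        refine setLIntegral_mono' measurableSet_Ioi fun r hr => ?_
        have hr' : (0 : ℝ) < r := hr
        gcongr
        rw [Set.indicator_of_mem ((smul_mem_wedge_iff hr').2 hs.1)]
        refine ENNReal.ofReal_le_ofReal (Real.exp_le_exp.2 ?_)
        have h2 := hs.2.le
        rw [real_inner_smul_right, mul_pow]
        nlinarith [sq_nonneg r]
    _ ≤ _ := setLIntegral_le_lintegral _ _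

theorem IsHalfSkewNormal.wedgeExpMoment_eq {μ : Measure E} {a b : E} {m s β : ℝ}
    (H : IsHalfSkewNormal μ a b m s β) (l : ℝ) :
    wedgeExpMoment μ a b l = skewExpMoment m s β l := by
  have h1 := H ((Set.Ioi 0).indicator (fun x => ENNReal.ofReal (Real.exp (l * x ^ 2))))
    (Measurable.indicator (by fun_prop) measurableSet_Ioi)
  rw [skewExpMoment, ← h1, wedgeExpMoment]
  have hm : MeasurableSet {w : E | 0 < ⟪b, w⟫} := measurableSet_lt measurable_const (by fun_prop)
  rw [← lintegral_indicator (isOpen_wedge a b).measurableSet, ← lintegral_indicator hm]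
  refine lintegral_congr fun w => ?_
  by_cases hb : 0 < ⟪b, w⟫ <;> by_cases ha : 0 < ⟪a, w⟫ <;>
    simp [Set.indicator, wedge, hb, ha]

/-- A common radial threshold `R` gives wedge thresholds `R / ‖a‖²` on the side of `a` and `R /
rejSq a b` on the side of `-a`. The skew normal law gives `t` and `t'`, whence `t ‖a‖² = t' rejSq a
b`. The threshold `R` is never named: both inequalities are proved by passing finiteness from one
wedge to the other. -/
theorem IsHalfSkewNormal.slant_eq [Nontrivial E] {p : ℝ → ENNReal} (hp : Measurable p) {a b : E}
    {m s β : ℝ} (H : IsHalfSkewNormal (radialMeasure E p) a b m s β) (hs : 0 < s) (ha : a ≠ 0)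
    (hb : b ≠ 0) (hab : 0 ≤ ⟪a, b⟫) (hK : 0 < rejSq a b) :
    0 ≤ β ∧ (1 + β ^ 2) * rejSq a b = ‖a‖ ^ 2 := by
  have ha' : 0 < ‖a‖ ^ 2 := by have := norm_pos_iff.2 ha; positivity
  set K := rejSq a b with hKdef
  set A := ‖a‖ ^ 2 with hA
  set t := (1 + (min β 0) ^ 2) / (2 * s ^ 2) with ht
  set t' := (1 + (min (-β) 0) ^ 2) / (2 * s ^ 2) with ht'
  have htpos : 0 < t := by positivity
  have htpos' : 0 < t' := by positivity
  have hKA : K ≤ A := by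
    rw [hKdef, rejSq, ← hA]
    have : 0 ≤ ⟪a, b⟫ ^ 2 / ‖b‖ ^ 2 := by positivity
    linarith
  have e1 := H.wedgeExpMoment_eq
  have e2 := H.neg.wedgeExpMoment_eq
  -- Otherwise some `u > t'` has `uK/A < t`: finiteness on the wedge of `a` just below `t` gives the
  -- radial moment at `uK`, hence finiteness at `u` on the wedge of `-a`, beyond its threshold.
  have hP : t * A ≤ t' * K := by
    by_contra! hcon
    obtain ⟨u, hu1, hu2⟩ := exists_between ((lt_div_iff₀ hK).2 hcon)
    have hu0 : 0 < u := htpos'.trans hu1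
    have hul : u * K / A < t := by rw [div_lt_iff₀ ha']; rwa [lt_div_iff₀ hK] at hu2
    obtain ⟨l, hl1, hl2⟩ := exists_between hul
    have h1 : radialExpMoment E p (u * K / A * A) < ⊤ :=
      radialExpMoment_lt_top hp (exists_mem_wedge_self ha hb hab hl1)
        (by rw [e1]; exact skewExpMoment_lt_top hs hl2)
    rw [div_mul_cancel₀ _ ha'.ne'] at h1
    have h2 := wedgeExpMoment_lt_top hp (wedge_bound_neg hb hab hu0.le) h1
    rw [e2, skewExpMoment_eq_top hs hu1] at h2
    exact lt_irrefl _ h2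
  have hQ : t' * K ≤ t * A := by
    by_contra! hcon
    obtain ⟨u, hu1, hu2⟩ := exists_between ((lt_div_iff₀ ha').2 hcon)
    have hu0 : 0 < u := htpos.trans hu1
    have hul : u * A / K < t' := by rw [div_lt_iff₀ hK]; rwa [lt_div_iff₀ ha'] at hu2
    obtain ⟨l, hl1, hl2⟩ := exists_between hul
    have h1 : radialExpMoment E p (u * A / K * K) < ⊤ :=
      radialExpMoment_lt_top hp (exists_mem_wedge_neg hb hK hl1)
        (by rw [e2]; exact skewExpMoment_lt_top hs hl2)
    rw [div_mul_cancel₀ _ hK.ne'] at h1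
    have h2 := wedgeExpMoment_lt_top (b := b) hp
      (fun w _ => wedge_bound_self (a := a) hu0.le w) h1
    rw [e1, skewExpMoment_eq_top hs hu1] at h2
    exact lt_irrefl _ h2
  have heq := le_antisymm hQ hP
  rw [ht, ht', div_mul_eq_mul_div, div_mul_eq_mul_div,
    div_left_inj' (by positivity)] at heq
  -- A negative slant would give `K = (1 + β²)A > A`, against `K ≤ A`.
  rcases le_or_gt 0 β with hβ | hβ
  · refine ⟨hβ, ?_⟩
    rw [min_eq_right hβ, min_eq_left (by linarith)] at heq
    nlinarith
  · rw [min_eq_left hβ.le, min_eq_right (by linarith)] at heq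
    have : 0 < β ^ 2 * A := mul_pos (by nlinarith) ha'
    nlinarith

end HalfSkewNormal

/-! ### The location vanishes and the projection is normal -/

section SkewNormalLocation

open scoped RealInnerProductSpace
open Filter Topology

variable {E : Type*} [NormedAddCommGroup E] [InnerProductSpace ℝ E] [FiniteDimensional ℝ E]
  [MeasurableSpace E] [BorelSpace E]

/-- In polar coordinates the mass of a cone is its spherical measure times a radial factor, and
total mass one fixes that factor. -/
theorem radialMeasure_cone_congr [Nontrivial E] {p p' : ℝ → ENNReal} (hp : Measurable p)
    (hp' : Measurable p') [IsProbabilityMeasure (radialMeasure E p)]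
    [IsProbabilityMeasure (radialMeasure E p')] {C : Set E} (hC : MeasurableSet C)
    (hcone : ∀ (w : E) (r : ℝ), 0 < r → (r • w ∈ C ↔ w ∈ C)) :
    radialMeasure E p C = radialMeasure E p' C := by
  set σ := (volume : Measure E).toSphere with hσ
  set N : (ℝ → ENNReal) → ENNReal := fun p => ∫⁻ r in Set.Ioi (0 : ℝ),
    ENNReal.ofReal (r ^ (Module.finrank ℝ E - 1)) * p r with hN
  have hσ0 : σ Set.univ ≠ 0 := by
    rw [Ne, Measure.measure_univ_eq_zero]
    exact Measure.toSphere_ne_zero _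
  have key : ∀ q : ℝ → ENNReal, Measurable q → ∀ D : Set E, MeasurableSet D →
      (∀ (w : E) (r : ℝ), 0 < r → (r • w ∈ D ↔ w ∈ D)) →
      radialMeasure E q D = N q * σ (Subtype.val ⁻¹' D) := by
    intro q hq D hD hDc
    rw [← lintegral_indicator_one hD, lintegral_radialMeasure hq (measurable_one.indicator hD),
      ← lintegral_indicator_one (hD.preimage measurable_subtype_coe), ← lintegral_const_mul _
        (measurable_one.indicator (hD.preimage measurable_subtype_coe))]
    refine lintegral_congr fun s => ?_
    rw [hN, ← lintegral_mul_const _ (by fun_prop)]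
    refine setLIntegral_congr_fun measurableSet_Ioi fun r hr => ?_
    have hr' : (0 : ℝ) < r := hr
    by_cases hs : s.val ∈ D
    · have h1 : r • s.val ∈ D := (hDc _ _ hr').2 hs
      simp [hs, h1]
    · have h1 : r • s.val ∉ D := fun h => hs ((hDc _ _ hr').1 h)
      simp [hs, h1]
  have hNeq : ∀ q : ℝ → ENNReal, Measurable q → IsProbabilityMeasure (radialMeasure E q) →
      N q = (σ Set.univ)⁻¹ := by
    intro q hq hprob
    have h1 := key q hq Set.univ MeasurableSet.univ (by simp)
    rw [measure_univ, Set.preimage_univ] at h1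
    exact ENNReal.eq_inv_of_mul_eq_one_left h1.symm
  rw [key p hp C hC hcone, key p' hp' C hC hcone, hNeq p hp inferInstance, hNeq p' hp' inferInstance]

theorem stdGaussian_eq_radialMeasure : ∃ p : ℝ → ENNReal, Measurable p ∧
    stdGaussian E = radialMeasure E p := by
  refine ⟨fun r => ENNReal.ofReal ((2 * Real.pi * (1 : ℝ) ^ 2) ^ (-(Module.finrank ℝ E : ℝ) / 2) *
    Real.exp (-(r ^ 2) / (2 * (1 : ℝ) ^ 2))), by fun_prop, stdGaussian_eq_withDensity⟩

theorem stdGaussian_map_inner_prod {e₁ e₂ : E} (h₁ : ‖e₁‖ = 1) (h₂ : ‖e₂‖ = 1)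
    (h₁₂ : ⟪e₁, e₂⟫ = 0) :
    (stdGaussian E).map (fun w => (⟪e₁, w⟫, ⟪e₂, w⟫)) =
      (gaussianReal 0 1).prod (gaussianReal 0 1) := by
  have hm : Measurable fun w : E => (⟪e₁, w⟫, ⟪e₂, w⟫) := by fun_prop
  have : IsProbabilityMeasure ((stdGaussian E).map (fun w => (⟪e₁, w⟫, ⟪e₂, w⟫))) :=
    Measure.isProbabilityMeasure_map hm.aemeasurable
  rw [← charFun_eq_prod_iff]
  intro t
  rw [Measure.map_map (by fun_prop) hm, charFun_gaussianReal, charFun_gaussianReal]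
  have h1 : charFun ((stdGaussian E).map (WithLp.toLp 2 ∘ fun w => (⟪e₁, w⟫, ⟪e₂, w⟫))) t =
      charFun (stdGaussian E) ((WithLp.ofLp t).1 • e₁ + (WithLp.ofLp t).2 • e₂) := by
    rw [charFun_apply, charFun_apply, integral_map (by fun_prop) (by fun_prop)]
    refine integral_congr_ae (ae_of_all _ fun w => ?_)
    simp only [Function.comp_apply, WithLp.prod_inner_apply, inner_add_right,
      real_inner_smul_right, RCLike.inner_apply, conj_trivial, real_inner_comm w]
  rw [h1, charFun_stdGaussian, ← Complex.exp_add]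
  congr 1
  have h2 : ‖(WithLp.ofLp t).1 • e₁ + (WithLp.ofLp t).2 • e₂‖ ^ 2 =
      (WithLp.ofLp t).1 ^ 2 + (WithLp.ofLp t).2 ^ 2 := by
    rw [norm_add_sq_real, norm_smul, norm_smul, h₁, h₂, real_inner_smul_left, real_inner_smul_right,
      h₁₂]
    simp
  rw [← Complex.ofReal_pow, h2]
  push_cast
  ring

/-- Split `b` into its part along `a` and its orthogonal part `c`. The normalised functionals of `a`
and `c` are independent standard normals `Y₁`, `Y₂`, and `⟪b, w⟫ > 0` means `Y₂ > -βY₁`, which has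
probability `Φ(βy)` given `Y₁ = y`. This `β` satisfies the equation of `IsHalfSkewNormal.slant_eq`.
-/
theorem stdGaussian_wedge_neg {a b : E} (ha : a ≠ 0) (hb : b ≠ 0) (hab : 0 ≤ ⟪a, b⟫)
    (hK : 0 < rejSq a b) :
    ∃ β : ℝ, 0 ≤ β ∧ (1 + β ^ 2) * rejSq a b = ‖a‖ ^ 2 ∧
      stdGaussian E (wedge (-a) b) = ∫⁻ y in Set.Iio 0,
        ENNReal.ofReal (cdf (gaussianReal 0 1) (β * y)) ∂gaussianReal 0 1 := by
  have ha' : 0 < ‖a‖ := norm_pos_iff.2 ha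
  have hb' : 0 < ‖b‖ := norm_pos_iff.2 hb
  have hK' : 0 < rejSq b a := by
    have : rejSq b a = rejSq a b * ‖b‖ ^ 2 / ‖a‖ ^ 2 := by
      rw [rejSq, rejSq, real_inner_comm]; field_simp
    rw [this]; positivity
  set c := b - (⟪b, a⟫ / ‖a‖ ^ 2) • a with hc
  have hcc : ‖c‖ ^ 2 = rejSq b a := norm_sub_proj_sq ha
  have hcpos : 0 < ‖c‖ := by
    rcases (norm_nonneg c).eq_or_lt with h | h
    · rw [← h] at hcc; simp at hcc; linarith
    · exact h
  have hac : ⟪a, c⟫ = 0 := by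
    rw [hc, inner_sub_right, real_inner_smul_right, real_inner_self_eq_norm_sq, real_inner_comm]
    field_simp; ring
  set β := ⟪a, b⟫ / (‖a‖ * ‖c‖) with hβ
  refine ⟨β, by positivity, ?_, ?_⟩
  · have : rejSq b a = ‖b‖ ^ 2 - ⟪a, b⟫ ^ 2 / ‖a‖ ^ 2 := by rw [rejSq, real_inner_comm]
    have h2 : ‖a‖ ^ 2 * ‖c‖ ^ 2 = ‖a‖ ^ 2 * ‖b‖ ^ 2 - ⟪a, b⟫ ^ 2 := by
      rw [hcc, this]; field_simp
    have h3 : rejSq a b = ‖a‖ ^ 2 * ‖c‖ ^ 2 / ‖b‖ ^ 2 := by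
      rw [h2, rejSq]; field_simp
    rw [h3, hβ, div_pow, mul_pow]
    field_simp
    linarith
  · have hjoint := stdGaussian_map_inner_prod (e₁ := ‖a‖⁻¹ • a) (e₂ := ‖c‖⁻¹ • c)
      (by rw [norm_smul]; simp [ha'.ne']) (by rw [norm_smul]; simp [hcpos.ne'])
      (by rw [real_inner_smul_left, real_inner_smul_right, hac]; simp)
    have hD : MeasurableSet {q : ℝ × ℝ | q.1 < 0 ∧ -(β * q.1) < q.2} :=
      (measurableSet_lt (f := fun q : ℝ × ℝ => q.1) (g := fun _ => 0) (by fun_prop)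
        (by fun_prop)).inter (measurableSet_lt (f := fun q : ℝ × ℝ => -(β * q.1))
        (g := fun q => q.2) (by fun_prop) (by fun_prop))
    have hpre : wedge (-a) b = (fun w => (⟪‖a‖⁻¹ • a, w⟫, ⟪‖c‖⁻¹ • c, w⟫)) ⁻¹'
        {q : ℝ × ℝ | q.1 < 0 ∧ -(β * q.1) < q.2} := by
      ext w
      simp only [wedge, Set.mem_preimage, real_inner_smul_left, inner_neg_left]
      have hbw : ⟪b, w⟫ = ⟪c, w⟫ + ⟪a, b⟫ / ‖a‖ ^ 2 * ⟪a, w⟫ := by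
        rw [hc, inner_sub_left, real_inner_smul_left, real_inner_comm a b]; ring
      have h1 : ‖a‖⁻¹ * ⟪a, w⟫ < 0 ↔ 0 < -⟪a, w⟫ := by
        rw [inv_mul_lt_iff₀ ha']; simp
      have h2 : -(β * (‖a‖⁻¹ * ⟪a, w⟫)) < ‖c‖⁻¹ * ⟪c, w⟫ ↔ 0 < ⟪b, w⟫ := by
        rw [hbw, hβ, ← sub_pos]
        have : ‖c‖⁻¹ * ⟪c, w⟫ - -(⟪a, b⟫ / (‖a‖ * ‖c‖) * (‖a‖⁻¹ * ⟪a, w⟫)) =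
            ‖c‖⁻¹ * (⟪c, w⟫ + ⟪a, b⟫ / ‖a‖ ^ 2 * ⟪a, w⟫) := by field_simp; ring
        rw [this, mul_pos_iff_of_pos_left (by positivity)]
      exact (and_comm.trans (and_congr h1.symm h2.symm))
    rw [hpre, ← Measure.map_apply (by fun_prop) hD, hjoint, Measure.prod_apply hD,
      ← lintegral_indicator measurableSet_Iio]
    refine lintegral_congr fun y => ?_
    by_cases hy : y < 0
    · rw [Set.indicator_of_mem (Set.mem_Iio.2 hy), ← gaussianReal_Ioi_neg]
      congr 1
      ext x
      simp [hy]
    · rw [Set.indicator_of_notMem (by simpa using hy)]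
      simp [hy]

/-- The slant agrees with the Gaussian one, so the wedge probability is the integral of `Φ(βy)` over
`y < -m/s` by hypothesis and over `y < 0` by comparison with the standard Gaussian law. -/
theorem IsHalfSkewNormal.location_eq_zero_of_nonneg [Nontrivial E] {p : ℝ → ENNReal}
    (hp : Measurable p) [IsProbabilityMeasure (radialMeasure E p)] {a b : E}
    {m s β : ℝ} (H : IsHalfSkewNormal (radialMeasure E p) a b m s β) (hs : 0 < s) (ha : a ≠ 0)
    (hb : b ≠ 0) (hab : 0 ≤ ⟪a, b⟫) (hK : 0 < rejSq a b) : m = 0 := by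
  obtain ⟨hβ0, hβ⟩ := H.slant_eq hp hs ha hb hab hK
  obtain ⟨β', hβ0', hβ', hG⟩ := stdGaussian_wedge_neg ha hb hab hK
  have hββ : β' = β := by
    have h1 : (1 + β' ^ 2) = 1 + β ^ 2 := mul_right_cancel₀ hK.ne' (hβ'.trans hβ.symm)
    exact (sq_eq_sq₀ hβ0' hβ0).1 (by linarith)
  subst hββ
  obtain ⟨p', hp', hpG⟩ := stdGaussian_eq_radialMeasure (E := E)
  have hprob : IsProbabilityMeasure (radialMeasure E p') := by rw [← hpG]; infer_instance
  have hcone := radialMeasure_cone_congr hp hp' (isOpen_wedge (-a) b).measurableSet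
    (fun w r hr => smul_mem_wedge_iff hr)
  rw [← hpG, hG] at hcone
  set ν := (gaussianReal 0 1).withDensity
    (fun y => ENNReal.ofReal (cdf (gaussianReal 0 1) (β' * y))) with hν
  have hcm : Measurable fun y => ENNReal.ofReal (cdf (gaussianReal 0 1) (β' * y)) :=
    ((measurable_cdf _).comp (by fun_prop)).ennreal_ofReal
  have hleft : radialMeasure E p (wedge (-a) b) = ν (Set.Iio (-(m / s))) := by
    have h1 := H ((Set.Iio 0).indicator 1) (measurable_one.indicator measurableSet_Iio)
    have hm : MeasurableSet {w : E | 0 < ⟪b, w⟫} := measurableSet_lt measurable_const (by fun_prop)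
    rw [← lintegral_indicator hm] at h1
    rw [← lintegral_indicator_one (isOpen_wedge (-a) b).measurableSet, hν,
      withDensity_apply _ measurableSet_Iio, ← lintegral_indicator measurableSet_Iio]
    refine Eq.trans (lintegral_congr fun w => ?_) (h1.trans (lintegral_congr fun y => ?_))
    · by_cases hbw : 0 < ⟪b, w⟫ <;> by_cases haw : ⟪a, w⟫ < 0 <;>
        simp [Set.indicator, wedge, hbw, haw]
    · have hiff : m + s * y < 0 ↔ y < -(m / s) := by
        rw [← neg_div, lt_div_iff₀ hs]
        constructor <;> intro h <;> linarith
      by_cases hy : m + s * y < 0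
      · simp [Set.indicator, hy, hiff.1 hy]
      · have hy' : ¬ y < -(m / s) := fun h => hy (hiff.2 h)
        simp only [Set.indicator, Set.mem_Iio, hy, hy', if_false, zero_mul]
  have hright : ν (Set.Iio 0) = ∫⁻ y in Set.Iio 0,
      ENNReal.ofReal (cdf (gaussianReal 0 1) (β' * y)) ∂gaussianReal 0 1 :=
    withDensity_apply _ measurableSet_Iio
  rw [hleft, ← hright] at hcone
  have hfin : ∀ x, ν (Set.Iio x) ≠ ⊤ := by
    intro x
    rw [hν, withDensity_apply _ measurableSet_Iio]
    refine ne_top_of_le_ne_top (measure_ne_top (gaussianReal 0 1) (Set.Iio x)) ?_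
    rw [← setLIntegral_one]
    refine lintegral_mono fun y => ?_
    rw [← ENNReal.ofReal_one]
    exact ENNReal.ofReal_le_ofReal (cdf_le_one _ _)
  -- The density `Φ(β'y)` is positive everywhere, so every interval is charged.
  have hstrict : ∀ x y, x < y → ν (Set.Iio x) ≠ ν (Set.Iio y) := by
    intro x y hxy heq
    have h1 : ν (Set.Iio y \ Set.Iio x) = 0 := by
      rw [measure_sdiff (Set.Iio_subset_Iio hxy.le) measurableSet_Iio.nullMeasurableSet (hfin x),
        heq, tsub_self]
    rw [hν, withDensity_apply_eq_zero hcm] at h1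
    have h2 : Set.Ioo x y ⊆ {z | ENNReal.ofReal (cdf (gaussianReal 0 1) (β' * z)) ≠ 0} ∩
        (Set.Iio y \ Set.Iio x) := by
      intro z hz
      refine ⟨?_, hz.2, by simpa using hz.1.le⟩
      simpa using cdf_gaussianReal_pos _
    have h3 := gaussianReal_absolutelyContinuous' 0 one_ne_zero (measure_mono_null h2 h1)
    simp at h3
    linarith
  have hms : -(m / s) = 0 := by
    rcases lt_trichotomy (-(m / s)) 0 with h | h | h
    · exact absurd hcone (hstrict _ _ h)
    · exact h
    · exact absurd hcone.symm (hstrict _ _ h)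
  rw [neg_eq_zero, div_eq_zero_iff] at hms
  exact hms.resolve_right hs.ne'

theorem IsHalfSkewNormal.location_eq_zero [Nontrivial E] {p : ℝ → ENNReal}
    (hp : Measurable p) [IsProbabilityMeasure (radialMeasure E p)] {a b : E}
    {m s β : ℝ} (H : IsHalfSkewNormal (radialMeasure E p) a b m s β) (hs : 0 < s) (ha : a ≠ 0)
    (hb : b ≠ 0) (hK : 0 < rejSq a b) : m = 0 := by
  rcases le_total 0 ⟪a, b⟫ with hab | hab
  · exact H.location_eq_zero_of_nonneg hp hs ha hb hab hK
  · have := H.neg.location_eq_zero_of_nonneg hp hs (neg_ne_zero.2 ha) hb (by simpa using hab)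
      (by simpa [rejSq] using hK)
    linarith

theorem IsHalfSkewNormal.map_inner_eq [Nontrivial E] {p : ℝ → ENNReal}
    (hp : Measurable p) [IsProbabilityMeasure (radialMeasure E p)] {a b : E}
    {m s β : ℝ} (H : IsHalfSkewNormal (radialMeasure E p) a b m s β) (hs : 0 < s) (ha : a ≠ 0)
    (hb : b ≠ 0) (hK : 0 < rejSq a b) :
    (radialMeasure E p).map (fun w => ⟪a, w⟫) = gaussianReal 0 (s ^ 2).toNNReal := by
  have hm := H.location_eq_zero hp hs ha hb hK
  subst hm
  set μ := radialMeasure E p with hμ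
  set γ := gaussianReal 0 1 with hγ
  have hsc : gaussianReal 0 (s ^ 2).toNNReal = γ.map (s * ·) := by
    rw [hγ, gaussianReal_map_const_mul]
    simp
    congr 1
    ext
    simp
    positivity
  have hneg : μ.map (fun w => -w) = μ :=
    (measurePreserving_radialMeasure hp (LinearIsometryEquiv.neg ℝ (E := E))).map_eq
  have hmp : MeasurableSet {w : E | 0 < ⟪b, w⟫} := measurableSet_lt measurable_const (by fun_prop)
  -- twice the half-space integral of an even function is the full integral
  have hhalf : ∀ h : ℝ → ENNReal, Measurable h → (∀ x, h (-x) = h x) →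
      ∫⁻ w, h ⟪a, w⟫ ∂μ = 2 * ∫⁻ w in {w | 0 < ⟪b, w⟫}, h ⟪a, w⟫ ∂μ := by
    intro h hh heven
    have hz : μ {w : E | ⟪b, w⟫ = 0} = 0 :=
      radialMeasure_absolutelyContinuous p (volume_inner_eq_zero hb)
    have h1 : ∫⁻ w in {w : E | ⟪b, w⟫ < 0}, h ⟪a, w⟫ ∂μ = ∫⁻ w in {w | 0 < ⟪b, w⟫}, h ⟪a, w⟫ ∂μ := by
      have hmn : MeasurableSet {w : E | ⟪b, w⟫ < 0} :=
        measurableSet_lt (by fun_prop) measurable_const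
      have h2 := setLIntegral_map (μ := μ) hmn (f := fun w => h ⟪a, w⟫) (g := fun w : E => -w)
        (by fun_prop) (by fun_prop)
      rw [hneg] at h2
      rw [h2]
      simp [heven]
    have hcompl : ({w : E | 0 < ⟪b, w⟫}ᶜ : Set E) =ᵐ[μ] ({w : E | ⟪b, w⟫ < 0} : Set E) := by
      have : ∀ᵐ w ∂μ, ⟪b, w⟫ ≠ 0 := measure_eq_zero_iff_ae_notMem.1 hz
      filter_upwards [this] with w hw
      apply propext
      change ¬ (0 < ⟪b, w⟫) ↔ ⟪b, w⟫ < 0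
      rw [not_lt]
      exact ⟨fun h => lt_of_le_of_ne h hw, le_of_lt⟩
    have hc := setLIntegral_congr (f := fun w => h ⟪a, w⟫) hcompl
    rw [← lintegral_add_compl _ hmp, hc, h1, two_mul]
  -- Averaging over `y` and `-y` removes the slant, as `Φ(βy) + Φ(-βy) = 1`.
  have heven : ∀ h : ℝ → ENNReal, Measurable h → (∀ x, h (-x) = h x) →
      ∫⁻ w, h ⟪a, w⟫ ∂μ = ∫⁻ y, h (s * y) ∂γ := by
    intro h hh hev
    rw [hhalf h hh hev, H h hh]
    have hc := measurable_cdf γ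
    have h1 := lintegral_gaussianReal_neg
      (h := fun y => h (0 + s * y) * ENNReal.ofReal (cdf (gaussianReal 0 1) (β * y))) (by fun_prop)
    rw [two_mul]
    nth_rewrite 1 [← h1]
    rw [← lintegral_add_right _ (by fun_prop)]
    refine lintegral_congr fun y => ?_
    have e1 : h (0 + s * -y) = h (s * y) := by rw [zero_add, mul_neg, hev]
    have e2 : β * -y = -(β * y) := by ring
    rw [e1, zero_add, ← mul_add, e2, cdf_gaussianReal_neg,
      ← ENNReal.ofReal_add (by linarith [cdf_le_one (gaussianReal 0 1) (β * y)]) (cdf_nonneg _ _)]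
    simp
  ext B hB
  rw [Measure.map_apply (by fun_prop) hB, hsc, Measure.map_apply (by fun_prop) hB]
  -- Both laws are symmetric, so the symmetrised indicator has twice the measure of `B` as its
  -- integral under each.
  set h : ℝ → ENNReal := fun x => B.indicator 1 x + B.indicator 1 (-x) with hh
  have hBm : Measurable (B.indicator (1 : ℝ → ENNReal)) := measurable_one.indicator hB
  have h1 := heven h (by fun_prop) (fun x => by simp [hh, add_comm])
  have hL : ∫⁻ w, h ⟪a, w⟫ ∂μ = 2 * μ ((fun w => ⟪a, w⟫) ⁻¹' B) := by
    rw [hh, lintegral_add_left (by fun_prop), two_mul]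
    have e1 : ∫⁻ w, B.indicator (1 : ℝ → ENNReal) ⟪a, w⟫ ∂μ = μ ((fun w => ⟪a, w⟫) ⁻¹' B) := by
      rw [← lintegral_indicator_one (hB.preimage (by fun_prop))]
      rfl
    have e2 : ∫⁻ w, B.indicator (1 : ℝ → ENNReal) (-⟪a, w⟫) ∂μ =
        ∫⁻ w, B.indicator (1 : ℝ → ENNReal) ⟪a, w⟫ ∂μ := by
      conv_rhs => rw [← hneg]
      rw [lintegral_map (by fun_prop) (by fun_prop)]
      simp
    rw [e2, e1]
  have hR : ∫⁻ y, h (s * y) ∂γ = 2 * γ ((s * ·) ⁻¹' B) := by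
    rw [hh, lintegral_add_left (by fun_prop), two_mul]
    have e1 : ∫⁻ y, B.indicator (1 : ℝ → ENNReal) (s * y) ∂γ = γ ((s * ·) ⁻¹' B) := by
      rw [← lintegral_indicator_one (hB.preimage (by fun_prop))]
      rfl
    have e2 := lintegral_gaussianReal_neg
      (h := fun y => B.indicator (1 : ℝ → ENNReal) (s * y)) (by fun_prop)
    simp only [mul_neg] at e2
    rw [e2, e1]
  rw [hL, hR] at h1
  exact (ENNReal.mul_right_inj (by simp) (by simp)).1 h1

end SkewNormalLocation

/-! ### Elliptical laws and their generators -/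

section Elliptical

variable {ι : Type*} [Fintype ι] {f : ℝ → ℝ}

theorem ellipticalConst_nonneg (hf : ∀ t, 0 ≤ t → 0 ≤ f t) : 0 ≤ ellipticalConst ι f :=
  inv_nonneg.2 (integral_nonneg fun _ => hf _ (sq_nonneg _))

/-- The radial profile of the spherical density `c f (‖w‖²)`. -/
def sphericalProfile (ι : Type*) [Fintype ι] (f : ℝ → ℝ) (r : ℝ) : ENNReal :=
  ENNReal.ofReal (ellipticalConst ι f * f (r ^ 2))

theorem measurable_sphericalProfile (hf : Measurable f) : Measurable (sphericalProfile ι f) := by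
  unfold sphericalProfile; fun_prop

variable [DecidableEq ι] {A : Matrix ι ι ℝ}

theorem ellipticalDensity_zero (y : EuclideanSpace ℝ ι) :
    ellipticalDensity 0 A f y = ellipticalConst ι f / √A.det * f (invQuadForm A y) := by
  rw [ellipticalDensity, sub_zero]

theorem measurable_ellipticalDensity (hf : Measurable f) :
    Measurable (ellipticalDensity (0 : EuclideanSpace ℝ ι) A f) := by
  have := (continuous_invQuadForm A).measurable
  simp only [funext (ellipticalDensity_zero (A := A) (f := f))]
  fun_prop

theorem ellipticalDensity_nonneg (hA : A.PosDef) (hf : ∀ t, 0 ≤ t → 0 ≤ f t)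
    (y : EuclideanSpace ℝ ι) : 0 ≤ ellipticalDensity 0 A f y := by
  rw [ellipticalDensity_zero]
  have := ellipticalConst_nonneg (ι := ι) hf
  have := hf _ (invQuadForm_nonneg hA y)
  positivity

theorem map_ellipticalDensity (hA : A.PosDef) (hf : Measurable f)
    {T : EuclideanSpace ℝ ι ≃L[ℝ] EuclideanSpace ℝ ι} (hT : ∀ y, ‖T y‖ ^ 2 = invQuadForm A y)
    (hdet : (volume : Measure (EuclideanSpace ℝ ι)).map T = ENNReal.ofReal √A.det • volume) :
    (volume.withDensity (fun y => ENNReal.ofReal (ellipticalDensity 0 A f y))).map T =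
      radialMeasure (EuclideanSpace ℝ ι) (sphericalProfile ι f) := by
  have hd := Real.sqrt_pos.2 hA.det_pos
  rw [map_withDensity_of_map_eq_smul (measurable_ellipticalDensity hf).ennreal_ofReal T hdet,
    radialMeasure]
  congr 1
  ext w
  rw [sphericalProfile, ← ENNReal.ofReal_mul hd.le, ellipticalDensity_zero, ← hT,
    T.apply_symm_apply]
  congr 1
  field_simp

variable {S : Type*} [MeasurableSpace S] {P : Measure S} {Y : S → EuclideanSpace ℝ ι}

theorem IsElliptical.map_eq_radialMeasure (h : IsElliptical P Y 0 A f)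
    {T : EuclideanSpace ℝ ι ≃L[ℝ] EuclideanSpace ℝ ι} (hT : ∀ y, ‖T y‖ ^ 2 = invQuadForm A y)
    (hdet : (volume : Measure (EuclideanSpace ℝ ι)).map T = ENNReal.ofReal √A.det • volume) :
    (P.map Y).map T = radialMeasure (EuclideanSpace ℝ ι) (sphericalProfile ι f) := by
  rw [h.law, map_ellipticalDensity h.posDef h.measurable_generator hT hdet]

theorem IsElliptical.isProbabilityMeasure_radialMeasure [IsProbabilityMeasure P]
    (h : IsElliptical P Y 0 A f) :
    IsProbabilityMeasure (radialMeasure (EuclideanSpace ℝ ι) (sphericalProfile ι f)) := by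
  obtain ⟨T, hT, hdet⟩ := exists_norm_sq_eq_invQuadForm h.posDef
  rw [← h.map_eq_radialMeasure hT hdet]
  have := Measure.isProbabilityMeasure_map h.aemeasurable
  exact Measure.isProbabilityMeasure_map T.continuous.measurable.aemeasurable

theorem IsElliptical.hasGaussianLaw_iff (h : IsElliptical P Y 0 A f) :
    HasGaussianLaw Y P ↔
      IsGaussian (radialMeasure (EuclideanSpace ℝ ι) (sphericalProfile ι f)) := by
  obtain ⟨T, hT, hdet⟩ := exists_norm_sq_eq_invQuadForm h.posDef
  rw [← h.map_eq_radialMeasure hT hdet]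
  constructor
  · intro hY
    have := hY.isGaussian_map
    exact isGaussian_map (T : EuclideanSpace ℝ ι →L[ℝ] EuclideanSpace ℝ ι)
  · intro hY
    have h1 := isGaussian_map (μ := (P.map Y).map T)
      (T.symm : EuclideanSpace ℝ ι →L[ℝ] EuclideanSpace ℝ ι)
    have hid : (T.symm : EuclideanSpace ℝ ι →L[ℝ] EuclideanSpace ℝ ι) ∘ T = id := by
      ext x : 1
      simp
    rw [Measure.map_map (by fun_prop) (by fun_prop), hid, Measure.map_id] at h1
    exact ⟨h1⟩

theorem IsElliptical.ellipticalConst_pos [IsProbabilityMeasure P] (h : IsElliptical P Y 0 A f) :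
    0 < ellipticalConst ι f := by
  refine (ellipticalConst_nonneg h.generator_nonneg).lt_of_ne fun h0 => ?_
  have h1 := h.isProbabilityMeasure_radialMeasure.measure_univ
  simp [radialMeasure, sphericalProfile, ← h0] at h1

theorem IsElliptical.not_ae_eq_zero [Nonempty ι] [IsProbabilityMeasure P]
    (h : IsElliptical P Y 0 A f) : ¬ ∀ᵐ t ∂volume.restrict (Set.Ioi (0 : ℝ)), f t = 0 := by
  intro h0
  have h1 := h.isProbabilityMeasure_radialMeasure.measure_univ
  have h2 := ae_norm_sq (E := EuclideanSpace ℝ ι) h0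
  rw [radialMeasure, withDensity_apply _ MeasurableSet.univ, Measure.restrict_univ,
    lintegral_congr_ae (g := 0) ?_] at h1
  · simp at h1
  · filter_upwards [h2] with w hw
    simp [sphericalProfile, hw]

theorem IsElliptical.integrable_ellipticalDensity [IsProbabilityMeasure P]
    (h : IsElliptical P Y 0 A f) :
    Integrable (ellipticalDensity (0 : EuclideanSpace ℝ ι) A f) := by
  have h1 := (Measure.isProbabilityMeasure_map h.aemeasurable).measure_univ
  rw [h.law, withDensity_apply _ MeasurableSet.univ, Measure.restrict_univ] at h1
  refine ⟨(measurable_ellipticalDensity h.measurable_generator).aestronglyMeasurable, ?_⟩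
  rw [hasFiniteIntegral_iff_ofReal
    (ae_of_all _ (ellipticalDensity_nonneg h.posDef h.generator_nonneg)), h1]
  exact ENNReal.one_lt_top

/-- A nonintegrable generator would have normalising constant `0⁻¹ = 0`, which a probability law
excludes. -/
theorem IsElliptical.integrable_generator [IsProbabilityMeasure P]
    (h : IsElliptical P Y 0 A f) : Integrable fun w : EuclideanSpace ℝ ι => f (‖w‖ ^ 2) := by
  by_contra hcon
  have := h.ellipticalConst_pos
  rw [ellipticalConst, integral_undef hcon] at this
  simp at this

/-- In dimension at least two a density generator is integrable away from the origin. -/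
theorem IsElliptical.integrableOn_generator [Nontrivial ι] [IsProbabilityMeasure P]
    (h : IsElliptical P Y 0 A f) {r : ℝ} (hr : 0 < r) : IntegrableOn f (Set.Ioi r) := by
  have h1 := h.integrable_generator
  rw [integrable_fun_norm_addHaar volume (f := fun x => f (x ^ 2)),
    finrank_euclideanSpace] at h1
  set k := Fintype.card ι - 1 with hk
  have hk1 : 1 ≤ k := by have := Fintype.one_lt_card (α := ι); omega
  -- Under `t = x²` the radial weight `x^k` becomes `t^((k-1)/2)` up to a constant; since `k ≥ 1`,
  -- it is bounded below on `(r, ∞)` and can be divided out.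
  have h2 := (integrableOn_Ioi_comp_rpow_iff' (fun t => t ^ (((k : ℝ) - 1) / 2) * f t)
    (p := 2) two_ne_zero).1 (h1.congr_fun (fun x hx => ?_) measurableSet_Ioi)
  · have h3 : IntegrableOn (fun t => r ^ (-(((k : ℝ) - 1) / 2)) *
        (t ^ (((k : ℝ) - 1) / 2) * f t)) (Set.Ioi r) :=
      (h2.mono_set (Set.Ioi_subset_Ioi hr.le)).const_mul _
    refine h3.mono' h.measurable_generator.aestronglyMeasurable ?_
    filter_upwards [ae_restrict_mem measurableSet_Ioi] with t ht
    have ht' : r < t := ht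
    have hf := h.generator_nonneg t (hr.trans ht').le
    rw [Real.norm_of_nonneg hf, ← mul_assoc]
    refine le_mul_of_one_le_left hf ?_
    rw [Real.rpow_neg hr.le, inv_mul_eq_div, one_le_div (by positivity)]
    refine Real.rpow_le_rpow hr.le ht'.le ?_
    have : (1 : ℝ) ≤ k := by exact_mod_cast hk1
    linarith
  · have hx' : (0 : ℝ) < x := hx
    simp only [smul_eq_mul, Real.rpow_two]
    rw [← mul_assoc]
    congr 1
    rw [show (2 : ℝ) - 1 = 1 by norm_num, Real.rpow_one, ← Real.rpow_natCast x 2,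
      ← Real.rpow_mul hx'.le, ← Real.rpow_natCast x k]
    nth_rewrite 2 [← Real.rpow_one x]
    rw [← Real.rpow_add hx']
    congr 1
    push_cast
    ring

end Elliptical

/-! ### The density of `Z` -/

section SkewLaw

variable {d : ℕ}

theorem measurable_joinVec :
    Measurable fun q : ℝ × EuclideanSpace ℝ (Fin d) => joinVec q.1 q.2 := by
  unfold joinVec
  refine (PiLp.continuous_toLp 2 _).measurable.comp (measurable_pi_iff.2 ?_)
  rintro (i | i)
  · exact measurable_fst
  · change Measurable fun q : ℝ × EuclideanSpace ℝ (Fin d) => q.2.ofLp i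
    fun_prop

theorem measurable_vecPart : Measurable (vecPart (d := d)) := by
  unfold vecPart
  fun_prop

@[simp] theorem vecPart_joinVec (u : ℝ) (z : EuclideanSpace ℝ (Fin d)) :
    vecPart (joinVec u z) = z := rfl

theorem lintegral_joinVec {h : EuclideanSpace ℝ (Unit ⊕ Fin d) → ENNReal} (hh : Measurable h) :
    ∫⁻ y, h y = ∫⁻ z : EuclideanSpace ℝ (Fin d), ∫⁻ u : ℝ, h (joinVec u z) := by
  have h1 := (PiLp.volume_preserving_toLp (Unit ⊕ Fin d)).lintegral_comp hh
  have hh1 : Measurable fun x : Unit ⊕ Fin d → ℝ => h (WithLp.toLp 2 x) := by fun_prop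
  have h2 := (volume_measurePreserving_sumPiEquivProdPi_symm
    (fun _ : Unit ⊕ Fin d => ℝ)).lintegral_comp hh1
  have h3 := (PiLp.volume_preserving_toLp (Fin d)).lintegral_comp
    (f := fun z => ∫⁻ u : ℝ, h (joinVec u z))
    (hh.comp measurable_joinVec).lintegral_prod_left'
  rw [← h1, ← h2, ← h3, Measure.volume_eq_prod, lintegral_prod_symm]
  · refine lintegral_congr fun z => ?_
    have h4 := (volume_preserving_funUnique Unit ℝ).lintegral_comp
      (f := fun u => h (joinVec u (WithLp.toLp 2 z)))
      (hh.comp (measurable_joinVec.comp measurable_prodMk_right))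
    rw [← h4]
    rfl
  · exact (hh1.comp (MeasurableEquiv.measurable _)).aemeasurable

theorem condGenerator_integral_Ioi_neg (f : ℝ → ℝ) (q y : ℝ) :
    ∫ x in Set.Ioi (-y), f (q + x ^ 2) = ∫ x in Set.Iic y, f (q + x ^ 2) := by
  have := integral_comp_neg_Iic y (fun x => f (q + x ^ 2))
  simpa using this.symm

variable {δ : Fin d → ℝ} {Ωbar : Matrix (Fin d) (Fin d) ℝ} {f : ℝ → ℝ}

theorem setIntegral_comp_sub_div (g : ℝ → ℝ) (m : ℝ) {k : ℝ} (hk : 0 < k) :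
    ∫ u in Set.Ioi 0, g ((u - m) / k) = k * ∫ x in Set.Ioi (-(m / k)), g x := by
  rw [← integral_indicator measurableSet_Ioi, ← integral_indicator measurableSet_Ioi]
  have h1 := integral_sub_right_eq_self (μ := volume)
    (fun u => (Set.Ioi (-(m / k))).indicator g (u / k)) m
  have h2 := Measure.integral_comp_div ((Set.Ioi (-(m / k))).indicator g) k
  rw [abs_of_pos hk, smul_eq_mul] at h2
  rw [← h2, ← h1]
  refine integral_congr_ae (ae_of_all _ fun u => ?_)
  have hiff : u ∈ Set.Ioi 0 ↔ (u - m) / k ∈ Set.Ioi (-(m / k)) := by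
    rw [Set.mem_Ioi, Set.mem_Ioi, sub_div, ← sub_pos, sub_zero, ← sub_pos (b := -(m / k))]
    have : u / k - m / k - -(m / k) = u / k := by ring
    rw [this, div_pos_iff_of_pos_right hk]
  by_cases hu : u ∈ Set.Ioi 0
  · simp only [Set.indicator_of_mem hu, Set.indicator_of_mem (hiff.1 hu)]
  · simp only [Set.indicator_of_notMem hu, Set.indicator_of_notMem (fun h => hu (hiff.2 h))]

theorem integral_comp_sub_div (g : ℝ → ℝ) (m : ℝ) {k : ℝ} (hk : 0 < k) :
    ∫ u, g ((u - m) / k) = k * ∫ x, g x := by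
  have h1 := integral_sub_right_eq_self (μ := volume) (fun u => g (u / k)) m
  rw [h1, Measure.integral_comp_div, abs_of_pos hk, smul_eq_mul]

/-- The ratio of `f_U (z)` to `∫ f (Q_z + x²) dx`. -/
def marginalConst (δ : Fin d → ℝ) (Ωbar : Matrix (Fin d) (Fin d) ℝ) (f : ℝ → ℝ) : ℝ :=
  ellipticalConst (Unit ⊕ Fin d) f / √(starMatrix δ Ωbar).det * √(1 - δ ⬝ᵥ (Ωbar⁻¹ *ᵥ δ))

theorem marginalDensity_eq (h : (starMatrix δ Ωbar).PosDef) (z : EuclideanSpace ℝ (Fin d)) :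
    marginalDensity δ Ωbar f z =
      marginalConst δ Ωbar f * ∫ x, f (invQuadForm Ωbar z + x ^ 2) := by
  have hκ := Real.sqrt_pos.2 (schurComplement_pos_of_starMatrix h)
  simp only [marginalDensity, ellipticalDensity_zero, invQuadForm_starMatrix h]
  rw [integral_const_mul, integral_comp_sub_div (fun x => f (invQuadForm Ωbar z + x ^ 2)) _ hκ,
    marginalConst]
  ring

/-- Standardising `u` turns `u > 0` into `x > -αᵀz`, and evenness of the integrand flips this to `x
< αᵀz` up to a null set. -/
theorem setIntegral_ellipticalDensity_joinVec (h : (starMatrix δ Ωbar).PosDef)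
    (z : EuclideanSpace ℝ (Fin d)) :
    ∫ u in Set.Ioi 0, ellipticalDensity 0 (starMatrix δ Ωbar) f (joinVec u z) =
      marginalConst δ Ωbar f * ∫ x in Set.Iic (shapeParam δ Ωbar ⬝ᵥ z.ofLp),
        f (invQuadForm Ωbar z + x ^ 2) := by
  have hκ := Real.sqrt_pos.2 (schurComplement_pos_of_starMatrix h)
  simp only [ellipticalDensity_zero, invQuadForm_starMatrix h]
  rw [integral_const_mul, setIntegral_comp_sub_div (fun x => f (invQuadForm Ωbar z + x ^ 2)) _ hκ,
    ← condGenerator_integral_Ioi_neg, shapeParam_dotProduct h, marginalConst]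
  ring

theorem marginalDensity_mul_condDistFun (h : (starMatrix δ Ωbar).PosDef)
    (hf : ∀ t, 0 ≤ t → 0 ≤ f t) {z : EuclideanSpace ℝ (Fin d)}
    (hz : Integrable fun x => f (invQuadForm Ωbar z + x ^ 2)) :
    marginalDensity δ Ωbar f z *
        condDistFun f (invQuadForm Ωbar z) (shapeParam δ Ωbar ⬝ᵥ z.ofLp) =
      ∫ u in Set.Ioi 0, ellipticalDensity 0 (starMatrix δ Ωbar) f (joinVec u z) := by
  have hq := invQuadForm_nonneg (posDef_of_starMatrix h) z
  rw [marginalDensity_eq h, setIntegral_ellipticalDensity_joinVec h, condDistFun]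
  simp only [condGenerator]
  -- If the total integral vanishes, `condDistFun` is `0` by the convention on division, and the
  -- partial integral vanishes too.
  rcases eq_or_ne (∫ x, f (invQuadForm Ωbar z + x ^ 2)) 0 with h0 | h0
  · rw [h0, div_zero, mul_zero]
    have h1 : ∫ x in Set.Iic (shapeParam δ Ωbar ⬝ᵥ z.ofLp), f (invQuadForm Ωbar z + x ^ 2) = 0 := by
      refine le_antisymm ?_ (integral_nonneg fun x => hf _ (by positivity))
      rw [← h0]
      exact setIntegral_le_integral hz (ae_of_all _ fun x => hf _ (by positivity))
    rw [h1, mul_zero]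
  · field_simp

variable {S : Type*} [MeasurableSpace S] {P : Measure S} [IsProbabilityMeasure P]
  {Ustar : S → EuclideanSpace ℝ (Unit ⊕ Fin d)}

theorem IsElliptical.marginalConst_pos (hU : IsElliptical P Ustar 0 (starMatrix δ Ωbar) f) :
    0 < marginalConst δ Ωbar f := by
  have := hU.ellipticalConst_pos
  have := Real.sqrt_pos.2 hU.posDef.det_pos
  have := Real.sqrt_pos.2 (schurComplement_pos_of_starMatrix hU.posDef)
  unfold marginalConst
  positivity

theorem IsElliptical.ae_integrable_joinVec (hU : IsElliptical P Ustar 0 (starMatrix δ Ωbar) f) :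
    ∀ᵐ z : EuclideanSpace ℝ (Fin d), Integrable fun u : ℝ =>
      ellipticalDensity 0 (starMatrix δ Ωbar) f (joinVec u z) := by
  have hm := (measurable_ellipticalDensity (A := starMatrix δ Ωbar)
    hU.measurable_generator)
  have h1 := hU.integrable_ellipticalDensity.2
  rw [hasFiniteIntegral_iff_ofReal
    (ae_of_all _ (ellipticalDensity_nonneg hU.posDef hU.generator_nonneg)),
    lintegral_joinVec hm.ennreal_ofReal] at h1
  filter_upwards [ae_lt_top ((hm.ennreal_ofReal.comp measurable_joinVec).lintegral_prod_left')
    h1.ne] with z hz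
  refine ⟨(hm.comp (measurable_joinVec.comp measurable_prodMk_right)).aestronglyMeasurable, ?_⟩
  rw [hasFiniteIntegral_iff_ofReal
    (ae_of_all _ fun u => ellipticalDensity_nonneg hU.posDef hU.generator_nonneg _)]
  exact hz

theorem IsElliptical.ae_integrable_condGenerator
    (hU : IsElliptical P Ustar 0 (starMatrix δ Ωbar) f) :
    ∀ᵐ z : EuclideanSpace ℝ (Fin d), Integrable fun x => f (invQuadForm Ωbar z + x ^ 2) := by
  have hκ := Real.sqrt_pos.2 (schurComplement_pos_of_starMatrix hU.posDef)
  have hc := hU.ellipticalConst_pos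
  have hdet := Real.sqrt_pos.2 hU.posDef.det_pos
  filter_upwards [hU.ae_integrable_joinVec] with z hz
  simp only [ellipticalDensity_zero, invQuadForm_starMatrix hU.posDef] at hz
  have h1 := (integrable_const_mul_iff (IsUnit.mk0 _ (div_pos hc hdet).ne') _).1 hz
  have h2 := h1.comp_add_right (δ ⬝ᵥ (Ωbar⁻¹ *ᵥ z.ofLp))
  simp only [add_sub_cancel_right] at h2
  have h3 := h2.comp_mul_left' hκ.ne'
  refine h3.congr (ae_of_all _ fun x => ?_)
  simp only
  rw [mul_div_cancel_left₀ _ hκ.ne']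

theorem IsElliptical.map_vecPart (hU : IsElliptical P Ustar 0 (starMatrix δ Ωbar) f) :
    (P.map Ustar).map vecPart =
      volume.withDensity fun z => ENNReal.ofReal (marginalDensity δ Ωbar f z) := by
  have hm := (measurable_ellipticalDensity (A := starMatrix δ Ωbar)
    hU.measurable_generator)
  ext B hB
  rw [Measure.map_apply measurable_vecPart hB, hU.law,
    withDensity_apply _ (measurable_vecPart hB), withDensity_apply _ hB,
    ← lintegral_indicator (measurable_vecPart hB), ← lintegral_indicator hB,
    lintegral_joinVec (hm.ennreal_ofReal.indicator (measurable_vecPart hB))]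
  refine lintegral_congr_ae ?_
  filter_upwards [hU.ae_integrable_joinVec] with z hz
  by_cases hzB : z ∈ B
  · rw [Set.indicator_of_mem hzB, marginalDensity, ofReal_integral_eq_lintegral_ofReal hz
      (ae_of_all _ fun u => ellipticalDensity_nonneg hU.posDef hU.generator_nonneg _)]
    refine lintegral_congr fun u => ?_
    rw [Set.indicator_of_mem]
    simpa using hzB
  · rw [Set.indicator_of_notMem hzB]
    simp [Set.indicator, hzB]

/-- The law is invariant under `y ↦ -y` and does not charge the hyperplane `y₀ = 0`. This is where
the factor `2` in the density comes from. -/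
theorem IsElliptical.measure_pos_eq (hU : IsElliptical P Ustar 0 (starMatrix δ Ωbar) f) :
    P.map Ustar {y | 0 < y.ofLp (Sum.inl ())} = 2⁻¹ := by
  set μ := P.map Ustar with hμ
  have hprob : IsProbabilityMeasure μ := Measure.isProbabilityMeasure_map hU.aemeasurable
  have hneg : μ.map (fun y => -y) = μ := by
    have h1 := map_withDensity_of_map_eq_smul
      (measurable_ellipticalDensity (A := starMatrix δ Ωbar) hU.measurable_generator).ennreal_ofReal
      (ContinuousLinearEquiv.neg ℝ (M := EuclideanSpace ℝ (Unit ⊕ Fin d))) (k := 1)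
      (by rw [one_smul]; exact (Measure.measurePreserving_neg (volume :
        Measure (EuclideanSpace ℝ (Unit ⊕ Fin d)))).map_eq)
    rw [hμ, hU.law]
    refine h1.trans ?_
    congr 1
    ext y
    rw [one_mul, ellipticalDensity_zero, ellipticalDensity_zero]
    change ENNReal.ofReal (_ * f (invQuadForm _ (-y))) = _
    rw [invQuadForm_neg]
  have hmp : MeasurableSet {y : EuclideanSpace ℝ (Unit ⊕ Fin d) | 0 < y.ofLp (Sum.inl ())} :=
    measurableSet_lt measurable_const (by fun_prop)
  have h0 : μ {y | y.ofLp (Sum.inl ()) = 0} = 0 := by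
    have h1 := volume_inner_eq_zero (a := EuclideanSpace.single (Sum.inl () : Unit ⊕ Fin d) (1 : ℝ))
      (by simp)
    have hac : μ ≪ volume := by rw [hμ, hU.law]; exact withDensity_absolutelyContinuous _ _
    refine hac ?_
    simpa [EuclideanSpace.inner_single_left] using h1
  have h1 : μ {y | y.ofLp (Sum.inl ()) < 0} = μ {y | 0 < y.ofLp (Sum.inl ())} := by
    nth_rewrite 2 [← hneg]
    rw [Measure.map_apply measurable_neg hmp]
    simp
  have h2 : μ {y | 0 < y.ofLp (Sum.inl ())}ᶜ = μ {y | y.ofLp (Sum.inl ()) < 0} := by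
    refine le_antisymm ?_ (measure_mono fun y (hy : y.ofLp (Sum.inl ()) < 0) =>
      not_lt.2 hy.le)
    have hsub : {y : EuclideanSpace ℝ (Unit ⊕ Fin d) | 0 < y.ofLp (Sum.inl ())}ᶜ ⊆
        {y | y.ofLp (Sum.inl ()) < 0} ∪ {y | y.ofLp (Sum.inl ()) = 0} :=
      fun y hy => (not_lt.1 hy : y.ofLp (Sum.inl ()) ≤ 0).lt_or_eq
    exact (measure_mono hsub).trans ((measure_union_le _ _).trans (by rw [h0, add_zero]))
  have h3 := measure_add_measure_compl (μ := μ) hmp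
  rw [h2, h1, measure_univ, ← two_mul] at h3
  exact ENNReal.eq_inv_of_mul_eq_one_left (by rw [mul_comm]; exact h3)

/-- `P(U ∈ B, U₀ > 0) = P(Z ∈ B) / 2`. -/
theorem IsElliptical.skewLaw_apply (hU : IsElliptical P Ustar 0 (starMatrix δ Ωbar) f)
    {B : Set (EuclideanSpace ℝ (Fin d))} (hB : MeasurableSet B) :
    skewLaw P Ustar B = 2 * P.map Ustar ({y | 0 < y.ofLp (Sum.inl ())} ∩ vecPart ⁻¹' B) := by
  have hmp : MeasurableSet {y : EuclideanSpace ℝ (Unit ⊕ Fin d) | 0 < y.ofLp (Sum.inl ())} :=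
    measurableSet_lt measurable_const (by fun_prop)
  have hvm := measurable_vecPart (d := d)
  have hpos := hU.measure_pos_eq
  rw [Measure.map_apply_of_aemeasurable hU.aemeasurable hmp] at hpos
  have hcond : ProbabilityTheory.cond P {s | 0 < (Ustar s).ofLp (Sum.inl ())} ≪ P :=
    cond_absolutelyContinuous
  rw [skewLaw, Measure.map_apply_of_aemeasurable
    (f := fun s => vecPart (Ustar s)) (hvm.comp_aemeasurable (hU.aemeasurable.mono_ac hcond)) hB,
    Measure.map_apply_of_aemeasurable hU.aemeasurable (hmp.inter (hvm hB)),
    ProbabilityTheory.cond, Measure.smul_apply, Measure.restrict_apply₀']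
  · change (P (Ustar ⁻¹' {y | 0 < y.ofLp (Sum.inl ())}))⁻¹ *
      P ((fun s => vecPart (Ustar s)) ⁻¹' B ∩ Ustar ⁻¹' {y | 0 < y.ofLp (Sum.inl ())}) = _
    rw [hpos, inv_inv, Set.inter_comm]
    rfl
  · exact hU.aemeasurable.nullMeasurableSet_preimage hmp

theorem IsElliptical.skewLaw_eq (hU : IsElliptical P Ustar 0 (starMatrix δ Ωbar) f) :
    skewLaw P Ustar = volume.withDensity fun z => ENNReal.ofReal (2 * marginalDensity δ Ωbar f z *
      condDistFun f (invQuadForm Ωbar z) (shapeParam δ Ωbar ⬝ᵥ z.ofLp)) := by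
  have hm := (measurable_ellipticalDensity (A := starMatrix δ Ωbar)
    hU.measurable_generator)
  have hmp : MeasurableSet {y : EuclideanSpace ℝ (Unit ⊕ Fin d) | 0 < y.ofLp (Sum.inl ())} :=
    measurableSet_lt measurable_const (by fun_prop)
  ext B hB
  have hC := hmp.inter (measurable_vecPart hB)
  rw [hU.skewLaw_apply hB, hU.law, withDensity_apply _ hC, withDensity_apply _ hB,
    ← lintegral_indicator hC, ← lintegral_indicator hB,
    lintegral_joinVec (hm.ennreal_ofReal.indicator hC), ← lintegral_const_mul' _ _ (by simp)]
  refine lintegral_congr_ae ?_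
  filter_upwards [hU.ae_integrable_joinVec, hU.ae_integrable_condGenerator] with z hz hz'
  by_cases hzB : z ∈ B
  · rw [Set.indicator_of_mem hzB, mul_assoc,
      marginalDensity_mul_condDistFun hU.posDef hU.generator_nonneg hz',
      ENNReal.ofReal_mul zero_le_two, ofReal_integral_eq_lintegral_ofReal hz.integrableOn
      (ae_of_all _ fun u => ellipticalDensity_nonneg hU.posDef hU.generator_nonneg _),
      ← lintegral_indicator measurableSet_Ioi]
    congr 1
    · simp
    refine lintegral_congr fun u => ?_
    by_cases hu : 0 < u
    · rw [Set.indicator_of_mem (Set.mem_Ioi.2 hu), Set.indicator_of_mem]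
      exact ⟨hu, hzB⟩
    · have h1 : u ∉ Set.Ioi (0 : ℝ) := hu
      have h2 : joinVec u z ∉ ({y : EuclideanSpace ℝ (Unit ⊕ Fin d) | 0 < y.ofLp (Sum.inl ())} ∩
        vecPart ⁻¹' B) := fun h => hu h.1
      rw [Set.indicator_of_notMem h1, Set.indicator_of_notMem h2]
  · rw [Set.indicator_of_notMem hzB]
    have : ∀ u, joinVec u z ∉ ({y : EuclideanSpace ℝ (Unit ⊕ Fin d) | 0 < y.ofLp (Sum.inl ())} ∩
        vecPart ⁻¹' B) := fun u h => hzB h.2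
    simp [this]

end SkewLaw

/-! ### Gaussian laws and exponential generators -/

section GaussianGenerator

variable {ι : Type*} [Fintype ι] [DecidableEq ι] {A : Matrix ι ι ℝ} {f : ℝ → ℝ}
  {S : Type*} [MeasurableSpace S] {P : Measure S} [IsProbabilityMeasure P]
  {Y : S → EuclideanSpace ℝ ι}

theorem IsElliptical.generator_eq_exp_of_hasGaussianLaw [Nonempty ι]
    (h : IsElliptical P Y 0 A f) (hY : HasGaussianLaw Y P) :
    ∃ σ a : ℝ, 0 < σ ∧ 0 < a ∧
      ∀ᵐ t ∂volume.restrict (Set.Ioi (0 : ℝ)), f t = a * Real.exp (-(1 / (2 * σ ^ 2)) * t) := by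
  have hG := h.hasGaussianLaw_iff.1 hY
  have hprob := h.isProbabilityMeasure_radialMeasure
  have hc := h.ellipticalConst_pos
  obtain ⟨σ, hσ, hσE⟩ := exists_eq_stdGaussian_map_of_isGaussian
    (E := EuclideanSpace ℝ ι) (measurable_sphericalProfile (ι := ι) h.measurable_generator)
  rw [stdGaussian_map_smul hσ, radialMeasure] at hσE
  have hm := (measurable_sphericalProfile (ι := ι) h.measurable_generator).comp
    (measurable_norm (α := EuclideanSpace ℝ ι))
  have hfin : ∫⁻ w : EuclideanSpace ℝ ι, sphericalProfile ι f ‖w‖ ≠ ⊤ := by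
    have h1 := hprob.measure_univ
    rw [radialMeasure, withDensity_apply _ MeasurableSet.univ, Measure.restrict_univ] at h1
    rw [h1]; exact ENNReal.one_ne_top
  have hae := (withDensity_eq_iff hm.aemeasurable
    continuous_isotropicGaussianDensity.measurable.ennreal_ofReal.aemeasurable hfin).1 hσE
  set k := (2 * Real.pi * σ ^ 2) ^ (-(Module.finrank ℝ (EuclideanSpace ℝ ι) : ℝ) / 2) with hk
  have hk0 : 0 < k := by positivity
  refine ⟨σ, k / ellipticalConst ι f, hσ, by positivity,
    ae_Ioi_of_ae_norm_sq (E := EuclideanSpace ℝ ι) ?_⟩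
  filter_upwards [hae] with w hw
  have hf := h.generator_nonneg (‖w‖ ^ 2) (by positivity)
  change ENNReal.ofReal (ellipticalConst ι f * f (‖w‖ ^ 2)) = ENNReal.ofReal _ at hw
  rw [ENNReal.ofReal_eq_ofReal_iff (by positivity)
    (isotropicGaussianDensity_pos hσ w).le, isotropicGaussianDensity, ← hk] at hw
  have he : -(1 / (2 * σ ^ 2)) * ‖w‖ ^ 2 = -(‖w‖ ^ 2) / (2 * σ ^ 2) := by ring
  rw [he, div_mul_eq_mul_div, ← hw]
  field_simp

/-- Proportional densities of total mass one coincide; this spares the computation of normalising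
constants. -/
theorem eq_one_of_lintegral_const_mul {α : Type*} [MeasurableSpace α] {μ : Measure α} {g h : α → ℝ}
    {k : ℝ} (hgh : ∀ᵐ x ∂μ, g x = k * h x) (hk : 0 ≤ k)
    (hg : ∫⁻ x, ENNReal.ofReal (g x) ∂μ = 1) (hh : ∫⁻ x, ENNReal.ofReal (h x) ∂μ = 1) : k = 1 := by
  have h1 : ∫⁻ x, ENNReal.ofReal (g x) ∂μ = ENNReal.ofReal k * ∫⁻ x, ENNReal.ofReal (h x) ∂μ := by
    rw [← lintegral_const_mul' _ _ ENNReal.ofReal_ne_top]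
    refine lintegral_congr_ae ?_
    filter_upwards [hgh] with x hx
    rw [hx, ENNReal.ofReal_mul hk]
  rw [hg, hh, mul_one] at h1
  exact (ENNReal.ofReal_eq_one.1 h1.symm)

theorem IsElliptical.hasGaussianLaw_of_generator_eq_exp [Nonempty ι]
    (h : IsElliptical P Y 0 A f) {a b : ℝ} (ha : 0 < a) (hb : 0 < b)
    (hf : ∀ᵐ t ∂volume.restrict (Set.Ioi (0 : ℝ)), f t = a * Real.exp (-b * t)) :
    HasGaussianLaw Y P := by
  rw [h.hasGaussianLaw_iff]
  have hprob := h.isProbabilityMeasure_radialMeasure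
  have hc := h.ellipticalConst_pos
  set σ := √(1 / (2 * b)) with hσd
  have hσ : 0 < σ := Real.sqrt_pos.2 (by positivity)
  have hσ2 : σ ^ 2 = 1 / (2 * b) := Real.sq_sqrt (by positivity)
  set k := (2 * Real.pi * σ ^ 2) ^ (-(Module.finrank ℝ (EuclideanSpace ℝ ι) : ℝ) / 2) with hk
  have hk0 : 0 < k := by positivity
  have hae : ∀ᵐ w : EuclideanSpace ℝ ι, ellipticalConst ι f * f (‖w‖ ^ 2) =
      (ellipticalConst ι f * a / k) * isotropicGaussianDensity (EuclideanSpace ℝ ι) σ w := by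
    filter_upwards [ae_norm_sq (E := EuclideanSpace ℝ ι) hf] with w hw
    rw [hw, isotropicGaussianDensity, ← hk, hσ2]
    have : -(‖w‖ ^ 2) / (2 * (1 / (2 * b))) = -b * ‖w‖ ^ 2 := by field_simp
    rw [this]
    field_simp
  have h1 : ∫⁻ w : EuclideanSpace ℝ ι, ENNReal.ofReal (ellipticalConst ι f * f (‖w‖ ^ 2)) = 1 := by
    have := hprob.measure_univ
    rwa [radialMeasure, withDensity_apply _ MeasurableSet.univ, Measure.restrict_univ] at this
  have h2 : ∫⁻ w : EuclideanSpace ℝ ι,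
      ENNReal.ofReal (isotropicGaussianDensity (EuclideanSpace ℝ ι) σ w) = 1 := by
    have := isGaussian_stdGaussian_map_smul (E := EuclideanSpace ℝ ι) σ
    have := (IsGaussian.toIsProbabilityMeasure
      ((stdGaussian (EuclideanSpace ℝ ι)).map (σ • ·))).measure_univ
    rwa [stdGaussian_map_smul hσ, withDensity_apply _ MeasurableSet.univ,
      Measure.restrict_univ] at this
  have hone := eq_one_of_lintegral_const_mul hae (by positivity) h1 h2
  have heq : radialMeasure (EuclideanSpace ℝ ι) (sphericalProfile ι f) =
      (stdGaussian (EuclideanSpace ℝ ι)).map (σ • ·) := by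
    rw [stdGaussian_map_smul hσ, radialMeasure]
    refine withDensity_congr_ae ?_
    filter_upwards [hae] with w hw
    rw [sphericalProfile, hw, hone, one_mul]
  rw [heq]
  exact isGaussian_stdGaussian_map_smul σ

theorem cdf_gaussianReal_eq_setIntegral {v : NNReal} (hv : v ≠ 0) (y : ℝ) :
    cdf (gaussianReal 0 v) y = ∫ x in Set.Iic y, gaussianPDFReal 0 v x := by
  rw [cdf_eq_real, measureReal_def, gaussianReal_apply_eq_integral 0 hv,
    ENNReal.toReal_ofReal (integral_nonneg fun x => gaussianPDFReal_nonneg _ _ _)]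

theorem cdf_gaussianReal_sq {σ : ℝ} (hσ : 0 < σ) (x : ℝ) :
    cdf (gaussianReal 0 (σ ^ 2).toNNReal) x = cdf (gaussianReal 0 1) (x / σ) := by
  have h : gaussianReal 0 (σ ^ 2).toNNReal = (gaussianReal 0 1).map (σ * ·) := by
    rw [gaussianReal_map_const_mul]
    congr 1
    · simp
    · ext; simp; positivity
  rw [cdf_eq_real, cdf_eq_real, measureReal_def, measureReal_def, h,
    Measure.map_apply (by fun_prop) measurableSet_Iic]
  congr 2
  ext y
  simp only [Set.mem_preimage, Set.mem_Iic]
  rw [le_div_iff₀ hσ, mul_comm]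

/-- The factor `exp(-q / (2σ²))` cancels in the ratio. The result holds for every `q ≥ 0` although
`f` is known only almost everywhere, because `x ↦ q + x²` pulls null sets back to null sets. -/
theorem condDistFun_eq_cdf_gaussianReal {σ a q : ℝ} (hσ : 0 < σ) (ha : 0 < a) (hq : 0 ≤ q)
    (hf : ∀ᵐ t ∂volume.restrict (Set.Ioi (0 : ℝ)), f t = a * Real.exp (-(1 / (2 * σ ^ 2)) * t))
    (y : ℝ) :
    condDistFun f q y = cdf (gaussianReal 0 (σ ^ 2).toNNReal) y := by
  have hv : (σ ^ 2).toNNReal ≠ 0 := by simpa using hσ.ne'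
  set k := a * Real.exp (-(1 / (2 * σ ^ 2)) * q) * √(2 * Real.pi * σ ^ 2) with hk
  have hk0 : 0 < k := by positivity
  have hae : ∀ᵐ x : ℝ, condGenerator f q (x ^ 2) = k * gaussianPDFReal 0 (σ ^ 2).toNNReal x := by
    filter_upwards [ae_comp_add_sq hf hq] with x hx
    rw [condGenerator, hx, gaussianPDFReal, hk, Real.coe_toNNReal _ (by positivity), mul_add,
      Real.exp_add, sub_zero]
    have : -(1 / (2 * σ ^ 2)) * x ^ 2 = -x ^ 2 / (2 * σ ^ 2) := by ring
    rw [this]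
    field_simp
  rw [condDistFun, integral_congr_ae hae, setIntegral_congr_ae measurableSet_Iic
    (hae.mono fun x hx _ => hx), integral_const_mul, integral_const_mul,
    integral_gaussianPDFReal_eq_one 0 hv, cdf_gaussianReal_eq_setIntegral hv]
  field_simp

theorem integral_generator_eq_exp {a b q : ℝ} (hq : 0 ≤ q)
    (hf : ∀ᵐ t ∂volume.restrict (Set.Ioi (0 : ℝ)), f t = a * Real.exp (-b * t)) :
    ∫ x, f (q + x ^ 2) = a * √(Real.pi / b) * Real.exp (-b * q) := by
  have hae : ∀ᵐ x : ℝ, f (q + x ^ 2) = a * Real.exp (-b * q) * Real.exp (-b * x ^ 2) := by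
    filter_upwards [ae_comp_add_sq hf hq] with x hx
    rw [hx, mul_add, Real.exp_add, mul_assoc]
  rw [integral_congr_ae hae, integral_const_mul, integral_gaussian]
  ring

end GaussianGenerator

/-! ### The multivariate normal density -/

section NormalDensity

variable {d : ℕ} {A : Matrix (Fin d) (Fin d) ℝ}

theorem continuous_normalDensity : Continuous (normalDensity A) := by
  have := continuous_invQuadForm A
  unfold normalDensity
  fun_prop

theorem normalDensity_pos (hA : A.PosDef) (z : EuclideanSpace ℝ (Fin d)) :
    0 < normalDensity A z := by
  have := Real.sqrt_pos.2 hA.det_pos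
  unfold normalDensity; positivity

theorem map_normalDensity (hA : A.PosDef)
    {T : EuclideanSpace ℝ (Fin d) ≃L[ℝ] EuclideanSpace ℝ (Fin d)}
    (hT : ∀ y, ‖T y‖ ^ 2 = invQuadForm A y)
    (hdet : (volume : Measure (EuclideanSpace ℝ (Fin d))).map T =
      ENNReal.ofReal √A.det • volume) :
    (volume.withDensity fun z => ENNReal.ofReal (normalDensity A z)).map T =
      stdGaussian (EuclideanSpace ℝ (Fin d)) := by
  have hd := Real.sqrt_pos.2 hA.det_pos
  rw [map_withDensity_of_map_eq_smul continuous_normalDensity.measurable.ennreal_ofReal T hdet,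
    stdGaussian_eq_withDensity]
  congr 1
  ext w
  rw [← ENNReal.ofReal_mul hd.le, normalDensity, isotropicGaussianDensity, ← hT,
    T.apply_symm_apply, finrank_euclideanSpace, Fintype.card_fin, one_pow, mul_one, mul_one]
  congr 1
  field_simp

theorem isProbabilityMeasure_normalDensity (hA : A.PosDef) :
    IsProbabilityMeasure
      ((volume : Measure (EuclideanSpace ℝ (Fin d))).withDensity fun z =>
        ENNReal.ofReal (normalDensity A z)) := by
  obtain ⟨T, hT, hdet⟩ := exists_norm_sq_eq_invQuadForm hA
  have h1 := map_normalDensity hA hT hdet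
  have : IsProbabilityMeasure (stdGaussian (EuclideanSpace ℝ (Fin d))) := inferInstance
  rw [← h1] at this
  refine ⟨?_⟩
  have h2 := this.measure_univ
  rwa [Measure.map_apply T.continuous.measurable MeasurableSet.univ, Set.preimage_univ] at h2

end NormalDensity

/-! ### A Gaussian `U*` yields a skew normal `Z` -/

section SkewNormal

variable {d : ℕ} {δ : Fin d → ℝ} {Ωbar : Matrix (Fin d) (Fin d) ℝ} {f : ℝ → ℝ}
  {S : Type*} [MeasurableSpace S] {P : Measure S} [IsProbabilityMeasure P]
  {Ustar : S → EuclideanSpace ℝ (Unit ⊕ Fin d)}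

theorem IsElliptical.marginalDensity_eq_normalDensity
    (hU : IsElliptical P Ustar 0 (starMatrix δ Ωbar) f) {σ a : ℝ} (hσ : 0 < σ) (ha : 0 < a)
    (hf : ∀ᵐ t ∂volume.restrict (Set.Ioi (0 : ℝ)), f t = a * Real.exp (-(1 / (2 * σ ^ 2)) * t))
    (z : EuclideanSpace ℝ (Fin d)) :
    marginalDensity δ Ωbar f z = normalDensity (σ ^ 2 • Ωbar) z := by
  have hΩ := posDef_of_starMatrix hU.posDef
  have hσ2 : 0 < σ ^ 2 := by positivity
  have hΩσ : (σ ^ 2 • Ωbar).PosDef := hΩ.smul hσ2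
  have hc := hU.marginalConst_pos
  have hdet := Real.sqrt_pos.2 hΩσ.det_pos
  set k := marginalConst δ Ωbar f * (a * √(Real.pi / (1 / (2 * σ ^ 2)))) /
    ((2 * Real.pi) ^ (-(d : ℝ) / 2) / √(σ ^ 2 • Ωbar).det) with hk
  have hk0 : 0 < k := by positivity
  have hmul : ∀ z, marginalDensity δ Ωbar f z = k * normalDensity (σ ^ 2 • Ωbar) z := by
    intro z
    rw [marginalDensity_eq hU.posDef, integral_generator_eq_exp (invQuadForm_nonneg hΩ z) hf,
      normalDensity, invQuadForm_smul_matrix _ hσ2.ne' hΩ, hk]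
    have : -((σ ^ 2)⁻¹ * invQuadForm Ωbar z) / 2 = -(1 / (2 * σ ^ 2)) * invQuadForm Ωbar z := by
      field_simp
    rw [this]
    field_simp
  have h1 := (isProbabilityMeasure_normalDensity hΩσ).measure_univ
  have hp := Measure.isProbabilityMeasure_map hU.aemeasurable
  have h2 := (Measure.isProbabilityMeasure_map (μ := P.map Ustar)
    measurable_vecPart.aemeasurable).measure_univ
  rw [hU.map_vecPart, withDensity_apply _ MeasurableSet.univ, Measure.restrict_univ] at h2
  rw [withDensity_apply _ MeasurableSet.univ, Measure.restrict_univ] at h1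
  rw [hmul, eq_one_of_lintegral_const_mul (ae_of_all _ hmul) hk0.le h2 h1, one_mul]

theorem IsElliptical.isSkewNormal_of_generator_eq_exp
    (hU : IsElliptical P Ustar 0 (starMatrix δ Ωbar) f) (hdiag : ∀ i, Ωbar i i = 1)
    {σ a : ℝ} (hσ : 0 < σ) (ha : 0 < a)
    (hf : ∀ᵐ t ∂volume.restrict (Set.Ioi (0 : ℝ)), f t = a * Real.exp (-(1 / (2 * σ ^ 2)) * t)) :
    IsSkewNormal (skewLaw P Ustar) 0 (σ ^ 2 • Ωbar) (shapeParam δ Ωbar) := by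
  have hΩ := posDef_of_starMatrix hU.posDef
  refine ⟨hΩ.smul (by positivity), ?_⟩
  rw [hU.skewLaw_eq]
  congr 1
  ext z
  rw [condDistFun_eq_cdf_gaussianReal hσ ha (invQuadForm_nonneg hΩ z) hf,
    hU.marginalDensity_eq_normalDensity hσ ha hf, skewNormalDensity, sub_zero,
    cdf_gaussianReal_sq hσ]
  congr 3
  -- The unit diagonal of `Ω̄` gives `ω = σI`, so dividing by `ω` is exactly the rescaling by `σ` of
  -- the normal distribution function.
  simp only [Matrix.smul_apply, hdiag, smul_eq_mul, mul_one, Real.sqrt_sq hσ.le, dotProduct,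
    Finset.sum_div, mul_div_assoc]

end SkewNormal

/-! ### Transport along the standardising map -/

section Transfer

open scoped RealInnerProductSpace

variable {E : Type*} [NormedAddCommGroup E] [InnerProductSpace ℝ E]

theorem ne_zero_of_inner_eq_inner_symm {T : E ≃L[ℝ] E} {a b : E}
    (hb : ∀ w, ⟪b, w⟫ = ⟪a, T.symm w⟫) (ha : a ≠ 0) : b ≠ 0 := by
  rintro rfl
  have := hb (T a)
  rw [inner_zero_left, T.symm_apply_apply] at this
  exact ha (inner_self_eq_zero.1 this.symm)

/-- In dimension at least two, linear functionals take all intermediate values on the sphere. -/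
theorem exists_mem_sphere_inner_eq (hE : 1 < Module.rank ℝ E) {b : E} (hb : b ≠ 0) {y : ℝ}
    (hy : |y| ≤ ‖b‖) : ∃ s ∈ Metric.sphere (0 : E) 1, ⟪b, s⟫ = y := by
  have hb' : 0 < ‖b‖ := norm_pos_iff.2 hb
  have hu : ‖(‖b‖⁻¹ • b : E)‖ = 1 := by rw [norm_smul]; simp [hb'.ne']
  have hbu : ⟪b, ‖b‖⁻¹ • b⟫ = ‖b‖ := by
    rw [real_inner_smul_right, real_inner_self_eq_norm_sq]; field_simp
  have h := (isPreconnected_sphere hE (0 : E) 1).intermediate_value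
    (a := -(‖b‖⁻¹ • b)) (b := ‖b‖⁻¹ • b) (by simpa using hu) (by simpa using hu)
    (f := fun s => ⟪b, s⟫) (by fun_prop)
  have hmem : y ∈ Set.Icc ⟪b, -(‖b‖⁻¹ • b)⟫ ⟪b, ‖b‖⁻¹ • b⟫ := by
    rw [inner_neg_right, hbu]
    exact ⟨(abs_le.1 hy).1, (abs_le.1 hy).2⟩
  exact h hmem

variable [FiniteDimensional ℝ E]

theorem exists_inner_eq_inner_symm (T : E ≃L[ℝ] E) (a : E) :
    ∃ b : E, ∀ w, ⟪b, w⟫ = ⟪a, T.symm w⟫ :=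
  ⟨ContinuousLinearMap.adjoint (T.symm : E →L[ℝ] E) a, fun w => by
    rw [ContinuousLinearMap.adjoint_inner_left]; rfl⟩

variable [MeasurableSpace E] [BorelSpace E]

theorem ae_comp_symm_of_map_eq_smul {T : E ≃L[ℝ] E} {k : ENNReal} (hk : k ≠ 0)
    (hT : (volume : Measure E).map T = k • volume) {p : E → Prop} (h : ∀ᵐ z : E, p z) :
    ∀ᵐ w : E, p (T.symm w) := by
  have h1 : ∀ᵐ w ∂((volume : Measure E).map T), p (T.symm w) := by
    refine T.toHomeomorph.measurableEmbedding.ae_map_iff.2 ?_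
    filter_upwards [h] with z hz
    change p (T.symm (T z))
    rwa [T.symm_apply_apply]
  rw [hT, ae_iff, Measure.smul_apply, smul_eq_mul, mul_eq_zero] at h1
  exact h1.resolve_left hk

end Transfer

/-! ### Comparison of distribution functions -/

section DistributionFunctions

/-- `F x ≤ F t = H t ≤ H y` for some `t` between `x` and `y`; then `y ↓ x` by right continuity.
Agreement on a dense set is all that almost every direction provides. -/
theorem StieltjesFunction.le_of_frequently_eq {F H : StieltjesFunction ℝ} {l u : ℝ}
    (h : ∀ x y, l < x → x < y → y < u → ∃ t, x < t ∧ t < y ∧ F t = H t) {x : ℝ} (hlx : l < x)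
    (hxu : x < u) : F x ≤ H x := by
  have h1 := ((H.right_continuous x).mono Set.Ioi_subset_Ici_self).tendsto
  refine ge_of_tendsto h1 ?_
  filter_upwards [Ioo_mem_nhdsGT hxu] with y hy
  obtain ⟨t, hxt, hty, ht⟩ := h x y hlx hy.1 hy.2
  exact (F.mono hxt.le).trans (ht.le.trans (H.mono hty.le))

theorem StieltjesFunction.eq_of_frequently_eq {F H : StieltjesFunction ℝ} {l u : ℝ}
    (h : ∀ x y, l < x → x < y → y < u → ∃ t, x < t ∧ t < y ∧ F t = H t) {x : ℝ} (hlx : l < x)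
    (hxu : x < u) : F x = H x :=
  le_antisymm (le_of_frequently_eq h hlx hxu) (le_of_frequently_eq (fun x y hx hxy hy => by
    obtain ⟨t, h1, h2, h3⟩ := h x y hx hxy hy
    exact ⟨t, h1, h2, h3.symm⟩) hlx hxu)

variable {f : ℝ → ℝ} {q : ℝ}

theorem exists_cdf_eq_condDistFun (hf : ∀ t, 0 ≤ t → 0 ≤ f t) (hq : 0 ≤ q)
    (hI : Integrable fun x => f (q + x ^ 2)) (h0 : ∫ x, f (q + x ^ 2) ≠ 0) :
    ∃ ν : Measure ℝ, ∀ y, condDistFun f q y = cdf ν y := by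
  set G := ∫ x, f (q + x ^ 2) with hG
  have hG0 : 0 < G := (integral_nonneg fun x => hf _ (by positivity)).lt_of_ne h0.symm
  set ν := (volume : Measure ℝ).withDensity fun x => ENNReal.ofReal (f (q + x ^ 2) / G) with hν
  have hI' : Integrable fun x => f (q + x ^ 2) / G := hI.div_const _
  have hnn : ∀ x, 0 ≤ f (q + x ^ 2) / G := fun x => div_nonneg (hf _ (by positivity)) hG0.le
  have happ : ∀ B, MeasurableSet B → ν B = ENNReal.ofReal ((∫ x in B, f (q + x ^ 2)) / G) := by
    intro B hB
    rw [hν, withDensity_apply _ hB, ← ofReal_integral_eq_lintegral_ofReal hI'.integrableOn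
      (ae_of_all _ hnn), integral_div]
  have : IsProbabilityMeasure ν := by
    refine ⟨?_⟩
    rw [happ _ MeasurableSet.univ, Measure.restrict_univ, ← hG, div_self h0, ENNReal.ofReal_one]
  refine ⟨ν, fun y => ?_⟩
  rw [cdf_eq_real, measureReal_def, happ _ measurableSet_Iic, ENNReal.toReal_ofReal]
  · rfl
  · exact div_nonneg (integral_nonneg fun x => hf _ (by positivity)) hG0.le

/-- Gives the separated form. Where the total integral is zero both sides vanish, so nothing is
required of `F^q` there. -/
theorem intervalIntegral_eq_mul_sub (hf : ∀ t, 0 ≤ t → 0 ≤ f t) (hq : 0 ≤ q)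
    (hI : Integrable fun x => f (q + x ^ 2)) {F : ℝ → ℝ} {y : ℝ} (hy : 0 ≤ y)
    (h : ∫ x, f (q + x ^ 2) ≠ 0 → condDistFun f q y = F y ∧ condDistFun f q 0 = F 0) :
    ∫ x in (0 : ℝ)..y, f (q + x ^ 2) = (∫ x, f (q + x ^ 2)) * (F y - F 0) := by
  rcases eq_or_ne (∫ x, f (q + x ^ 2)) 0 with h0 | h0
  · rw [h0, zero_mul, intervalIntegral.integral_of_le hy]
    refine le_antisymm ?_ (integral_nonneg fun x => hf _ (by positivity))
    rw [← h0]
    exact setIntegral_le_integral hI (ae_of_all _ fun x => hf _ (by positivity))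
  · rw [← intervalIntegral.integral_Iic_sub_Iic hI.integrableOn hI.integrableOn,
      ← (h h0).1, ← (h h0).2, condDistFun, condDistFun]
    simp only [condGenerator]
    field_simp

end DistributionFunctions

/-! ### A conditional distribution function free of `Q_z` forces normality -/

section Separation

open scoped RealInnerProductSpace

variable {d : ℕ} {δ : Fin d → ℝ} {Ωbar : Matrix (Fin d) (Fin d) ℝ} {f : ℝ → ℝ}
  {S : Type*} [MeasurableSpace S] {P : Measure S}
  {Ustar : S → EuclideanSpace ℝ (Unit ⊕ Fin d)}

theorem IsElliptical.measurable_marginalDensity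
    (hU : IsElliptical P Ustar 0 (starMatrix δ Ωbar) f) :
    Measurable (marginalDensity δ Ωbar f) := by
  have hm := (measurable_ellipticalDensity (A := starMatrix δ Ωbar)
    hU.measurable_generator).comp measurable_joinVec
  exact hm.stronglyMeasurable.integral_prod_left'.measurable

theorem IsElliptical.marginalDensity_nonneg
    (hU : IsElliptical P Ustar 0 (starMatrix δ Ωbar) f) (z : EuclideanSpace ℝ (Fin d)) :
    0 ≤ marginalDensity δ Ωbar f z :=
  integral_nonneg fun _ => ellipticalDensity_nonneg hU.posDef hU.generator_nonneg _

theorem condDistFun_nonneg (hf : ∀ t, 0 ≤ t → 0 ≤ f t) {q : ℝ} (hq : 0 ≤ q) (y : ℝ) :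
    0 ≤ condDistFun f q y :=
  div_nonneg (integral_nonneg fun x => hf _ (by positivity))
    (integral_nonneg fun x => hf _ (by positivity))

theorem shapeParam_ne_zero (h : (starMatrix δ Ωbar).PosDef) (hδ : δ ≠ 0) :
    shapeParam δ Ωbar ≠ 0 := by
  have hΩ := posDef_of_starMatrix h
  have hu : IsUnit Ωbar.det := (Matrix.isUnit_iff_isUnit_det Ωbar).1 hΩ.isUnit
  have hκ := Real.sqrt_pos.2 (schurComplement_pos_of_starMatrix h)
  intro h0
  rw [shapeParam, smul_eq_zero] at h0
  rcases h0 with h0 | h0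
  · exact (one_div_pos.2 hκ).ne' h0
  · apply hδ
    have := congrArg (Ωbar *ᵥ ·) h0
    simpa [Matrix.mulVec_mulVec, Matrix.mul_nonsing_inv _ hu] using this

variable [IsProbabilityMeasure P]

theorem IsElliptical.ae_integrable_condGenerator_norm
    (hU : IsElliptical P Ustar 0 (starMatrix δ Ωbar) f) :
    ∀ᵐ w : EuclideanSpace ℝ (Fin d), Integrable fun x => f (‖w‖ ^ 2 + x ^ 2) := by
  have hΩ := posDef_of_starMatrix hU.posDef
  obtain ⟨T, hT, hdet⟩ := exists_norm_sq_eq_invQuadForm hΩ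
  have hd : ENNReal.ofReal √Ωbar.det ≠ 0 := by simpa using Real.sqrt_pos.2 hΩ.det_pos
  filter_upwards [ae_comp_symm_of_map_eq_smul hd hdet hU.ae_integrable_condGenerator] with w hw
  rwa [← hT, T.apply_symm_apply] at hw

theorem IsElliptical.ae_Ioi_integrable_condGenerator (hd : 1 ≤ d)
    (hU : IsElliptical P Ustar 0 (starMatrix δ Ωbar) f) :
    ∀ᵐ q ∂volume.restrict (Set.Ioi (0 : ℝ)), Integrable fun x => f (q + x ^ 2) := by
  have : Nonempty (Fin d) := ⟨⟨0, hd⟩⟩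
  exact ae_Ioi_of_ae_norm_sq hU.ae_integrable_condGenerator_norm

/-- If the standardised conditional distribution functions agree with a fixed function on
`|y| < a √q`, then the elliptical law is normal. -/
theorem IsElliptical.hasGaussianLaw_of_condDistFun_eq (hd : 1 ≤ d)
    (hU : IsElliptical P Ustar 0 (starMatrix δ Ωbar) f) {a : ℝ} (ha : 0 < a) {F : ℝ → ℝ}
    (h : ∀ᵐ q ∂volume.restrict (Set.Ioi (0 : ℝ)), ∫ x, f (q + x ^ 2) ≠ 0 →
      ∀ y, 0 ≤ y → y < a * √q → condDistFun f q y = F y) : HasGaussianLaw Ustar P := by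
  have : Nontrivial (Unit ⊕ Fin d) := ⟨Sum.inl (), Sum.inr ⟨0, hd⟩, by simp⟩
  obtain ⟨A, b, hA, hb, hf⟩ := ae_eq_exp_of_separated (g := fun q => ∫ x, f (q + x ^ 2))
    (F := fun y => F y - F 0) hU.measurable_generator hU.generator_nonneg
    (fun r hr => hU.integrableOn_generator hr) hU.not_ae_eq_zero ha (by
      filter_upwards [h, hU.ae_Ioi_integrable_condGenerator hd, ae_restrict_mem measurableSet_Ioi]
        with q hq hI hq0 y hy hya
      have hq0' : (0 : ℝ) < q := hq0
      refine intervalIntegral_eq_mul_sub hU.generator_nonneg hq0'.le hI hy fun h0 => ?_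
      exact ⟨hq h0 y hy hya, hq h0 0 le_rfl (hy.trans_lt hya)⟩)
  exact hU.hasGaussianLaw_of_generator_eq_exp hA hb hf

theorem IsElliptical.marginalDensity_ne_zero_iff
    (hU : IsElliptical P Ustar 0 (starMatrix δ Ωbar) f) (z : EuclideanSpace ℝ (Fin d)) :
    marginalDensity δ Ωbar f z ≠ 0 ↔ ∫ x, f (invQuadForm Ωbar z + x ^ 2) ≠ 0 := by
  rw [marginalDensity_eq hU.posDef]
  simp [hU.marginalConst_pos.ne']

theorem IsElliptical.hasGaussianLaw_of_condDistFun_const (hd : 1 ≤ d)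
    (hU : IsElliptical P Ustar 0 (starMatrix δ Ωbar) f) {F : ℝ → ℝ}
    (h : ∀ᵐ z : EuclideanSpace ℝ (Fin d), marginalDensity δ Ωbar f z ≠ 0 →
      ∀ y, condDistFun f (invQuadForm Ωbar z) y = F y) : HasGaussianLaw Ustar P := by
  have : Nonempty (Fin d) := ⟨⟨0, hd⟩⟩
  have hΩ := posDef_of_starMatrix hU.posDef
  obtain ⟨T, hT, hdet⟩ := exists_norm_sq_eq_invQuadForm hΩ
  have hd0 : ENNReal.ofReal √Ωbar.det ≠ 0 := by simpa using Real.sqrt_pos.2 hΩ.det_pos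
  have h1 : ∀ᵐ q ∂volume.restrict (Set.Ioi (0 : ℝ)), ∫ x, f (q + x ^ 2) ≠ 0 →
      ∀ y, condDistFun f q y = F y := by
    refine ae_Ioi_of_ae_norm_sq (E := EuclideanSpace ℝ (Fin d)) ?_
    filter_upwards [ae_comp_symm_of_map_eq_smul hd0 hdet h] with w hw
    rwa [hU.marginalDensity_ne_zero_iff, ← hT, T.apply_symm_apply] at hw
  refine hU.hasGaussianLaw_of_condDistFun_eq (F := F) hd one_pos ?_
  filter_upwards [h1] with q hq h0 y _ _ using hq h0 y

theorem IsElliptical.aemeasurable_skewDensity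
    (hU : IsElliptical P Ustar 0 (starMatrix δ Ωbar) f) :
    AEMeasurable fun z : EuclideanSpace ℝ (Fin d) => 2 * marginalDensity δ Ωbar f z *
      condDistFun f (invQuadForm Ωbar z) (shapeParam δ Ωbar ⬝ᵥ z.ofLp) := by
  have hm := (measurable_ellipticalDensity (A := starMatrix δ Ωbar)
    hU.measurable_generator).comp measurable_joinVec
  refine ⟨fun z => 2 * ∫ u in Set.Ioi 0, ellipticalDensity 0 (starMatrix δ Ωbar) f (joinVec u z),
    (hm.stronglyMeasurable.integral_prod_left'
      (μ := volume.restrict (Set.Ioi (0 : ℝ)))).measurable.const_mul 2, ?_⟩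
  filter_upwards [hU.ae_integrable_condGenerator] with z hz
  rw [mul_assoc, marginalDensity_mul_condDistFun hU.posDef hU.generator_nonneg hz]

/-- Equal densities give `F^{r²}(⟪b, w⟫) = F(⟪b, w⟫)` for almost every radius `r` and almost every
direction. On a fixed sphere of dimension at least one, `⟪b, w⟫` takes all values in `[-‖b‖r,
‖b‖r]`, so the two functions agree on a dense subset and, by right continuity, on the whole cone `0
≤ y < ‖b‖√q`. -/
theorem IsElliptical.hasGaussianLaw_of_skewLaw_eq (hd : 2 ≤ d) (hδ : δ ≠ 0)
    (hU : IsElliptical P Ustar 0 (starMatrix δ Ωbar) f) {ν : Measure ℝ}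
    (h : skewLaw P Ustar = volume.withDensity fun z => ENNReal.ofReal
      (2 * marginalDensity δ Ωbar f z * cdf ν (shapeParam δ Ωbar ⬝ᵥ z.ofLp))) :
    HasGaussianLaw Ustar P := by
  have : Nonempty (Fin d) := ⟨⟨0, by omega⟩⟩
  have hΩ := posDef_of_starMatrix hU.posDef
  obtain ⟨T, hT, hdet⟩ := exists_norm_sq_eq_invQuadForm hΩ
  have hd0 : ENNReal.ofReal √Ωbar.det ≠ 0 := by simpa using Real.sqrt_pos.2 hΩ.det_pos
  set a : EuclideanSpace ℝ (Fin d) := WithLp.toLp 2 (shapeParam δ Ωbar) with ha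
  have hainner : ∀ z : EuclideanSpace ℝ (Fin d), shapeParam δ Ωbar ⬝ᵥ z.ofLp = ⟪a, z⟫ := by
    intro z
    rw [EuclideanSpace.inner_eq_star_dotProduct, dotProduct_comm]
    simp [ha]
  have ha0 : a ≠ 0 := by
    intro h0
    exact shapeParam_ne_zero hU.posDef hδ ((WithLp.toLp_eq_zero 2).1 h0)
  obtain ⟨b, hb⟩ := exists_inner_eq_inner_symm T a
  have hb0 := ne_zero_of_inner_eq_inner_symm hb ha0
  have hb0' : 0 < ‖b‖ := norm_pos_iff.2 hb0
  rw [hU.skewLaw_eq, withDensity_eq_iff_of_sigmaFinite hU.aemeasurable_skewDensity.ennreal_ofReal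
    (by
      have := hU.measurable_marginalDensity
      have := measurable_cdf ν
      simp only [hainner]
      exact Measurable.aemeasurable (by fun_prop))] at h
  have h1 : ∀ᵐ w : EuclideanSpace ℝ (Fin d), ∫ x, f (‖w‖ ^ 2 + x ^ 2) ≠ 0 →
      condDistFun f (‖w‖ ^ 2) ⟪b, w⟫ = cdf ν ⟪b, w⟫ := by
    filter_upwards [ae_comp_symm_of_map_eq_smul hd0 hdet h] with w hw h0
    have hQ : invQuadForm Ωbar (T.symm w) = ‖w‖ ^ 2 := by rw [← hT, T.apply_symm_apply]
    have hm := hU.marginalDensity_nonneg (T.symm w)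
    have hne := (hU.marginalDensity_ne_zero_iff (T.symm w)).2 (by rwa [hQ])
    have hc := condDistFun_nonneg hU.generator_nonneg (sq_nonneg ‖w‖) ⟪b, w⟫
    have hc' := cdf_nonneg ν ⟪b, w⟫
    rw [hainner, ← hb, hQ, ENNReal.ofReal_eq_ofReal_iff (by positivity) (by positivity)] at hw
    exact mul_left_cancel₀ (mul_ne_zero two_ne_zero hne) hw
  have hrank : 1 < Module.rank ℝ (EuclideanSpace ℝ (Fin d)) := by
    rw [← Module.finrank_eq_rank, finrank_euclideanSpace_fin]
    exact_mod_cast hd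
  refine hU.hasGaussianLaw_of_condDistFun_eq (F := cdf ν) (by omega) hb0' (ae_Ioi_of_ae_sq ?_)
  have hint := ae_polar hU.ae_integrable_condGenerator_norm
  filter_upwards [ae_polar h1, hint, ae_restrict_mem measurableSet_Ioi] with r hr hI hr0 h0 y hy hyr
  have hr0' : (0 : ℝ) < r := hr0
  have hnorm : ∀ s : Metric.sphere (0 : EuclideanSpace ℝ (Fin d)) 1, ‖r • s.val‖ = r := by
    intro s
    rw [norm_smul, Real.norm_of_nonneg hr0'.le, norm_eq_of_mem_sphere, mul_one]
  have hne : NeZero (volume : Measure (EuclideanSpace ℝ (Fin d))).toSphere :=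
    ⟨(volume : Measure (EuclideanSpace ℝ (Fin d))).toSphere_ne_zero⟩
  obtain ⟨s₀, hs₀⟩ := hI.exists
  rw [hnorm] at hs₀
  obtain ⟨ν', hν'⟩ := exists_cdf_eq_condDistFun hU.generator_nonneg (sq_nonneg r) hs₀ h0
  rw [Real.sqrt_sq hr0'.le] at hyr
  rw [hν']
  refine StieltjesFunction.eq_of_frequently_eq (l := -(‖b‖ * r)) (u := ‖b‖ * r) ?_
    (by nlinarith [mul_pos hb0' hr0']) hyr
  intro x x' hlx hxx' hxu
  have hopen : IsOpen {s : Metric.sphere (0 : EuclideanSpace ℝ (Fin d)) 1 |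
      x < ⟪b, r • s.val⟫ ∧ ⟪b, r • s.val⟫ < x'} :=
    (isOpen_lt (f := fun _ => x) (g := fun s : Metric.sphere (0 : EuclideanSpace ℝ (Fin d)) 1 =>
      ⟪b, r • s.val⟫) (by fun_prop) (by fun_prop)).inter
    (isOpen_lt (f := fun s : Metric.sphere (0 : EuclideanSpace ℝ (Fin d)) 1 =>
      ⟪b, r • s.val⟫) (g := fun _ => x') (by fun_prop) (by fun_prop))
  obtain ⟨s₁, hs₁, hs₁'⟩ := exists_mem_sphere_inner_eq hrank hb0 (y := (x + x') / 2 / r) (by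
    rw [abs_div, abs_of_pos hr0', div_le_iff₀ hr0', abs_le]
    constructor <;> linarith)
  have hnonempty : {s : Metric.sphere (0 : EuclideanSpace ℝ (Fin d)) 1 |
      x < ⟪b, r • s.val⟫ ∧ ⟪b, r • s.val⟫ < x'}.Nonempty := by
    refine ⟨⟨s₁, hs₁⟩, ?_⟩
    have : ⟪b, r • s₁⟫ = (x + x') / 2 := by
      rw [real_inner_smul_right, hs₁']; field_simp
    change x < ⟪b, r • s₁⟫ ∧ ⟪b, r • s₁⟫ < x'
    rw [this]
    constructor <;> linarith
  -- The spherical measure charges open sets, so good directions are dense.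
  obtain ⟨s, hs, hs'⟩ := Measure.dense_of_ae hr |>.exists_mem_open hopen hnonempty
  rw [Set.mem_ofPred_eq, hnorm] at hs
  exact ⟨_, hs'.1, hs'.2, by rw [← hν']; exact hs h0⟩

end Separation

/-! ### A skew normal `Z` forces normality -/

section SkewNormalProjection

open scoped RealInnerProductSpace

variable {d : ℕ}

theorem inner_toLp_eq_sum {ι : Type*} [Fintype ι] (t : ι → ℝ) (z : EuclideanSpace ℝ ι) :
    ⟪WithLp.toLp 2 t, z⟫ = ∑ i, t i * z.ofLp i := by
  rw [EuclideanSpace.inner_eq_star_dotProduct, dotProduct_comm]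
  simp [dotProduct]

/-- A linear functional proportional to the slant direction of a skew normal vector is univariate
skew normal. -/
theorem IsSkewNormal.exists_lintegral_inner_eq {μ : Measure (EuclideanSpace ℝ (Fin d))}
    {ξ : EuclideanSpace ℝ (Fin d)} {A : Matrix (Fin d) (Fin d) ℝ} {α : Fin d → ℝ}
    (h : IsSkewNormal μ ξ A α) {t : EuclideanSpace ℝ (Fin d)} (ht : t ≠ 0) {c : ℝ}
    (hc : ∀ z : EuclideanSpace ℝ (Fin d), ∑ i, α i * (z.ofLp i / √(A i i)) = c * ⟪t, z⟫) :
    ∃ s : ℝ, 0 < s ∧ ∀ g : ℝ → ENNReal, Measurable g → ∫⁻ z, g ⟪t, z⟫ ∂μ =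
      2 * ∫⁻ y, g (⟪t, ξ⟫ + s * y) * ENNReal.ofReal (cdf (gaussianReal 0 1) (c * s * y))
        ∂gaussianReal 0 1 := by
  obtain ⟨hA, hμ⟩ := h
  obtain ⟨T, hT, hdet⟩ := exists_norm_sq_eq_invQuadForm hA
  obtain ⟨t', ht'⟩ := exists_inner_eq_inner_symm T t
  have hs : 0 < ‖t'‖ := norm_pos_iff.2 (ne_zero_of_inner_eq_inner_symm ht' ht)
  refine ⟨‖t'‖, hs, fun g hg => ?_⟩
  have hΦ := measurable_cdf (gaussianReal 0 1)
  have hφ := (continuous_normalDensity (A := A)).measurable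
  have hdens : ∀ z, skewNormalDensity ξ A α z =
      2 * normalDensity A (z - ξ) * cdf (gaussianReal 0 1) (c * ⟪t, z - ξ⟫) := fun z => by
    rw [skewNormalDensity, hc]
  have hG : gaussianReal 0 (‖t'‖ ^ 2).toNNReal = (gaussianReal 0 1).map (‖t'‖ * ·) := by
    rw [gaussianReal_map_const_mul]
    congr 1
    · simp
    · ext; simp
  calc ∫⁻ z, g ⟪t, z⟫ ∂μ
      = ∫⁻ z, ENNReal.ofReal (normalDensity A (z - ξ)) * (2 * (g (⟪t, ξ⟫ + ⟪t, z - ξ⟫) *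
          ENNReal.ofReal (cdf (gaussianReal 0 1) (c * ⟪t, z - ξ⟫)))) := by
        rw [hμ, lintegral_withDensity_eq_lintegral_mul _ _ (by fun_prop)]
        · refine lintegral_congr fun z => ?_
          have hn := (normalDensity_pos hA (z - ξ)).le
          rw [Pi.mul_apply, hdens, ENNReal.ofReal_mul (by positivity),
            ENNReal.ofReal_mul zero_le_two, ENNReal.ofReal_ofNat, ← inner_add_right,
            add_sub_cancel]
          ring
        · simp only [funext hdens]
          fun_prop
    _ = ∫⁻ z, ENNReal.ofReal (normalDensity A z) * (2 * (g (⟪t, ξ⟫ + ⟪t, z⟫) *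
          ENNReal.ofReal (cdf (gaussianReal 0 1) (c * ⟪t, z⟫)))) :=
        lintegral_sub_right_eq_self (fun z => ENNReal.ofReal (normalDensity A z) *
          (2 * (g (⟪t, ξ⟫ + ⟪t, z⟫) *
            ENNReal.ofReal (cdf (gaussianReal 0 1) (c * ⟪t, z⟫))))) ξ
    _ = ∫⁻ z, 2 * (g (⟪t, ξ⟫ + ⟪t, z⟫) * ENNReal.ofReal (cdf (gaussianReal 0 1) (c * ⟪t, z⟫)))
          ∂volume.withDensity fun z => ENNReal.ofReal (normalDensity A z) := by
        rw [lintegral_withDensity_eq_lintegral_mul _ (by fun_prop) (by fun_prop)]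
        rfl
    _ = ∫⁻ w, 2 * (g (⟪t, ξ⟫ + ⟪t', w⟫) * ENNReal.ofReal (cdf (gaussianReal 0 1) (c * ⟪t', w⟫)))
          ∂stdGaussian (EuclideanSpace ℝ (Fin d)) := by
        rw [← map_normalDensity hA hT hdet, lintegral_map (by fun_prop) (by fun_prop)]
        simp only [ht', T.symm_apply_apply]
    _ = ∫⁻ x, 2 * (g (⟪t, ξ⟫ + x) * ENNReal.ofReal (cdf (gaussianReal 0 1) (c * x)))
          ∂gaussianReal 0 (‖t'‖ ^ 2).toNNReal := by
        rw [← stdGaussian_map_inner, lintegral_map (by fun_prop) (by fun_prop)]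
    _ = _ := by
        rw [hG, lintegral_map (by fun_prop) (by fun_prop), lintegral_const_mul _ (by fun_prop)]
        simp only [mul_assoc]

variable {δ : Fin d → ℝ} {Ωbar : Matrix (Fin d) (Fin d) ℝ} {f : ℝ → ℝ}
  {S : Type*} [MeasurableSpace S] {P : Measure S} [IsProbabilityMeasure P]
  {Ustar : S → EuclideanSpace ℝ (Unit ⊕ Fin d)}

theorem IsElliptical.skewLaw_eq_map (hU : IsElliptical P Ustar 0 (starMatrix δ Ωbar) f) :
    skewLaw P Ustar =
      2 • ((P.map Ustar).restrict {y | 0 < y.ofLp (Sum.inl ())}).map vecPart := by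
  have hmp : MeasurableSet {y : EuclideanSpace ℝ (Unit ⊕ Fin d) | 0 < y.ofLp (Sum.inl ())} :=
    measurableSet_lt measurable_const (by fun_prop)
  ext B hB
  rw [hU.skewLaw_apply hB, Measure.smul_apply, Measure.map_apply measurable_vecPart hB,
    Measure.restrict_apply (measurable_vecPart hB), Set.inter_comm]
  simp

/-- After standardisation `b` represents `u₀` and `a` represents `tᵀu`, with `t` along the slant
direction. The projected law of `Z` then says that the radial law is half skew normal in the
direction `a`, so `⟪a, w⟫` is normal and the whole radial law with it. -/
theorem IsElliptical.hasGaussianLaw_of_isSkewNormal (hd : 1 ≤ d)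
    (hU : IsElliptical P Ustar 0 (starMatrix δ Ωbar) f) {ξ : EuclideanSpace ℝ (Fin d)}
    {A : Matrix (Fin d) (Fin d) ℝ} {α : Fin d → ℝ} (h : IsSkewNormal (skewLaw P Ustar) ξ A α) :
    HasGaussianLaw Ustar P := by
  obtain ⟨t, c, ht, hc⟩ : ∃ (t : EuclideanSpace ℝ (Fin d)) (c : ℝ), t ≠ 0 ∧
      ∀ z : EuclideanSpace ℝ (Fin d), ∑ i, α i * (z.ofLp i / √(A i i)) = c * ⟪t, z⟫ := by
    have hsum : ∀ z : EuclideanSpace ℝ (Fin d), ∑ i, α i * (z.ofLp i / √(A i i)) =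
        ⟪WithLp.toLp 2 fun i => α i / √(A i i), z⟫ := fun z => by
      rw [inner_toLp_eq_sum]
      exact Finset.sum_congr rfl fun i _ => by ring
    by_cases h0 : (WithLp.toLp 2 fun i => α i / √(A i i) : EuclideanSpace ℝ (Fin d)) = 0
    -- Without slant any nonzero `t` serves, with `c = 0`.
    · refine ⟨EuclideanSpace.single ⟨0, hd⟩ 1, 0, by simp, fun z => ?_⟩
      rw [hsum, h0, inner_zero_left, zero_mul]
    · exact ⟨_, 1, h0, fun z => by rw [hsum, one_mul]⟩
  obtain ⟨s, hs, hproj⟩ := h.exists_lintegral_inner_eq ht hc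
  obtain ⟨T, hT, hdet⟩ := exists_norm_sq_eq_invQuadForm hU.posDef
  obtain ⟨a, ha⟩ := exists_inner_eq_inner_symm T (joinVec 0 t)
  obtain ⟨b, hb⟩ := exists_inner_eq_inner_symm T
    (EuclideanSpace.single (Sum.inl () : Unit ⊕ Fin d) (1 : ℝ))
  have hinner : ∀ y, ⟪joinVec 0 t, y⟫ = ⟪t, vecPart y⟫ := by
    intro y
    rw [joinVec, inner_toLp_eq_sum, Fintype.sum_sum_type, ← WithLp.toLp_ofLp 2 t,
      inner_toLp_eq_sum]
    simp [vecPart]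
  have hcoord : ∀ y : EuclideanSpace ℝ (Unit ⊕ Fin d),
      ⟪EuclideanSpace.single (Sum.inl () : Unit ⊕ Fin d) (1 : ℝ), y⟫ = y.ofLp (Sum.inl ()) := by
    intro y
    simp [EuclideanSpace.inner_single_left]
  have htt : ⟪t, t⟫ ≠ 0 := fun h0 => ht (inner_self_eq_zero.1 h0)
  have haT : ⟪a, T (joinVec 0 t)⟫ = ⟪t, t⟫ := by
    rw [ha, T.symm_apply_apply, hinner, vecPart_joinVec]
  have hbT : ⟪b, T (joinVec 0 t)⟫ = 0 := by
    rw [hb, T.symm_apply_apply, hcoord]; rfl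
  have hb0 : b ≠ 0 := ne_zero_of_inner_eq_inner_symm hb (by simp)
  have ha0 : a ≠ 0 := by
    rintro rfl
    rw [inner_zero_left] at haT
    exact htt haT.symm
  -- `a` is not a multiple of `b`: the vector `T (0, t)` is orthogonal to `b` but not to `a`.
  have hK : 0 < rejSq a b := by
    rw [← norm_sub_proj_sq hb0]
    refine pow_pos (norm_pos_iff.2 fun h0 => htt ?_) 2
    rw [← haT, sub_eq_zero.1 h0, real_inner_smul_left, hbT, mul_zero]
  have hprob := hU.isProbabilityMeasure_radialMeasure
  have hpm := measurable_sphericalProfile (ι := Unit ⊕ Fin d) hU.measurable_generator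
  have H : IsHalfSkewNormal
      (radialMeasure (EuclideanSpace ℝ (Unit ⊕ Fin d)) (sphericalProfile (Unit ⊕ Fin d) f))
      a b ⟪t, ξ⟫ s (c * s) := by
    intro g hg
    have hvm := measurable_vecPart (d := d)
    have hmb : MeasurableSet {w : EuclideanSpace ℝ (Unit ⊕ Fin d) | 0 < ⟪b, w⟫} :=
      measurableSet_lt measurable_const (by fun_prop)
    have h1 := hproj g hg
    rw [hU.skewLaw_eq_map, lintegral_smul_measure, lintegral_map (by fun_prop) hvm] at h1
    have h2 : ∫⁻ w in {w | 0 < ⟪b, w⟫}, g ⟪a, w⟫ ∂((P.map Ustar).map T) =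
        ∫⁻ y in {y | 0 < y.ofLp (Sum.inl ())}, g ⟪t, vecPart y⟫ ∂(P.map Ustar) := by
      rw [setLIntegral_map hmb (by fun_prop) T.continuous.measurable]
      simp only [ha, hb, T.symm_apply_apply, hinner, hcoord, Set.preimage_ofPred_eq]
    rw [hU.map_eq_radialMeasure hT hdet] at h2
    rw [h2]
    rw [nsmul_eq_mul, Nat.cast_ofNat] at h1
    exact (ENNReal.mul_right_inj two_ne_zero ENNReal.ofNat_ne_top).1 h1
  rw [hU.hasGaussianLaw_iff,
    radialMeasure_eq_stdGaussian_map hpm ha0 hs (H.map_inner_eq hpm hs ha0 hb0 hK)]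
  exact isGaussian_stdGaussian_map_smul _

end SkewNormalProjection

/-! ### Consequences of Gaussianity and the main theorem -/

section Characterisation

variable {d : ℕ} {δ : Fin d → ℝ} {Ωbar : Matrix (Fin d) (Fin d) ℝ} {f : ℝ → ℝ}
  {S : Type*} [MeasurableSpace S] {P : Measure S} [IsProbabilityMeasure P]
  {Ustar : S → EuclideanSpace ℝ (Unit ⊕ Fin d)}

theorem IsElliptical.exists_condDistFun_eq_cdf (hU : IsElliptical P Ustar 0 (starMatrix δ Ωbar) f)
    (hG : HasGaussianLaw Ustar P) :
    ∃ ν : Measure ℝ, IsProbabilityMeasure ν ∧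
      ∀ (z : EuclideanSpace ℝ (Fin d)) (y : ℝ),
        condDistFun f (invQuadForm Ωbar z) y = cdf ν y := by
  obtain ⟨σ, a, hσ, ha, hf⟩ := hU.generator_eq_exp_of_hasGaussianLaw hG
  exact ⟨gaussianReal 0 (σ ^ 2).toNNReal, inferInstance, fun z y =>
    condDistFun_eq_cdf_gaussianReal hσ ha
      (invQuadForm_nonneg (posDef_of_starMatrix hU.posDef) z) hf y⟩

theorem IsElliptical.exists_isSkewNormal_of_hasGaussianLaw
    (hU : IsElliptical P Ustar 0 (starMatrix δ Ωbar) f) (hdiag : ∀ i, Ωbar i i = 1)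
    (hG : HasGaussianLaw Ustar P) :
    ∃ σ : ℝ, 0 < σ ∧ IsSkewNormal (skewLaw P Ustar) 0 (σ ^ 2 • Ωbar) (shapeParam δ Ωbar) := by
  obtain ⟨σ, a, hσ, ha, hf⟩ := hU.generator_eq_exp_of_hasGaussianLaw hG
  exact ⟨σ, hσ, hU.isSkewNormal_of_generator_eq_exp hdiag hσ ha hf⟩

end Characterisation

end

theorem proposition6 {S : Type*} [MeasurableSpace S] (P : Measure S) [IsProbabilityMeasure P]
    (d : ℕ) (hd : 1 ≤ d) (δ : Fin d → ℝ) (Ωbar : Matrix (Fin d) (Fin d) ℝ)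
    (hΩ : IsFullRankCorrelation (starMatrix δ Ωbar)) (f : ℝ → ℝ)
    (Ustar : S → EuclideanSpace ℝ (Unit ⊕ Fin d))
    (hU : IsElliptical P Ustar 0 (starMatrix δ Ωbar) f) :
    -- the skewing argument can be taken to be `w(z) = αᵀ z` iff `U*` is Gaussian
    (2 ≤ d → δ ≠ 0 →
      ((∃ (ν : Measure ℝ) (w : EuclideanSpace ℝ (Fin d) → ℝ),
          IsSkewingRepresentation P Ustar δ Ωbar f ν w ∧
            ∀ z, w z = shapeParam δ Ωbar ⬝ᵥ z.ofLp) ↔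
        HasGaussianLaw Ustar P)) ∧
    -- `Q_z` is absent from the conditional distribution function iff `U*` is Gaussian
    ((∃ ν : Measure ℝ, IsProbabilityMeasure ν ∧
        ∀ᵐ z : EuclideanSpace ℝ (Fin d), marginalDensity δ Ωbar f z ≠ 0 →
          ∀ y, condDistFun f (invQuadForm Ωbar z) y = cdf ν y) ↔
      HasGaussianLaw Ustar P) ∧
    -- `U*` is Gaussian iff `Z` is skew normal
    List.TFAE [
      HasGaussianLaw Ustar P,
      ∃ σ : ℝ, 0 < σ ∧
        IsSkewNormal (skewLaw P Ustar) 0 (σ ^ 2 • Ωbar) (shapeParam δ Ωbar),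
      ∃ (ξ : EuclideanSpace ℝ (Fin d)) (A : Matrix (Fin d) (Fin d) ℝ) (α : Fin d → ℝ),
        IsSkewNormal (skewLaw P Ustar) ξ A α] := by
  refine ⟨fun hd2 hδ => ⟨?_, fun hG => ?_⟩, ⟨?_, fun hG => ?_⟩, ?_⟩
  · rintro ⟨ν, w, ⟨-, -, hlaw⟩, hw⟩
    simp only [hw] at hlaw
    exact hU.hasGaussianLaw_of_skewLaw_eq hd2 hδ hlaw
  · obtain ⟨ν, hν, hcdf⟩ := hU.exists_condDistFun_eq_cdf hG
    refine ⟨ν, fun z => shapeParam δ Ωbar ⬝ᵥ z.ofLp, ⟨hν, ⟨fun x _ => x, fun _ => rfl⟩, ?_⟩,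
      fun _ => rfl⟩
    simp only [hU.skewLaw_eq, hcdf]
  · rintro ⟨ν, -, h⟩
    exact hU.hasGaussianLaw_of_condDistFun_const hd h
  · obtain ⟨ν, hν, hcdf⟩ := hU.exists_condDistFun_eq_cdf hG
    exact ⟨ν, hν, ae_of_all _ fun z _ => hcdf z⟩
  · tfae_have 1 → 2 := hU.exists_isSkewNormal_of_hasGaussianLaw fun i => hΩ.2 (Sum.inr i)
    tfae_have 2 → 3 := fun ⟨σ, _, h⟩ => ⟨0, σ ^ 2 • Ωbar, shapeParam δ Ωbar, h⟩
    tfae_have 3 → 1 := fun ⟨_, _, _, h⟩ => hU.hasGaussianLaw_of_isSkewNormal hd h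
    tfae_finish
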